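/- Terminology. An arc is a homeomorphic copy of $[0,1]$. A continuum is a nonempty compact connected metrizable space. A dendroid is an arcwise connected, hereditarily unicoherent continuum; any two distinct points $x,y$ of it are the endpoints of a unique arc $[x,y]$ (and $[x,x]=\{x\}$). A point $e$ is an endpoint of a dendroid if it is an endpoint of every arc that contains it. A fan is a dendroid $F$ with exactly one ramification point $t$ (a point that is the top of a simple triod, i.e. of three arcs glued together at a common endpoint); $t$ is called the top of $F$, $E(F)$ is the set of endpoints of $F$, and the arcs $[t,e]$ with $e\in E(F)$ are the blades of $F$. The fan is smooth if $[t,x_n]\to[t,x]$ in the Hausdorff metric whenever $x_n\to x$. It is endpoint-homogeneous if for all $e,e'\in E(F)$ there is a homeomorphism $h:F\to F$ with $h(e)=e'$. For $X\subseteq[0,1]$, $F$ is $X$-EPG if for every blade $B$ there is a homeomorphism $\phi:[0,1]\to B$ with $\phi(0)=t$ and $\phi[X]=B\cap\overline{E(F)\setminus B}$. A space is $\frac1n$-homogeneous if it can be partitioned into $n$ nonempty sets, but no fewer, such that any two points in the same piece are mapped one to the other by a self-homeomorphism of the space; equivalently, its homeomorphism group has exactly $n$ orbits. Combs. A comb is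 a closed set $C\subseteq[0,1]^2$ whose horizontal sections $C_y=\{x:(x,y)\in C\}$ satisfy: $C_0=[0,1]$; $C_y$ is contained in the Cantor ternary set for all $y\in(0,1]$; $C_{y_1}\supseteq C_{y_2}$ whenever $y_1<y_2$; and $|C_y|>2$ for some $y\in(0,1]$. Its fan $F_C$ is the quotient space obtained from $C$ by collapsing $[0,1]\times\{0\}$ to a point. Let $X$ be a closed subset of $[0,1]$ with $0\in X$, $1\notin X$, $X\neq\{0\}$, and let $M=\max X$. Let $D$ be a countable dense subset of $X\setminus\{0\}$ and $(y_n)_{n\ge1}$ a sequence in $D$ that takes every value $d\in D$ infinitely often. A comb associated with $X$ is any set $$C=[0,1]\times\{0\}\ \cup\ \{0\}\times[0,1]\ \cup\bigcup_{k\ge1}\ \bigcup_{n_1,\dots,n_k\ge1}\Big\{2\sum_{i=1}^k 3^{-(n_1+\dots+n_i)}\Big\}\times\Big[0,\ M^{n_1+\dots+n_{k-1}}\prod_{i=1}^k y_{n_i}\Big]$$ obtained from such a choice of $D$ and $(y_n)$. Theorem. For every $n\ge5$ there is an endpoint-homogeneous, $\frac1n$-homogeneous smooth fan. More precisely: (a)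 Let $n\ge5$ be odd, $m=\frac{n-3}2$, $0<a_1<\dots<a_m<1$ and $X=\{0,a_1,\dots,a_m\}$. Then every set $C$ associated with $X$ as above is a comb, and $F_C$ is an endpoint-homogeneous, $\frac1n$-homogeneous, $X$-EPG smooth fan. (b) Let $n\ge6$ be even and $m=\frac{n-4}2$. Let $(p_i)_{i\in\mathbb Z}$ be a strictly increasing family of real numbers with $\lim_{i\to-\infty}p_i=0$ and $\lim_{i\to\infty}p_i=a_1$, where $a_1<a_2<\dots<a_m<1$, and let $X=\{p_i:i\in\mathbb Z\}\cup\{0,a_1,\dots,a_m\}$. Then every set $C$ associated with $X$ as above is a comb, and $F_C$ is an endpoint-homogeneous, $\frac1n$-homogeneous, $X$-EPG smooth fan. In each case the homeomorphism group of the fan has exactly $n$ orbits. -/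

import Mathlib

open Set Filter Topology

namespace Fans

/-! ### Continua, arcs, dendroids, fans -/

/-- A continuum is a nonempty compact connected metrizable space. -/
structure IsContinuum (X : Type*) [TopologicalSpace X] : Prop where
  compact : CompactSpace X
  connected : ConnectedSpace X
  metrizable : TopologicalSpace.MetrizableSpace X

section Spaces

variable {X : Type*} [TopologicalSpace X]

/-- The subset `A` is a continuum in the subspace topology (`X` is metrizable in all uses;
`IsConnected` includes nonemptiness). -/
def IsSubcontinuum (A : Set X) : Prop := IsCompact A ∧ IsConnected A

/-- A subcontinuum `Y` is unicoherent: whenever it is the union of two subcontinua, these have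
connected intersection. -/
def IsUnicoherent (Y : Set X) : Prop :=
  ∀ A B : Set X, IsSubcontinuum A → IsSubcontinuum B → A ∪ B = Y → IsConnected (A ∩ B)

/-- `A` is an arc (a homeomorphic copy of `[0,1]`) with endpoints `x` and `y`. -/
def IsArcBetween (A : Set X) (x y : X) : Prop :=
  ∃ φ : unitInterval → X, IsEmbedding φ ∧ range φ = A ∧ φ 0 = x ∧ φ 1 = y

/-- `A` is the arc with endpoints `x ≠ y`, or the singleton `{x}` if `x = y`. In a dendroid there
is exactly one such set, which is denoted `[x, y]`. -/
def IsSegment (A : Set X) (x y : X) : Prop :=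
  IsArcBetween A x y ∨ (x = y ∧ A = {x})

variable (X) in
/-- The endpoints of `X`: the points that are an endpoint of every arc that contains them. -/
def endpoints : Set X :=
  {x | ∀ (A : Set X) (a b : X), IsArcBetween A a b → x ∈ A → x = a ∨ x = b}

variable (X) in
/-- The ramification points of `X`: the tops of simple triods, that is, of triples of arcs glued
together at a common endpoint. -/
def ramificationPoints : Set X :=
  {t | ∃ (A B C : Set X) (a b c : X),
    IsArcBetween A t a ∧ IsArcBetween B t b ∧ IsArcBetween C t c ∧
      A ∩ B = {t} ∧ A ∩ C = {t} ∧ B ∩ C = {t}}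

variable (X) in
/-- A dendroid is an arcwise connected, hereditarily unicoherent continuum. -/
structure IsDendroid : Prop where
  continuum : IsContinuum X
  arcwise : ∀ x y : X, x ≠ y → ∃ A : Set X, IsArcBetween A x y
  unicoherent : ∀ Y : Set X, IsSubcontinuum Y → IsUnicoherent Y

/-- `t` is the top of `X`: its only ramification point. -/
def IsTop (t : X) : Prop := ramificationPoints X = {t}

variable (X) in
/-- A fan is a dendroid with exactly one ramification point. -/
def IsFan : Prop := IsDendroid X ∧ ∃ t : X, IsTop t

variable (X) in
/-- A fan with top `t` is smooth if `[t, x n]` converges to `[t, x']` whenever `x n` converges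
to `x'`. The convergence is the one of Mathlib's topology on the nonempty compact subsets (the
Vietoris topology), which for any compatible metric is the topology of the Hausdorff metric. -/
def IsSmoothFan : Prop :=
  IsFan X ∧ ∀ t : X, IsTop t → ∀ (x : ℕ → X) (x' : X), Tendsto x atTop (𝓝 x') →
    ∀ (A : ℕ → TopologicalSpace.NonemptyCompacts X) (A' : TopologicalSpace.NonemptyCompacts X),
      (∀ n, IsSegment (A n : Set X) t (x n)) → IsSegment (A' : Set X) t x' →
        Tendsto A atTop (𝓝 A')

variable (X) in
/-- Any two endpoints are exchanged by a self-homeomorphism. -/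
def IsEndpointHomogeneous : Prop :=
  ∀ e ∈ endpoints X, ∀ e' ∈ endpoints X, ∃ h : X ≃ₜ X, h e = e'

/-- `F` is an `S`-endpoint generated fan, for `S ⊆ [0,1]`: every blade `B = [t, e]` is the image
of a homeomorphism `φ : [0,1] → B` with `φ 0 = t` that maps `S` onto the set of points of `B`
that are limits of endpoints of `F` outside `B`. -/
def IsEPG (S : Set ℝ) (F : Type*) [TopologicalSpace F] : Prop :=
  IsFan F ∧ ∀ t : F, IsTop t → ∀ e ∈ endpoints F, ∀ B : Set F, IsArcBetween B t e →
    ∃ φ : unitInterval → F, IsEmbedding φ ∧ range φ = B ∧ φ 0 = t ∧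
      φ '' {s | (s : ℝ) ∈ S} = B ∩ closure (endpoints F \ B)

/-- `X` can be partitioned into `k` (nonempty) pieces, the fibres of `P`, such that any two points
in the same piece are exchanged by a self-homeomorphism of `X`. -/
def HasHomogeneousPartition (k : ℕ) (X : Type*) [TopologicalSpace X] : Prop :=
  ∃ P : X → Fin k, Function.Surjective P ∧ ∀ x y, P x = P y → ∃ h : X ≃ₜ X, h x = y

/-- `X` is `1/n`-homogeneous: there is such a partition into `n` pieces, but no fewer. -/
def IsOneDivHomogeneous (n : ℕ) (X : Type*) [TopologicalSpace X] : Prop :=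
  IsLeast {k : ℕ | HasHomogeneousPartition k X} n

variable (X) in
/-- The set of orbits of the homeomorphism group of `X`. -/
def homeoOrbits : Set (Set X) := range fun x : X => {y | ∃ h : X ≃ₜ X, h x = y}

end Spaces

/-! ### Combs and their fans -/

/-- A comb over the Cantor set. The horizontal section of `C` at height `y` is
`{x | (x, y) ∈ C}`. -/
structure IsComb (C : Set (ℝ × ℝ)) : Prop where
  subset : C ⊆ Icc 0 1 ×ˢ Icc 0 1
  closed : IsClosed C
  bottom : {x | (x, (0 : ℝ)) ∈ C} = Icc 0 1
  cantor : ∀ y ∈ Ioc (0 : ℝ) 1, {x | (x, y) ∈ C} ⊆ cantorSet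
  antitone : ∀ y₁ ∈ Icc (0 : ℝ) 1, ∀ y₂ ∈ Icc (0 : ℝ) 1, y₁ < y₂ →
    {x | (x, y₂) ∈ C} ⊆ {x | (x, y₁) ∈ C}
  three : ∃ y ∈ Ioc (0 : ℝ) 1, 2 < {x | (x, y) ∈ C}.encard

/-- The equivalence relation on `C` that identifies all points on the horizontal axis. -/
def combSetoid (C : Set (ℝ × ℝ)) : Setoid C where
  r p q := p = q ∨ ((p : ℝ × ℝ).2 = 0 ∧ (q : ℝ × ℝ).2 = 0)
  iseqv :=
    { refl := fun _ => Or.inl rfl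
      symm := by
        rintro p q (h | ⟨h, h'⟩)
        · exact Or.inl h.symm
        · exact Or.inr ⟨h', h⟩
      trans := by
        rintro p q r (rfl | ⟨h, h'⟩) (rfl | ⟨k, k'⟩)
        · exact Or.inl rfl
        · exact Or.inr ⟨k, k'⟩
        · exact Or.inr ⟨h, h'⟩
        · exact Or.inr ⟨h, k'⟩ }

/-- The fan of the comb `C`: the quotient of `C` that collapses `[0,1] × {0}` to a point. -/
def CombFan (C : Set (ℝ × ℝ)) : Type := Quotient (combSetoid C)

instance (C : Set (ℝ × ℝ)) : TopologicalSpace (CombFan C) :=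
  inferInstanceAs (TopologicalSpace (Quotient (combSetoid C)))

/-- The horizontal position of the blade with index `(n₁, …, nₖ)`, namely
`2 * ∑ i ≤ k, (1/3) ^ (n₁ + ⋯ + nᵢ)`; for `k = 0` it is `0`. -/
noncomputable def bladePos (l : List ℕ+) : ℝ :=
  2 * ∑ i ∈ Finset.range l.length, (1 / 3 : ℝ) ^ ((l.take (i + 1)).map PNat.val).sum

/-- The height of the blade with index `(n₁, …, nₖ)`, namely
`M ^ (n₁ + ⋯ + nₖ₋₁) * (y n₁ * ⋯ * y nₖ)`; for `k = 0` it is `1`. -/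
noncomputable def bladeHeight (M : ℝ) (y : ℕ+ → ℝ) (l : List ℕ+) : ℝ :=
  M ^ (l.dropLast.map PNat.val).sum * (l.map y).prod

/-- The union of `[0,1] × {0}` and of all the blades `{bladePos l} × [0, bladeHeight M y l]`,
where `l` ranges over the finite sequences of positive integers, the empty one included. -/
def comb (M : ℝ) (y : ℕ+ → ℝ) : Set (ℝ × ℝ) :=
  Icc 0 1 ×ˢ {0} ∪ ⋃ l : List ℕ+, {bladePos l} ×ˢ Icc 0 (bladeHeight M y l)

/-- The data of the construction for a set `S`: `M` is the maximum of `S`, and `y` is a sequence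
in a countable dense subset `D` of `S \ {0}` that takes every value in `D` infinitely often. -/
def IsCombData (S : Set ℝ) (M : ℝ) (y : ℕ+ → ℝ) : Prop :=
  IsGreatest S M ∧ ∃ D : Set ℝ, D.Countable ∧ D ⊆ S \ {0} ∧ S \ {0} ⊆ closure D ∧
    (∀ n, y n ∈ D) ∧ ∀ d ∈ D, {n | y n = d}.Infinite

end Fans

namespace Fans

/-! ### Arcs in topological spaces -/

section Arcs

variable {X Y : Type*} [TopologicalSpace X] [TopologicalSpace Y]

/-! The blades form a self-similar tree. The children `l ++ [j]` of a blade `l` converge to it in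
position as `j → ∞`, while every proper descendant of `l ++ [j]` has height at most `M ^ j`. So away
from the top only its own children accumulate on a blade, and the limits on the root blade of the
other ends are `0` and the closure of the values of `y`, which together make up `X`.

All blades except the root have height at most `M < 1`. The branch growing from `[n]` is therefore a
copy of the whole fan: heights in `[0, M]` are multiplied by `M ^ n * y n`, and the free interval
`[M, 1]` is stretched so that `1` goes to `y n` (`exists_branch_iso`). Since `y` takes each value
infinitely often, removing the child `[n]` leaves the root with enough children of every height, so
a homeomorphism can exchange the root with `[n]` (`exists_bladeMap_swap`). Lifted into branches,
such exchanges make the homeomorphism group transitive on blades. This gives endpoint-homogeneity,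
reduces the EPG property to the root, and shows that every orbit meets the root blade `[0,1]`.

A homeomorphism that sends some point of the root other than the top into the root maps the root
onto itself and acts there as an increasing map preserving `X`. Conversely, an increasing map
preserving the values of `y` extends to the fan (`exists_bladeMap_root`). The orbits are thus
classified by `pointType`. If `X` is `0` together with `k` points, the classes are `0`, `1`, the `k`
points and the `k + 1` gaps: `2k + 3`. With a bi-infinite sequence below `a 0`, shifts merge all its
terms into one class and all gaps between them into another; with `0`, `1`, the `k` points `a i` and
the `k` gaps above them this makes `2k + 4`.

For the continuum theory, `(x, s) ↦ (s x, s)` embeds the fan in the plane as countably many segments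
from the origin. Lines through the origin that avoid all blades separate them, which yields unique
arcs and unicoherence; smoothness is the continuity of the radial contraction. -/

theorem IsArcBetween.symm {A : Set X} {x y : X} (h : IsArcBetween A x y) :
    IsArcBetween A y x := by
  obtain ⟨φ, hφ, hr, h0, h1⟩ := h
  refine ⟨φ ∘ unitInterval.symm, hφ.comp unitInterval.symmHomeomorph.isEmbedding, ?_, ?_, ?_⟩
  · rw [unitInterval.symm_bijective.surjective.range_comp, hr]
  · simp [h1]
  · simp [h0]

theorem IsArcBetween.ne {A : Set X} {x y : X} (h : IsArcBetween A x y) : x ≠ y := by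
  obtain ⟨φ, hφ, -, rfl, rfl⟩ := h
  exact fun h => zero_ne_one (hφ.injective h)

theorem IsArcBetween.left_mem {A : Set X} {x y : X} (h : IsArcBetween A x y) : x ∈ A := by
  obtain ⟨φ, -, rfl, rfl, -⟩ := h
  exact mem_range_self _

theorem IsArcBetween.right_mem {A : Set X} {x y : X} (h : IsArcBetween A x y) : y ∈ A :=
  h.symm.left_mem

theorem IsArcBetween.isCompact {A : Set X} {x y : X} (h : IsArcBetween A x y) : IsCompact A := by
  obtain ⟨φ, hφ, rfl, -, -⟩ := h
  exact isCompact_range hφ.continuous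

theorem IsArcBetween.isPreconnected {A : Set X} {x y : X} (h : IsArcBetween A x y) :
    IsPreconnected A := by
  obtain ⟨φ, hφ, rfl, -, -⟩ := h
  exact isPreconnected_range hφ.continuous

/-- An arc is irreducible between its endpoints. -/
theorem IsArcBetween.eq_of_subset {A Z : Set X} {x y : X} (h : IsArcBetween A x y)
    (hZ : IsPreconnected Z) (hZA : Z ⊆ A) (hx : x ∈ Z) (hy : y ∈ Z) : A = Z := by
  obtain ⟨φ, hφ, rfl, rfl, rfl⟩ := h
  refine Subset.antisymm ?_ hZA
  have hpre : IsPreconnected (φ ⁻¹' Z) := by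
    rw [← hφ.isInducing.isPreconnected_image, image_preimage_eq_of_subset hZA]
    exact hZ
  rintro _ ⟨r, rfl⟩
  exact hpre.Icc_subset (a := 0) (b := 1) hx hy ⟨r.2.1, r.2.2⟩

theorem IsArcBetween.image {A : Set X} {x y : X} (h : IsArcBetween A x y) (f : X ≃ₜ Y) :
    IsArcBetween (f '' A) (f x) (f y) := by
  obtain ⟨φ, hφ, rfl, rfl, rfl⟩ := h
  exact ⟨f ∘ φ, f.isEmbedding.comp hφ, range_comp _ _, rfl, rfl⟩

theorem isArcBetween_image_Icc [T2Space X] {γ : ℝ → X} {a b : ℝ} (hab : a < b)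
    (hc : Continuous γ) (hi : InjOn γ (Icc a b)) :
    IsArcBetween (γ '' Icc a b) (γ a) (γ b) := by
  have hm : ∀ r : unitInterval, a + r * (b - a) ∈ Icc a b := fun r =>
    ⟨by nlinarith [r.2.1], by nlinarith [r.2.2]⟩
  refine ⟨fun r => γ (a + r * (b - a)), ?_, ?_, by simp, by simp⟩
  · refine (Continuous.isClosedEmbedding (by fun_prop) fun r r' h => ?_).isEmbedding
    have := hi (hm r) (hm r') h
    have h2 : (r : ℝ) * (b - a) = r' * (b - a) := by linarith
    exact Subtype.ext (mul_right_cancel₀ (by linarith) h2)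
  · ext x
    constructor
    · rintro ⟨r, rfl⟩
      exact ⟨_, hm r, rfl⟩
    · rintro ⟨s, hs, rfl⟩
      refine ⟨⟨(s - a) / (b - a), div_nonneg (by linarith [hs.1]) (by linarith),
        (div_le_one (by linarith)).2 (by linarith [hs.2])⟩, ?_⟩
      have : b - a ≠ 0 := by linarith
      simp only
      congr 1
      field_simp
      ring

theorem Homeomorph.map_endpoints (f : X ≃ₜ Y) {x : X} (hx : x ∈ endpoints X) :
    f x ∈ endpoints Y := by
  intro A a b hA hxA
  have := hx _ _ _ (hA.image f.symm) ⟨_, hxA, f.symm_apply_apply x⟩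
  simpa [f.eq_symm_apply] using this

theorem Homeomorph.image_endpoints (f : X ≃ₜ Y) : f '' endpoints X = endpoints Y := by
  refine Subset.antisymm (image_subset_iff.2 fun x hx => Homeomorph.map_endpoints f hx) ?_
  intro y hy
  exact ⟨f.symm y, Homeomorph.map_endpoints f.symm hy, f.apply_symm_apply y⟩

theorem Homeomorph.map_ramificationPoints (f : X ≃ₜ Y) {x : X} (hx : x ∈ ramificationPoints X) :
    f x ∈ ramificationPoints Y := by
  obtain ⟨A, B, C, a, b, c, hA, hB, hC, h1, h2, h3⟩ := hx
  refine ⟨_, _, _, _, _, _, hA.image f, hB.image f, hC.image f, ?_, ?_, ?_⟩ <;>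
    rw [← image_inter f.injective, ‹_ ∩ _ = _›, image_singleton]

theorem Homeomorph.map_top {t : X} (ht : IsTop t) (f : X ≃ₜ X) : f t = t := by
  have : f t ∈ ramificationPoints X :=
    Homeomorph.map_ramificationPoints f (by rw [ht]; exact mem_singleton t)
  rwa [ht] at this

end Arcs

/-! ### Planar models of fans -/

/-- A presentation of `F` as the union of countably many segments in the plane that share an
endpoint: the blade with index `l` is the segment from the origin to `len l • (pos l, 1)`. -/
structure FanModel (ι F : Type*) [TopologicalSpace F] where
  pos : ι → ℝ
  len : ι → ℝ
  coord : F → ℝ × ℝ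
  pt : ι → ℝ → F
  top : F
  pos_injective : Function.Injective pos
  len_pos : ∀ l, 0 < len l
  isEmbedding : IsEmbedding coord
  coord_top : coord top = 0
  coord_pt : ∀ l s, 0 ≤ s → s ≤ len l → coord (pt l s) = (s * pos l, s)
  continuous_pt : ∀ l, Continuous (pt l)
  exists_pt : ∀ x, ∃ l s, 0 ≤ s ∧ s ≤ len l ∧ pt l s = x

namespace FanModel

variable {ι F : Type*} [TopologicalSpace F] (G : FanModel ι F)

/-- The height of a point above the top. -/
def ht (x : F) : ℝ := (G.coord x).2

theorem continuous_coord : Continuous G.coord := G.isEmbedding.continuous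

theorem continuous_ht : Continuous G.ht := G.continuous_coord.snd

theorem ht_pt {l : ι} {s : ℝ} (h0 : 0 ≤ s) (h1 : s ≤ G.len l) : G.ht (G.pt l s) = s := by
  rw [ht, G.coord_pt l s h0 h1]

theorem pt_zero (l : ι) : G.pt l 0 = G.top := by
  apply G.isEmbedding.injective
  rw [G.coord_pt l 0 le_rfl (G.len_pos l).le, G.coord_top]
  simp

theorem ht_top : G.ht G.top = 0 := by simp [ht, G.coord_top]

/-- The index of a blade that contains a given point. -/
noncomputable def idx (x : F) : ι := (G.exists_pt x).choose

theorem idx_spec (x : F) : 0 ≤ G.ht x ∧ G.ht x ≤ G.len (G.idx x) ∧ G.pt (G.idx x) (G.ht x) = x := by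
  obtain ⟨s, h0, h1, h⟩ := (G.exists_pt x).choose_spec
  have : G.ht x = s := by rw [← h, G.ht_pt h0 h1]
  rw [this]
  exact ⟨h0, h1, h⟩

theorem ht_nonneg (x : F) : 0 ≤ G.ht x := (G.idx_spec x).1

theorem ht_le (x : F) : G.ht x ≤ G.len (G.idx x) := (G.idx_spec x).2.1

theorem pt_idx (x : F) : G.pt (G.idx x) (G.ht x) = x := (G.idx_spec x).2.2

theorem coord_eq (x : F) : G.coord x = (G.ht x * G.pos (G.idx x), G.ht x) := by
  conv_lhs => rw [← G.pt_idx x]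
  exact G.coord_pt _ _ (G.ht_nonneg x) (G.ht_le x)

theorem eq_top_iff (x : F) : x = G.top ↔ G.ht x = 0 := by
  refine ⟨fun h => h ▸ G.ht_top, fun h => ?_⟩
  rw [← G.pt_idx x, h, pt_zero]

theorem pt_inj {l l' : ι} {s s' : ℝ} (h0 : 0 < s) (h1 : s ≤ G.len l) (h0' : 0 ≤ s')
    (h1' : s' ≤ G.len l') (h : G.pt l s = G.pt l' s') : l = l' ∧ s = s' := by
  have := congrArg G.coord h
  rw [G.coord_pt l s h0.le h1, G.coord_pt l' s' h0' h1', Prod.mk.injEq] at this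
  obtain ⟨h2, rfl⟩ := this
  exact ⟨G.pos_injective (mul_left_cancel₀ h0.ne' h2), rfl⟩

theorem idx_pt {l : ι} {s : ℝ} (h0 : 0 < s) (h1 : s ≤ G.len l) : G.idx (G.pt l s) = l := by
  have := G.pt_idx (G.pt l s)
  rw [G.ht_pt h0.le h1] at this
  refine (G.pt_inj h0 h1 h0.le ?_ this.symm).1.symm
  have := G.ht_le (G.pt l s)
  rwa [G.ht_pt h0.le h1] at this

theorem injOn_pt (l : ι) : InjOn (G.pt l) (Icc 0 (G.len l)) := by
  intro s hs s' hs' h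
  rw [← G.ht_pt hs.1 hs.2, h, G.ht_pt hs'.1 hs'.2]

theorem t2Space (G : FanModel ι F) : T2Space F := G.isEmbedding.t2Space

theorem isPreconnected_image_Icc (l : ι) (s s' : ℝ) : IsPreconnected (G.pt l '' Icc s s') :=
  isPreconnected_Icc.image _ (G.continuous_pt l).continuousOn

theorem isArcBetween_pt {l : ι} {s s' : ℝ} (h0 : 0 ≤ s) (h : s < s') (h1 : s' ≤ G.len l) :
    IsArcBetween (G.pt l '' Icc s s') (G.pt l s) (G.pt l s') :=
  have := G.t2Space
  isArcBetween_image_Icc h (G.continuous_pt l) ((G.injOn_pt l).mono (Icc_subset_Icc h0 h1))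

theorem isArcBetween_pt_pt {l l' : ι} (hl : l ≠ l') {s s' : ℝ} (h0 : 0 < s) (h1 : s ≤ G.len l)
    (h0' : 0 < s') (h1' : s' ≤ G.len l') :
    IsArcBetween (G.pt l '' Icc 0 s ∪ G.pt l' '' Icc 0 s') (G.pt l s) (G.pt l' s') := by
  have := G.t2Space
  -- `γ` descends the blade `l` for negative parameters and climbs `l'` for positive ones, passing
  -- the top at `0`.
  let γ : ℝ → F := fun r => if r ≤ 0 then G.pt l (-r) else G.pt l' r
  have hc : Continuous γ := by
    refine Continuous.if_le ((G.continuous_pt l).comp continuous_neg) (G.continuous_pt l')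
      continuous_id continuous_const ?_
    rintro r rfl
    simp [pt_zero]
  have hneg : ∀ r, r ≤ 0 → γ r = G.pt l (-r) := fun r hr => if_pos hr
  have hpos : ∀ r, 0 < r → γ r = G.pt l' r := fun r hr => if_neg hr.not_ge
  have hi : InjOn γ (Icc (-s) s') := by
    intro r hr r' hr' h
    rcases le_or_gt r 0 with hr0 | hr0 <;> rcases le_or_gt r' 0 with hr0' | hr0'
    · rw [hneg r hr0, hneg r' hr0'] at h
      have := G.injOn_pt l ⟨by linarith, by linarith [hr.1]⟩ ⟨by linarith, by linarith [hr'.1]⟩ h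
      linarith
    · rw [hneg r hr0, hpos r' hr0'] at h
      exact absurd (G.pt_inj hr0' (hr'.2.trans h1') (by linarith) (by linarith [hr.1]) h.symm).1.symm
        hl
    · rw [hpos r hr0, hneg r' hr0'] at h
      exact absurd (G.pt_inj hr0 (hr.2.trans h1') (by linarith) (by linarith [hr'.1]) h).1.symm hl
    · rw [hpos r hr0, hpos r' hr0'] at h
      exact G.injOn_pt l' ⟨hr0.le, hr.2.trans h1'⟩ ⟨hr0'.le, hr'.2.trans h1'⟩ h
  have key := isArcBetween_image_Icc (by linarith) hc hi
  rw [hneg (-s) (by linarith), hpos s' h0', neg_neg] at key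
  convert key using 1
  ext x
  constructor
  · rintro (⟨r, hr, rfl⟩ | ⟨r, hr, rfl⟩)
    · exact ⟨-r, ⟨by linarith [hr.2], by linarith [hr.1]⟩,
        by rw [hneg _ (by linarith [hr.1]), neg_neg]⟩
    · rcases hr.1.eq_or_lt with h | h
      · exact ⟨0, ⟨by linarith, by linarith⟩, by rw [hneg _ le_rfl, ← h, neg_zero, pt_zero, pt_zero]⟩
      · exact ⟨r, ⟨by linarith, hr.2⟩, hpos r h⟩
  · rintro ⟨r, hr, rfl⟩
    rcases le_or_gt r 0 with h | h
    · exact Or.inl ⟨-r, ⟨by linarith, by linarith [hr.1]⟩, (hneg r h).symm⟩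
    · exact Or.inr ⟨r, ⟨h.le, hr.2⟩, (hpos r h).symm⟩

/-- The contraction of `F` to its top along the blades. -/
noncomputable def contract (x : F) (r : unitInterval) : F := G.pt (G.idx x) (r * G.ht x)

/-- `contract` is defined through a choice of index, so its continuity is read off in the plane,
where it is multiplication by a scalar. -/
theorem coord_contract (x : F) (r : unitInterval) :
    G.coord (G.contract x r) = (r : ℝ) • G.coord x := by
  have h := G.ht_nonneg x
  rw [contract, G.coord_pt _ _ (mul_nonneg r.2.1 h) ((mul_le_of_le_one_left h r.2.2).trans (G.ht_le x)),
    G.coord_eq x]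
  simp [mul_assoc]

theorem continuous_contract : Continuous (Function.uncurry G.contract) := by
  rw [G.isEmbedding.continuous_iff]
  have : (G.coord ∘ Function.uncurry G.contract) = fun p => (p.2 : ℝ) • G.coord p.1 :=
    funext fun p => G.coord_contract p.1 p.2
  rw [this]
  exact (continuous_subtype_val.comp continuous_snd).smul (G.continuous_coord.comp continuous_fst)

theorem range_contract {l : ι} {s : ℝ} (h0 : 0 ≤ s) (h1 : s ≤ G.len l) :
    range (G.contract (G.pt l s)) = G.pt l '' Icc 0 s := by
  rcases h0.eq_or_lt with rfl | hs
  · ext x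
    simp [contract, pt_zero, ht_top, eq_comm]
  ext x
  constructor
  · rintro ⟨r, rfl⟩
    refine ⟨r * s, ⟨mul_nonneg r.2.1 h0, mul_le_of_le_one_left h0 r.2.2⟩, ?_⟩
    rw [contract, G.ht_pt h0 h1, G.idx_pt hs h1]
  · rintro ⟨u, hu, rfl⟩
    refine ⟨⟨u / s, div_nonneg hu.1 h0, (div_le_one hs).2 hu.2⟩, ?_⟩
    rw [contract, G.ht_pt h0 h1, G.idx_pt hs h1]
    simp [hs.ne']

theorem exists_arc (G : FanModel ι F) {x y : F} (hxy : x ≠ y) : ∃ A : Set F, IsArcBetween A x y := by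
  obtain ⟨l, s, h0, h1, rfl⟩ := G.exists_pt x
  obtain ⟨l', s', h0', h1', rfl⟩ := G.exists_pt y
  have aux : ∀ l s s', 0 ≤ s → s ≤ G.len l → 0 ≤ s' → s' ≤ G.len l → G.pt l s ≠ G.pt l s' →
      ∃ A, IsArcBetween A (G.pt l s) (G.pt l s') := by
    intro l s s' h0 h1 h0' h1' hne
    rcases lt_trichotomy s s' with h | h | h
    · exact ⟨_, G.isArcBetween_pt h0 h h1'⟩
    · exact absurd (h ▸ rfl) hne
    · exact ⟨_, (G.isArcBetween_pt h0' h h1).symm⟩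
  by_cases hl : l = l'
  · subst hl
    exact aux l s s' h0 h1 h0' h1' hxy
  · rcases h0.eq_or_lt with rfl | hs
    · rw [pt_zero, ← G.pt_zero l'] at hxy ⊢
      exact aux l' 0 s' le_rfl (G.len_pos l').le h0' h1' hxy
    rcases h0'.eq_or_lt with rfl | hs'
    · rw [pt_zero, ← G.pt_zero l] at hxy ⊢
      exact aux l s 0 h0 h1 le_rfl (G.len_pos l).le hxy
    exact ⟨_, G.isArcBetween_pt_pt hl hs h1 hs' h1'⟩

/-! ### Connected subsets, unicoherence, endpoints, top and smoothness -/

section Connected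

variable [Countable ι]

/-- Supplies lines through the origin that meet the fan only at the top; they separate blades from
each other. -/
theorem exists_notMem_range_pos {a b : ℝ} (hab : a < b) : ∃ c ∈ Ioo a b, c ∉ range G.pos := by
  by_contra! h
  exact (Cardinal.Real.Ioo_countable_iff.not.2 hab.not_ge)
    ((countable_range G.pos).mono fun c hc => h c hc)

/-- A closed connected set that contains a point of a blade, but not all points of this blade below
it, is contained in the part of the blade above any such missing point. -/
theorem subset_above {A : Set F} (hA : IsPreconnected A) (hcl : IsClosed A) {l : ι} {s s' : ℝ}
    (h0 : 0 ≤ s') (hs : s' < s) (h1 : s ≤ G.len l) (hmem : G.pt l s ∈ A)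
    (hnot : G.pt l s' ∉ A) : ∀ x ∈ A, ∃ u, s' < u ∧ u ≤ G.len l ∧ G.pt l u = x := by
  -- A neighbourhood of the missing point avoids the closed set `A`, so `A` has no point at height
  -- `s'` on blades close to `l`.
  obtain ⟨δ, hδ, hmiss⟩ : ∃ δ > 0, ∀ l₁, |G.pos l₁ - G.pos l| < δ → s' ≤ G.len l₁ →
      G.pt l₁ s' ∉ A := by
    have hn : Aᶜ ∈ 𝓝 (G.pt l s') := hcl.isOpen_compl.mem_nhds hnot
    rw [G.isEmbedding.isInducing.nhds_eq_comap, (Metric.nhds_basis_ball.comap _).mem_iff] at hn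
    obtain ⟨ε, hε, hn⟩ := hn
    refine ⟨ε / (s' + 1), by positivity, fun l₁ hl₁ hle => hn ?_⟩
    rw [mem_preimage, G.coord_pt l₁ s' h0 hle, G.coord_pt l s' h0 (by linarith), Metric.mem_ball,
      Prod.dist_eq, dist_self, Real.dist_eq, ← mul_sub, abs_mul, abs_of_nonneg h0]
    rw [lt_div_iff₀ (by positivity)] at hl₁
    exact max_lt (by nlinarith [abs_nonneg (G.pos l₁ - G.pos l)]) hε
  intro x hx
  obtain ⟨l₁, u, hu0, hu1, rfl⟩ := G.exists_pt x
  by_contra hcon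
  have hcon' : l₁ = l → u ≤ s' := by
    rintro rfl
    by_contra! h
    exact hcon ⟨u, h, hu1, rfl⟩
  -- The window of slopes is to exclude the blade of `x`, unless that blade is `l`.
  obtain ⟨δ', hδ', hδδ, hl₁⟩ : ∃ δ' > 0, δ' ≤ δ ∧ (l₁ ≠ l → δ' ≤ |G.pos l₁ - G.pos l|) := by
    by_cases h : l₁ = l
    · exact ⟨δ, hδ, le_rfl, fun h' => absurd h h'⟩
    · have := abs_pos.2 (sub_ne_zero.2 (G.pos_injective.ne h))
      exact ⟨min δ |G.pos l₁ - G.pos l|, lt_min hδ this, min_le_left _ _, fun _ => min_le_right _ _⟩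
  obtain ⟨a, ha, har⟩ := G.exists_notMem_range_pos (show G.pos l - δ' < G.pos l by linarith)
  obtain ⟨b, hb, hbr⟩ := G.exists_notMem_range_pos (show G.pos l < G.pos l + δ' by linarith)
  -- The sector of slopes in `(a, b)` above height `s'` and the exterior of its closure cover `A`:
  -- no blade has slope `a` or `b`, and no point of `A` in the sector has height `s'`.
  have hU : IsOpen {z | s' < G.ht z ∧ a * G.ht z < (G.coord z).1 ∧ (G.coord z).1 < b * G.ht z} :=
    (isOpen_lt continuous_const G.continuous_ht).inter
      ((isOpen_lt (continuous_const.mul G.continuous_ht) G.continuous_coord.fst).inter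
        (isOpen_lt G.continuous_coord.fst (continuous_const.mul G.continuous_ht)))
  have hV : IsOpen {z | G.ht z < s' ∨ (G.coord z).1 < a * G.ht z ∨ b * G.ht z < (G.coord z).1} :=
    (isOpen_lt G.continuous_ht continuous_const).union
      ((isOpen_lt G.continuous_coord.fst (continuous_const.mul G.continuous_ht)).union
        (isOpen_lt (continuous_const.mul G.continuous_ht) G.continuous_coord.fst))
  -- If `s' = 0`, the missing point is the top, which lies on every blade.
  have hpos : ∀ {l₂ v}, 0 ≤ v → G.pt l₂ v ∈ A → s' = 0 → 0 < v := by
    intro l₂ v hv hvA h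
    refine hv.lt_of_ne' ?_
    rintro rfl
    rw [h, pt_zero] at hnot
    rw [pt_zero] at hvA
    exact hnot hvA
  have hcov : A ⊆ {z | s' < G.ht z ∧ a * G.ht z < (G.coord z).1 ∧ (G.coord z).1 < b * G.ht z} ∪
      {z | G.ht z < s' ∨ (G.coord z).1 < a * G.ht z ∨ b * G.ht z < (G.coord z).1} := by
    intro z hz
    obtain ⟨l₂, v, hv0, hv1, rfl⟩ := G.exists_pt z
    simp only [mem_union, mem_ofPred_eq, G.ht_pt hv0 hv1, G.coord_pt l₂ v hv0 hv1]
    rcases hv0.eq_or_lt with rfl | hv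
    · right; left
      refine h0.lt_of_ne fun h => ?_
      exact lt_irrefl _ (hpos le_rfl hz h.symm)
    · rcases lt_trichotomy (G.pos l₂) a with h | h | h
      · right; right; left; nlinarith
      · exact absurd ⟨l₂, h⟩ har
      rcases lt_trichotomy (G.pos l₂) b with h' | h' | h'
      · rcases lt_trichotomy s' v with h2 | h2 | h2
        · exact Or.inl ⟨h2, by nlinarith, by nlinarith⟩
        · subst h2
          refine absurd hz (hmiss l₂ ?_ hv1)
          rw [abs_lt]
          constructor <;> linarith [ha.1, hb.2]
        · exact Or.inr (Or.inl h2)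
      · exact absurd ⟨l₂, h'⟩ hbr
      · right; right; right; nlinarith
  obtain ⟨z, hz, hzU, hzV⟩ := hA _ _ hU hV hcov
    ⟨_, hmem, by
      simp only [mem_ofPred_eq, G.ht_pt (h0.trans hs.le) h1, G.coord_pt l s (h0.trans hs.le) h1]
      exact ⟨hs, by nlinarith [ha.2], by nlinarith [hb.1]⟩⟩
    ⟨_, hx, by
      simp only [mem_ofPred_eq, G.ht_pt hu0 hu1, G.coord_pt l₁ u hu0 hu1]
      by_cases hl : l₁ = l
      · subst hl
        left
        refine (hcon' rfl).lt_of_ne ?_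
        rintro rfl
        exact hnot hx
      · rcases hu0.eq_or_lt with rfl | hu
        · left
          refine h0.lt_of_ne fun h => ?_
          exact lt_irrefl _ (hpos le_rfl hx h.symm)
        · right
          have := hl₁ hl
          rcases le_abs'.1 this with h | h
          · left; nlinarith [ha.1]
          · right; nlinarith [hb.2]⟩
  rcases hzV with h | h | h <;> linarith [hzU.1, hzU.2.1, hzU.2.2]

/-- A missing point in between would, by `subset_above`, force all of `A`, including the lower
point, strictly above it. -/
theorem image_Icc_subset {A : Set F} (hA : IsPreconnected A) (hcl : IsClosed A) {l : ι}
    {s s' : ℝ} (h0 : 0 ≤ s) (h1 : s' ≤ G.len l) (hs : G.pt l s ∈ A) (hs' : G.pt l s' ∈ A) :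
    G.pt l '' Icc s s' ⊆ A := by
  rintro _ ⟨u, hu, rfl⟩
  by_contra hn
  have hlt : u < s' := hu.2.lt_of_ne (by rintro rfl; exact hn hs')
  obtain ⟨v, hv, hv1, h⟩ := G.subset_above hA hcl (h0.trans hu.1) hlt h1 hs' hn _ hs
  have := G.injOn_pt l ⟨by linarith [hu.1], hv1⟩ ⟨h0, by linarith [hu.1, hu.2]⟩ h
  linarith [hu.1]

/-- A missing point would, by `subset_above`, confine `A` to the blade `l` without the top. -/
theorem image_Icc_zero_subset {A : Set F} (hA : IsPreconnected A) (hcl : IsClosed A) {l l' : ι}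
    (hl : l ≠ l') {s s' : ℝ} (h1 : s ≤ G.len l) (h0' : 0 ≤ s') (h1' : s' ≤ G.len l')
    (hs : G.pt l s ∈ A) (hs' : G.pt l' s' ∈ A) : G.pt l '' Icc 0 s ⊆ A := by
  rintro _ ⟨u, hu, rfl⟩
  by_contra hn
  have hlt : u < s := hu.2.lt_of_ne (by rintro rfl; exact hn hs)
  obtain ⟨v, hv, hv1, h⟩ := G.subset_above hA hcl hu.1 hlt h1 hs hn _ hs'
  exact hl (G.pt_inj (by linarith [hu.1]) hv1 h0' h1' h).1

/-- The arc between two points, as a set. -/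
theorem exists_hull (G : FanModel ι F) (x y : F) : ∃ Q : Set F, IsPreconnected Q ∧ x ∈ Q ∧ y ∈ Q ∧
    ∀ A : Set F, IsPreconnected A → IsClosed A → x ∈ A → y ∈ A → Q ⊆ A := by
  obtain ⟨l, s, h0, h1, rfl⟩ := G.exists_pt x
  obtain ⟨l', s', h0', h1', rfl⟩ := G.exists_pt y
  by_cases hl : l = l'
  · subst hl
    rcases le_total s s' with h | h
    · exact ⟨_, G.isPreconnected_image_Icc l s s', ⟨s, ⟨le_rfl, h⟩, rfl⟩, ⟨s', ⟨h, le_rfl⟩, rfl⟩,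
        fun A hA hcl hx hy => G.image_Icc_subset hA hcl h0 h1' hx hy⟩
    · exact ⟨_, G.isPreconnected_image_Icc l s' s, ⟨s, ⟨h, le_rfl⟩, rfl⟩, ⟨s', ⟨le_rfl, h⟩, rfl⟩,
        fun A hA hcl hx hy => G.image_Icc_subset hA hcl h0' h1 hy hx⟩
  · refine ⟨G.pt l '' Icc 0 s ∪ G.pt l' '' Icc 0 s', ?_, Or.inl ⟨s, ⟨h0, le_rfl⟩, rfl⟩,
      Or.inr ⟨s', ⟨h0', le_rfl⟩, rfl⟩, fun A hA hcl hx hy => union_subset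
        (G.image_Icc_zero_subset hA hcl hl h1 h0' h1' hx hy)
        (G.image_Icc_zero_subset hA hcl (Ne.symm hl) h1' h0 h1 hy hx)⟩
    exact (G.isPreconnected_image_Icc l 0 s).union G.top ⟨0, ⟨le_rfl, h0⟩, G.pt_zero l⟩
      ⟨0, ⟨le_rfl, h0'⟩, G.pt_zero l'⟩ (G.isPreconnected_image_Icc l' 0 s')

/-- The hull of two common points lies in both sets. -/
theorem isPreconnected_inter (G : FanModel ι F) {A B : Set F} (hA : IsPreconnected A) (hAc : IsClosed A)
    (hB : IsPreconnected B) (hBc : IsClosed B) : IsPreconnected (A ∩ B) := by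
  refine isPreconnected_of_forall_pair fun x hx y hy => ?_
  obtain ⟨Q, hQ, hxQ, hyQ, hsub⟩ := G.exists_hull x y
  exact ⟨Q, subset_inter (hsub A hA hAc hx.1 hy.1) (hsub B hB hBc hx.2 hy.2), hxQ, hyQ, hQ⟩

theorem isUnicoherent (G : FanModel ι F) {Y : Set F} (hY : IsSubcontinuum Y) : IsUnicoherent Y := by
  have := G.t2Space
  rintro A B ⟨hA, hA'⟩ ⟨hB, hB'⟩ rfl
  refine ⟨?_, G.isPreconnected_inter hA'.isPreconnected hA.isClosed hB'.isPreconnected hB.isClosed⟩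
  -- The intersection is nonempty because a connected set is not the union of two disjoint nonempty
  -- closed sets.
  have := isPreconnected_closed_iff.1 hY.2.isPreconnected A B hA.isClosed hB.isClosed Subset.rfl
    (hA'.nonempty.mono fun x hx => ⟨Or.inl hx, hx⟩) (hB'.nonempty.mono fun x hx => ⟨Or.inr hx, hx⟩)
  exact this.mono inter_subset_right

/-- In a fan model, every two arcs with the same endpoints coincide. -/
theorem arc_unique (G : FanModel ι F) {A B : Set F} {x y : F} (hA : IsArcBetween A x y) (hB : IsArcBetween B x y) :
    A = B := by
  have := G.t2Space
  obtain ⟨Q, hQ, hx, hy, hsub⟩ := G.exists_hull x y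
  rw [hA.eq_of_subset hQ (hsub A hA.isPreconnected hA.isCompact.isClosed hA.left_mem hA.right_mem)
    hx hy, hB.eq_of_subset hQ
    (hsub B hB.isPreconnected hB.isCompact.isClosed hB.left_mem hB.right_mem) hx hy]

theorem isContinuum (G : FanModel ι F) [CompactSpace F] : IsContinuum F where
  compact := inferInstance
  connected := by
    have : PreconnectedSpace F := ⟨isPreconnected_of_forall_pair fun x _ y _ => by
      obtain ⟨Q, hQ, hx, hy, -⟩ := G.exists_hull x y
      exact ⟨Q, subset_univ _, hx, hy, hQ⟩⟩
    exact { toNonempty := ⟨G.top⟩ }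
  metrizable := G.isEmbedding.metrizableSpace

theorem isDendroid (G : FanModel ι F) [CompactSpace F] : IsDendroid F :=
  ⟨G.isContinuum, fun _ _ => G.exists_arc, fun _ => G.isUnicoherent⟩

/-- The endpoints of `F` are the ends of the blades. -/
theorem endpoints_eq (G : FanModel ι F) [Nontrivial ι] : endpoints F = range fun l => G.pt l (G.len l) := by
  ext x
  constructor
  · intro hx
    obtain ⟨l, s, h0, h1, rfl⟩ := G.exists_pt x
    rcases h0.eq_or_lt with rfl | h0
    · exfalso
      -- The top is interior to the arc joining the ends of two blades.
      obtain ⟨l', hl'⟩ := exists_ne l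
      have hp := G.len_pos l
      have hp' := G.len_pos l'
      rcases hx _ _ _ (G.isArcBetween_pt_pt hl'.symm hp le_rfl hp' le_rfl)
        (Or.inl ⟨0, ⟨le_rfl, hp.le⟩, rfl⟩) with h | h
      · exact hp.ne' (G.pt_inj hp le_rfl le_rfl hp.le h.symm).2
      · exact hp'.ne' (G.pt_inj hp' le_rfl le_rfl hp.le h.symm).2
    · have hlen := G.len_pos l
      rcases hx _ _ _ (G.isArcBetween_pt le_rfl hlen le_rfl) ⟨s, ⟨h0.le, h1⟩, rfl⟩ with h | h
      · exact absurd (G.pt_inj h0 h1 le_rfl hlen.le h).2 h0.ne'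
      · exact ⟨l, h.symm⟩
  · rintro ⟨l, rfl⟩ A a b hA hx
    have hlen := G.len_pos l
    obtain ⟨la, sa, ha0, ha1, rfl⟩ := G.exists_pt a
    obtain ⟨lb, sb, hb0, hb1, rfl⟩ := G.exists_pt b
    have aux : ∀ {l' s u v}, 0 ≤ u → v ≤ s → s ≤ G.len l' →
        G.pt l (G.len l) ∈ G.pt l' '' Icc u v → G.pt l (G.len l) = G.pt l' s := by
      rintro l' s u v hu hv hs ⟨r, hr, h⟩
      obtain ⟨rfl, rfl⟩ := G.pt_inj hlen le_rfl (hu.trans hr.1) (hr.2.trans (hv.trans hs)) h.symm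
      rw [le_antisymm hs (hr.2.trans hv)]
    rcases eq_or_ne la lb with rfl | hl
    · rcases lt_trichotomy sa sb with h | h | h
      · rw [G.arc_unique hA (G.isArcBetween_pt ha0 h hb1)] at hx
        exact Or.inr (aux ha0 le_rfl hb1 hx)
      · exact absurd (h ▸ rfl) hA.ne
      · rw [G.arc_unique hA (G.isArcBetween_pt hb0 h ha1).symm] at hx
        exact Or.inl (aux hb0 le_rfl ha1 hx)
    · rcases ha0.eq_or_lt with rfl | ha
      · rw [pt_zero, ← G.pt_zero lb] at hA
        have h := hb0.lt_of_ne fun h => hA.ne (h ▸ rfl)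
        rw [G.arc_unique hA (G.isArcBetween_pt le_rfl h hb1)] at hx
        exact Or.inr (aux le_rfl le_rfl hb1 hx)
      rcases hb0.eq_or_lt with rfl | hb
      · rw [G.pt_zero lb, ← G.pt_zero la] at hA
        rw [G.arc_unique hA (G.isArcBetween_pt le_rfl ha ha1).symm] at hx
        exact Or.inl (aux le_rfl le_rfl ha1 hx)
      rw [G.arc_unique hA (G.isArcBetween_pt_pt hl ha ha1 hb hb1)] at hx
      exact hx.imp (aux le_rfl le_rfl ha1) (aux le_rfl le_rfl hb1)

/-- The top is the only ramification point. -/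
theorem isTop {l₁ l₂ l₃ : ι} (h₁₂ : l₁ ≠ l₂) (h₁₃ : l₁ ≠ l₃) (h₂₃ : l₂ ≠ l₃) : IsTop G.top := by
  have := G.t2Space
  refine Subset.antisymm ?_ (singleton_subset_iff.2 ?_)
  · rintro x ⟨A, B, C, a, b, c, hA, hB, hC, hAB, hAC, hBC⟩
    by_contra hx
    obtain ⟨l, s, h0, h1, rfl⟩ := G.exists_pt x
    have h0 : 0 < s := h0.lt_of_ne (by rintro rfl; exact hx (G.pt_zero l))
    -- every arc from the point contains a nearby point of its blade, above it or below it
    have key : ∀ {A : Set F} {a}, IsArcBetween A (G.pt l s) a →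
        (∃ u, s < u ∧ u ≤ G.len l ∧ ∀ v ∈ Icc s u, G.pt l v ∈ A) ∨
        (∃ u, 0 ≤ u ∧ u < s ∧ ∀ v ∈ Icc u s, G.pt l v ∈ A) := by
      intro A a hA
      obtain ⟨la, sa, ha0, ha1, rfl⟩ := G.exists_pt a
      have hp := hA.isPreconnected
      have hc := hA.isCompact.isClosed
      by_cases hl : la = l
      · subst hl
        rcases lt_trichotomy s sa with h | h | h
        · exact Or.inl ⟨sa, h, ha1, fun v hv =>
            G.image_Icc_subset hp hc h0.le ha1 hA.left_mem hA.right_mem ⟨v, hv, rfl⟩⟩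
        · exact absurd (h ▸ rfl) hA.ne
        · exact Or.inr ⟨sa, ha0, h, fun v hv =>
            G.image_Icc_subset hp hc ha0 h1 hA.right_mem hA.left_mem ⟨v, hv, rfl⟩⟩
      · exact Or.inr ⟨0, le_rfl, h0, fun v hv =>
          G.image_Icc_zero_subset hp hc (Ne.symm hl) h1 ha0 ha1 hA.left_mem hA.right_mem
            ⟨v, hv, rfl⟩⟩
    have up : ∀ {A B : Set F}, A ∩ B = {G.pt l s} →
        (∃ u, s < u ∧ u ≤ G.len l ∧ ∀ v ∈ Icc s u, G.pt l v ∈ A) →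
        (∃ u, s < u ∧ u ≤ G.len l ∧ ∀ v ∈ Icc s u, G.pt l v ∈ B) → False := by
      rintro A B hAB ⟨u, hu, hu1, hA⟩ ⟨v, hv, hv1, hB⟩
      have hm : G.pt l (min u v) ∈ A ∩ B := ⟨hA _ ⟨(lt_min hu hv).le, min_le_left _ _⟩,
        hB _ ⟨(lt_min hu hv).le, min_le_right _ _⟩⟩
      rw [hAB] at hm
      have := G.injOn_pt l ⟨(h0.trans (lt_min hu hv)).le, (min_le_left _ _).trans hu1⟩ ⟨h0.le, h1⟩ hm
      exact (lt_min hu hv).ne' this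
    have down : ∀ {A B : Set F}, A ∩ B = {G.pt l s} →
        (∃ u, 0 ≤ u ∧ u < s ∧ ∀ v ∈ Icc u s, G.pt l v ∈ A) →
        (∃ u, 0 ≤ u ∧ u < s ∧ ∀ v ∈ Icc u s, G.pt l v ∈ B) → False := by
      rintro A B hAB ⟨u, hu, hu1, hA⟩ ⟨v, hv, hv1, hB⟩
      have hm : G.pt l (max u v) ∈ A ∩ B := ⟨hA _ ⟨le_max_left _ _, (max_lt hu1 hv1).le⟩,
        hB _ ⟨le_max_right _ _, (max_lt hu1 hv1).le⟩⟩
      rw [hAB] at hm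
      have := G.injOn_pt l ⟨hu.trans (le_max_left _ _), (max_lt hu1 hv1).le.trans h1⟩ ⟨h0.le, h1⟩ hm
      exact (max_lt hu1 hv1).ne this
    -- Of three arcs two leave the point on the same side along its blade, and these share further
    -- points.
    rcases key hA with hA | hA <;> rcases key hB with hB | hB <;> rcases key hC with hC | hC
    exacts [up hAB hA hB, up hAB hA hB, up hAC hA hC, down hBC hB hC, up hBC hB hC,
      down hAC hA hC, down hAB hA hB, down hAB hA hB]
  · have arc : ∀ l, IsArcBetween (G.pt l '' Icc 0 (G.len l)) G.top (G.pt l (G.len l)) := by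
      intro l
      have := G.isArcBetween_pt (l := l) le_rfl (G.len_pos l) le_rfl
      rwa [pt_zero] at this
    have inter : ∀ l l', l ≠ l' →
        G.pt l '' Icc 0 (G.len l) ∩ G.pt l' '' Icc 0 (G.len l') = {G.top} := by
      intro l l' hl
      refine Subset.antisymm ?_ (singleton_subset_iff.2 ⟨(arc l).left_mem, (arc l').left_mem⟩)
      rintro _ ⟨⟨s, hs, rfl⟩, ⟨s', hs', h⟩⟩
      rcases hs.1.eq_or_lt with h0 | h0
      · rw [← h0, pt_zero]
        rfl
      · exact absurd (G.pt_inj h0 hs.2 hs'.1 hs'.2 h.symm).1 hl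
    exact ⟨_, _, _, _, _, _, arc l₁, arc l₂, arc l₃, inter _ _ h₁₂, inter _ _ h₁₃, inter _ _ h₂₃⟩

/-- The segment becomes the image of a fixed compact interval under a map depending continuously on
`x`; smoothness follows from this. -/
theorem segment_eq {A : Set F} {x : F} (h : IsSegment A G.top x) :
    A = range (G.contract x) := by
  obtain ⟨l, s, h0, h1, rfl⟩ := G.exists_pt x
  rw [G.range_contract h0 h1]
  rcases h with h | ⟨h, rfl⟩
  · have hs : 0 < s := h0.lt_of_ne (by rintro rfl; exact h.ne (G.pt_zero l).symm)
    have := G.isArcBetween_pt le_rfl hs h1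
    rw [pt_zero] at this
    exact G.arc_unique h this
  · have := (G.eq_top_iff _).1 h.symm
    rw [G.ht_pt h0 h1] at this
    simp [this, pt_zero]

theorem isFan [CompactSpace F] (h : IsTop G.top) : IsFan F := ⟨G.isDendroid, G.top, h⟩

theorem isSmoothFan [CompactSpace F] (htop : IsTop G.top) : IsSmoothFan F := by
  refine ⟨G.isFan htop, fun t ht x x' hx A A' hA hA' => ?_⟩
  have : t = G.top := by
    have h : {t} = ({G.top} : Set F) := ht.symm.trans htop
    exact singleton_injective h
  subst this
  have hc := Continuous.nonemptyCompacts_map'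
    (f := fun _ : F => (⊤ : TopologicalSpace.NonemptyCompacts unitInterval)) continuous_const
    G.continuous_contract
  have heq : ∀ (B : TopologicalSpace.NonemptyCompacts F) (z : F), IsSegment (B : Set F) G.top z →
      B = TopologicalSpace.NonemptyCompacts.map (G.contract z)
        (show Continuous (G.contract z) from
          G.continuous_contract.comp (Continuous.prodMk_right z)) ⊤ := by
    intro B z hB
    apply TopologicalSpace.NonemptyCompacts.ext
    rw [G.segment_eq hB]
    simp
  rw [heq A' x' hA', funext fun n => heq (A n) (x n) (hA n)]
  exact (hc.tendsto x').comp hx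

end Connected

end FanModel

/-! ### Positions and heights of the blades -/

theorem bladePos_nil : bladePos [] = 0 := by simp [bladePos]

/-- Self-similarity: the branch at `[n]` is a scaled copy of all positions, inside `[2 * 3⁻ⁿ, 3 *
3⁻ⁿ)`. -/
theorem bladePos_cons (n : ℕ+) (r : List ℕ+) :
    bladePos (n :: r) = (1 / 3 : ℝ) ^ (n : ℕ) * (2 + bladePos r) := by
  simp only [bladePos, List.length_cons, Finset.sum_range_succ', List.take_succ_cons,
    List.map_cons, List.sum_cons, pow_add, ← Finset.mul_sum]
  simp
  ring

theorem bladePos_mem (l : List ℕ+) : 0 ≤ bladePos l ∧ bladePos l < 1 := by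
  induction l with
  | nil => simp [bladePos_nil]
  | cons n r ih =>
    rw [bladePos_cons]
    have h : (1 / 3 : ℝ) ^ (n : ℕ) ≤ 1 / 3 :=
      pow_le_of_le_one (by norm_num) (by norm_num) n.pos.ne'
    have h0 : (0 : ℝ) < (1 / 3 : ℝ) ^ (n : ℕ) := by positivity
    exact ⟨mul_nonneg h0.le (by linarith), by nlinarith⟩

/-- The position has ternary digit 2 at the places `n₁`, `n₁ + n₂`, …, and 0 elsewhere. -/
theorem bladePos_mem_cantorSet (l : List ℕ+) : bladePos l ∈ cantorSet := by
  have third : ∀ k : ℕ, ∀ x ∈ cantorSet, (1 / 3 : ℝ) ^ k * x ∈ cantorSet := by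
    intro k
    induction k with
    | zero => simp
    | succ k ih =>
      intro x hx
      rw [cantorSet_eq_union_halves]
      exact Or.inl ⟨_, ih x hx, by ring⟩
  induction l with
  | nil => rw [bladePos_nil]; exact zero_mem_cantorSet
  | cons n r ih =>
    obtain ⟨k, hk⟩ : ∃ k, (n : ℕ) = k + 1 := ⟨n - 1, by have := n.pos; omega⟩
    rw [bladePos_cons, hk, pow_succ, mul_assoc]
    refine third k _ ?_
    rw [cantorSet_eq_union_halves]
    exact Or.inr ⟨_, ih, by ring⟩

/-- If two positions are close, then one index extends the other one by large numbers. -/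
theorem exists_eq_append_of_bladePos_close (l : List ℕ+) (N : ℕ) : ∃ δ > 0, ∀ l' : List ℕ+,
    |bladePos l' - bladePos l| < δ → l' = l ∨ ∃ j : ℕ+, N < j ∧ ∃ r, l' = l ++ j :: r := by
  induction l with
  | nil =>
    refine ⟨(1 / 3) ^ N, by positivity, fun l' h => ?_⟩
    cases l' with
    | nil => exact Or.inl rfl
    | cons n r =>
      refine Or.inr ⟨n, ?_, r, rfl⟩
      by_contra! hn
      have h1 : (1 / 3 : ℝ) ^ N ≤ (1 / 3) ^ (n : ℕ) :=
        pow_le_pow_of_le_one (by norm_num) (by norm_num) hn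
      have h2 := (abs_lt.1 h).2
      rw [bladePos_nil, bladePos_cons] at h2
      have h3 : (0 : ℝ) < (1 / 3) ^ (n : ℕ) := by positivity
      nlinarith [(bladePos_mem r).1]
  | cons n r ih =>
    obtain ⟨δ, hδ, ih⟩ := ih
    have hn : (0 : ℝ) < (1 / 3) ^ (n : ℕ) := by positivity
    -- An index that is empty or has a first entry other than `n` lies at distance at least `3⁻ⁿ`;
    -- for equal first entries the inductive `δ` is rescaled by `3⁻ⁿ`.
    refine ⟨(1 / 3) ^ (n : ℕ) * min δ 1, by positivity, fun l' h => ?_⟩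
    have hr := bladePos_mem r
    have hlt : |bladePos l' - bladePos (n :: r)| < (1 / 3) ^ (n : ℕ) :=
      h.trans_le (mul_le_of_le_one_right hn.le (min_le_right _ _))
    rw [abs_lt, bladePos_cons] at hlt
    cases l' with
    | nil =>
      rw [bladePos_nil] at hlt
      nlinarith [hlt.1]
    | cons n' r' =>
      have hr' := bladePos_mem r'
      have hn' : (0 : ℝ) < (1 / 3) ^ (n' : ℕ) := by positivity
      have step : ∀ {a b : ℕ}, a < b → (1 / 3 : ℝ) ^ b ≤ (1 / 3) ^ a * (1 / 3) := by
        intro a b hab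
        rw [← pow_succ]
        exact pow_le_pow_of_le_one (by norm_num) (by norm_num) hab
      rw [bladePos_cons] at hlt
      rcases lt_trichotomy (n : ℕ) n' with hnn | hnn | hnn
      · nlinarith [step hnn, hlt.1]
      · have hnn : n = n' := PNat.coe_injective hnn
        subst hnn
        rw [bladePos_cons, bladePos_cons, ← mul_sub, abs_mul, abs_of_pos hn,
          mul_lt_mul_iff_right₀ hn, add_sub_add_left_eq_sub] at h
        rcases ih r' (h.trans_le (min_le_left _ _)) with rfl | ⟨j, hj, q, rfl⟩
        · exact Or.inl rfl
        · exact Or.inr ⟨j, hj, q, rfl⟩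
      · nlinarith [step hnn, hlt.2]

/-- Two different indices with the same position would each properly extend the other. -/
theorem bladePos_injective : Function.Injective bladePos := by
  intro l l' h
  rcases exists_eq_append_of_bladePos_close l 0 with ⟨δ, hδ, hl⟩
  rcases hl l' (by rwa [h, sub_self, abs_zero]) with h | ⟨j, hj, r, hr⟩
  · exact h.symm
  rcases exists_eq_append_of_bladePos_close l' 0 with ⟨δ, hδ, hl'⟩
  rcases hl' l (by rwa [h, sub_self, abs_zero]) with h | ⟨j', hj', r', hr'⟩
  · exact h
  have h1 := congrArg List.length hr
  have h2 := congrArg List.length hr'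
  simp at h1 h2
  omega

theorem tendsto_pow_pnat {a : ℝ} (h0 : 0 ≤ a) (h1 : a < 1) :
    Tendsto (fun n : ℕ+ => a ^ (n : ℕ)) cofinite (𝓝 0) := by
  have h := PNat.coe_injective.tendsto_cofinite
  rw [Nat.cofinite_eq_atTop] at h
  exact (tendsto_pow_atTop_nhds_zero_of_lt_one h0 h1).comp h

theorem tendsto_bladePos_singleton :
    Tendsto (fun n : ℕ+ => bladePos [n]) cofinite (𝓝 (bladePos [])) := by
  simp only [bladePos_cons, bladePos_nil]
  simpa using (tendsto_pow_pnat (a := 1 / 3) (by norm_num) (by norm_num)).mul_const 2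

theorem tendsto_bladePos_append (l : List ℕ+) :
    Tendsto (fun n : ℕ+ => bladePos (l ++ [n])) cofinite (𝓝 (bladePos l)) := by
  induction l with
  | nil => exact tendsto_bladePos_singleton
  | cons m r ih =>
    simp only [List.cons_append, bladePos_cons]
    exact (ih.const_add 2).const_mul _

theorem bladeHeight_nil (M : ℝ) (y : ℕ+ → ℝ) : bladeHeight M y [] = 1 := by simp [bladeHeight]

theorem bladeHeight_singleton (M : ℝ) (y : ℕ+ → ℝ) (n : ℕ+) : bladeHeight M y [n] = y n := by
  simp [bladeHeight]

/-- The exponent of `M` omits the last entry, so the scaling excludes `r = []`: the blade `[n]` has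
height `y n`, without the factor `M ^ n`. -/
theorem bladeHeight_cons (M : ℝ) (y : ℕ+ → ℝ) (n : ℕ+) {r : List ℕ+} (hr : r ≠ []) :
    bladeHeight M y (n :: r) = M ^ (n : ℕ) * y n * bladeHeight M y r := by
  simp only [bladeHeight, List.dropLast_cons_of_ne_nil hr, List.map_cons, List.sum_cons, pow_add,
    List.prod_cons]
  ring

/-- The inequalities on the parameters of a comb. -/
structure IsCombParam (M : ℝ) (y : ℕ+ → ℝ) : Prop where
  lt_one : M < 1
  pos : ∀ n, 0 < y n
  le : ∀ n, y n ≤ M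

/-! ### Bounds on the heights and closedness of the comb -/

namespace IsCombParam

variable {M : ℝ} {y : ℕ+ → ℝ}

theorem M_pos (hp : IsCombParam M y) : 0 < M := (hp.pos 1).trans_le (hp.le 1)

theorem y_lt_one (hp : IsCombParam M y) (n : ℕ+) : y n < 1 := (hp.le n).trans_lt hp.lt_one

theorem height_pos (hp : IsCombParam M y) (l : List ℕ+) : 0 < bladeHeight M y l :=
  mul_pos (pow_pos hp.M_pos _) (List.prod_pos fun a ha => by
    obtain ⟨n, -, rfl⟩ := List.mem_map.1 ha
    exact hp.pos n)

theorem height_le (hp : IsCombParam M y) {l : List ℕ+} (hl : l ≠ []) : bladeHeight M y l ≤ M := by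
  induction l with
  | nil => exact absurd rfl hl
  | cons n r ih =>
    by_cases hr : r = []
    · rw [hr, bladeHeight_singleton]
      exact hp.le n
    · rw [bladeHeight_cons M y n hr]
      exact (mul_le_of_le_one_left (hp.height_pos r).le (mul_le_one₀
        (pow_le_one₀ hp.M_pos.le hp.lt_one.le) (hp.pos n).le (hp.y_lt_one n).le)).trans (ih hr)

theorem height_le_one (hp : IsCombParam M y) (l : List ℕ+) : bladeHeight M y l ≤ 1 := by
  by_cases hl : l = []
  · rw [hl, bladeHeight_nil]
  · exact (hp.height_le hl).trans hp.lt_one.le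

/-- Here `j` is not the last entry, so `M ^ j` is a factor of the height. This is why deeper
descendants do not accumulate away from the top. -/
theorem height_append_le (hp : IsCombParam M y) (l : List ℕ+) (j i : ℕ+) (r : List ℕ+) :
    bladeHeight M y (l ++ j :: i :: r) ≤ M ^ (j : ℕ) := by
  induction l with
  | nil =>
    rw [List.nil_append, bladeHeight_cons M y j (List.cons_ne_nil _ _), mul_assoc]
    exact mul_le_of_le_one_right (pow_nonneg hp.M_pos.le _) (mul_le_one₀ (hp.y_lt_one j).le
      (hp.height_pos _).le (hp.height_le_one _))
  | cons n q ih =>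
    rw [List.cons_append, bladeHeight_cons M y n (by simp)]
    exact (mul_le_of_le_one_left (hp.height_pos _).le (mul_le_one₀
        (pow_le_one₀ hp.M_pos.le hp.lt_one.le) (hp.pos n).le (hp.y_lt_one n).le)).trans ih

/-- The long blades close to a given blade are its children, with finitely many exceptions. -/
theorem exists_child_of_close (hp : IsCombParam M y) (l : List ℕ+) {P : ℕ+ → Prop}
    (hP : ∀ᶠ j in cofinite, P j) {ε : ℝ} (hε : 0 < ε) : ∃ δ > 0, ∀ l' : List ℕ+,
      |bladePos l' - bladePos l| < δ → ε ≤ bladeHeight M y l' →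
        l' = l ∨ ∃ j, P j ∧ l' = l ++ [j] := by
  have h1 : ∀ᶠ j : ℕ+ in cofinite, P j ∧ M ^ (j : ℕ) < ε :=
    hP.and ((tendsto_pow_pnat hp.M_pos.le hp.lt_one).eventually (gt_mem_nhds hε))
  -- Beyond `N` the property `P` holds and proper descendants of `l ++ [j]` are shorter than `ε`.
  obtain ⟨N, hN⟩ := (show {j : ℕ+ | ¬(P j ∧ M ^ (j : ℕ) < ε)}.Finite from h1).bddAbove
  obtain ⟨δ, hδ, hl⟩ := exists_eq_append_of_bladePos_close l N
  refine ⟨δ, hδ, fun l' h h' => (hl l' h).imp_right ?_⟩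
  rintro ⟨j, hj, r, rfl⟩
  have hPj : P j ∧ M ^ (j : ℕ) < ε := by
    by_contra hcon
    exact absurd (hN hcon) (not_le.2 (by exact_mod_cast hj))
  refine ⟨j, hPj.1, ?_⟩
  cases r with
  | nil => rfl
  | cons i r => exact absurd (h'.trans (hp.height_append_le l j i r)) (not_le.2 hPj.2)

/-- The positions `[n]` decrease to the root, so the set is an intersection over `N` of closed sets:
the first `N` children and a box of width `bladePos [N]` beside the root. -/
theorem isClosed_children (hp : IsCombParam M y) (ε : ℝ) :
    IsClosed (({0} ×ˢ Icc ε 1 : Set (ℝ × ℝ)) ∪ ⋃ n : ℕ+, {bladePos [n]} ×ˢ Icc ε (y n)) := by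
  have hpos : ∀ n : ℕ+, bladePos [n] = 2 * (1 / 3) ^ (n : ℕ) := fun n => by
    rw [bladePos_cons, bladePos_nil]; ring
  have hanti : ∀ {m n : ℕ+}, m ≤ n → bladePos [n] ≤ bladePos [m] := by
    intro m n h
    rw [hpos, hpos]
    have := pow_le_pow_of_le_one (a := (1 / 3 : ℝ)) (by norm_num) (by norm_num)
      (PNat.coe_le_coe _ _ |>.2 h)
    linarith
  have heq : (({0} ×ˢ Icc ε 1 : Set (ℝ × ℝ)) ∪ ⋃ n : ℕ+, {bladePos [n]} ×ˢ Icc ε (y n)) =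
      ⋂ N : ℕ+, (Icc 0 (bladePos [N]) ×ˢ Icc ε 1 ∪
        ⋃ n ∈ Iic N, {bladePos [n]} ×ˢ Icc ε (y n)) := by
    ext ⟨x, s⟩
    constructor
    · rintro (⟨hx, hs⟩ | h)
      · exact mem_iInter.2 fun N => Or.inl ⟨by rw [mem_singleton_iff.1 hx]; exact
          ⟨le_rfl, (bladePos_mem _).1⟩, hs⟩
      · obtain ⟨n, hx, hs⟩ := mem_iUnion.1 h
        refine mem_iInter.2 fun N => ?_
        rcases le_total n N with h | h
        · exact Or.inr (mem_iUnion₂.2 ⟨n, h, hx, hs⟩)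
        · refine Or.inl ⟨?_, hs.1, hs.2.trans (hp.y_lt_one n).le⟩
          rw [mem_singleton_iff.1 hx]
          exact ⟨(bladePos_mem _).1, hanti h⟩
    · intro h
      rw [mem_iInter] at h
      by_cases hx : x ≤ 0
      · rcases h 1 with ⟨h1, h2⟩ | h1
        · exact Or.inl ⟨le_antisymm hx h1.1, h2⟩
        · obtain ⟨n, -, h2⟩ := mem_iUnion₂.1 h1
          exact Or.inr (mem_iUnion.2 ⟨n, h2⟩)
      · have hev : ∀ᶠ n : ℕ+ in cofinite, bladePos [n] < x := by
          refine tendsto_bladePos_singleton.eventually (gt_mem_nhds ?_)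
          rw [bladePos_nil]
          exact not_le.1 hx
        obtain ⟨N, hN⟩ := hev.exists
        rcases h N with ⟨h1, -⟩ | h1
        · exact absurd (h1.2.trans_lt hN) (lt_irrefl _)
        · obtain ⟨n, -, h2⟩ := mem_iUnion₂.1 h1
          exact Or.inr (mem_iUnion.2 ⟨n, h2⟩)
  rw [heq]
  exact isClosed_iInter fun N => (isClosed_Icc.prod isClosed_Icc).union
    ((finite_Iic N).isClosed_biUnion fun n _ => isClosed_singleton.prod isClosed_Icc)

/-- Induction through self-similarity. Only finitely many branches reach height `ε` beyond their
first blade, and each is an affine copy of a truncation at `ε / (M ^ n * y n)`, which exceeds `M ^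
k` as `M ^ n * y n ≤ M`. -/
theorem isClosed_truncation (hp : IsCombParam M y) (k : ℕ) : ∀ ε : ℝ, M ^ k < ε →
    IsClosed {p : ℝ × ℝ | ∃ l, p.1 = bladePos l ∧ ε ≤ p.2 ∧ p.2 ≤ bladeHeight M y l} := by
  have hM := hp.M_pos
  induction k with
  | zero =>
    intro ε hε
    convert isClosed_empty
    refine eq_empty_iff_forall_notMem.2 ?_
    rintro p ⟨l, -, h1, h2⟩
    have := hp.height_le_one l
    rw [pow_zero] at hε
    linarith
  | succ k ih =>
    intro ε hε
    have hε0 : 0 < ε := (pow_pos hM _).trans hε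
    have hfin : {n : ℕ+ | ¬ M ^ (n : ℕ) < ε}.Finite :=
      (tendsto_pow_pnat hM.le hp.lt_one).eventually (gt_mem_nhds hε0)
    have hq : ∀ n : ℕ+, 0 < M ^ (n : ℕ) * y n := fun n => mul_pos (pow_pos hM _) (hp.pos n)
    have hqM : ∀ n : ℕ+, M ^ (n : ℕ) * y n ≤ M := fun n =>
      (mul_le_of_le_one_left (hp.pos n).le (pow_le_one₀ hM.le hp.lt_one.le)).trans (hp.le n)
    have hsub : ∀ n : ℕ+, IsClosed ((fun p : ℝ × ℝ => (3 ^ (n : ℕ) * p.1 - 2,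
        p.2 / (M ^ (n : ℕ) * y n))) ⁻¹' {p : ℝ × ℝ | ∃ l, p.1 = bladePos l ∧
          ε / (M ^ (n : ℕ) * y n) ≤ p.2 ∧ p.2 ≤ bladeHeight M y l}) := by
      intro n
      refine IsClosed.preimage (by fun_prop) (ih _ ?_)
      rw [lt_div_iff₀ (hq n)]
      refine (mul_le_mul_of_nonneg_left (hqM n) (pow_nonneg hM.le _)).trans_lt ?_
      rwa [← pow_succ]
    convert (hp.isClosed_children ε).union (hfin.isClosed_biUnion fun n _ => hsub n)
    ext ⟨x, s⟩
    simp only [mem_ofPred_eq, mem_union, mem_prod, mem_singleton_iff, mem_Icc, mem_iUnion,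
      mem_preimage, div_le_div_iff_of_pos_right (hq _), exists_prop]
    have hx3 : ∀ (n : ℕ+) (l : List ℕ+), 3 ^ (n : ℕ) * x - 2 = bladePos l ↔
        x = bladePos (n :: l) := by
      intro n l
      rw [bladePos_cons, one_div, inv_pow, sub_eq_iff_eq_add, add_comm,
        eq_inv_mul_iff_mul_eq₀ (by positivity)]
    constructor
    · rintro ⟨l, rfl, h1, h2⟩
      cases l with
      | nil => exact Or.inl (Or.inl ⟨bladePos_nil, h1, h2.trans (hp.height_le_one _)⟩)
      | cons n r =>
        by_cases hr : r = []
        · subst hr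
          rw [bladeHeight_singleton] at h2
          exact Or.inl (Or.inr ⟨n, rfl, h1, h2⟩)
        · rw [bladeHeight_cons M y n hr] at h2
          refine Or.inr ⟨n, ?_, r, (hx3 n r).2 rfl, h1, ?_⟩
          · rw [not_lt]
            refine (h1.trans h2).trans ?_
            rw [mul_assoc]
            exact mul_le_of_le_one_right (pow_nonneg hM.le _) (mul_le_one₀ (hp.y_lt_one n).le
              (hp.height_pos _).le (hp.height_le_one _))
          · rwa [div_le_iff₀ (hq n), mul_comm]
    · rintro ((⟨rfl, h1, h2⟩ | ⟨n, rfl, h1, h2⟩) | ⟨n, -, r, hx, h1, h2⟩)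
      · exact ⟨[], bladePos_nil.symm, h1, by rwa [bladeHeight_nil]⟩
      · exact ⟨[n], rfl, h1, by rwa [bladeHeight_singleton]⟩
      · refine ⟨n :: r, (hx3 n r).1 hx, h1, ?_⟩
        rw [div_le_iff₀ (hq n)] at h2
        -- The affine copy of the root has height `M ^ n * y n`, so it is only a part of the blade
        -- `[n]`.
        by_cases hr : r = []
        · subst hr
          rw [bladeHeight_nil, one_mul] at h2
          rw [bladeHeight_singleton]
          exact h2.trans (mul_le_of_le_one_left (hp.pos n).le (pow_le_one₀ hM.le hp.lt_one.le))
        · rw [bladeHeight_cons M y n hr]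
          linarith

theorem mem_comb {p : ℝ × ℝ} : p ∈ comb M y ↔
    (p.1 ∈ Icc (0 : ℝ) 1 ∧ p.2 = 0) ∨ ∃ l, p.1 = bladePos l ∧ 0 ≤ p.2 ∧ p.2 ≤ bladeHeight M y l := by
  simp [comb, mem_prod]

theorem comb_subset (hp : IsCombParam M y) : comb M y ⊆ Icc 0 1 ×ˢ Icc 0 1 := by
  intro p h
  rcases mem_comb.1 h with ⟨h1, h2⟩ | ⟨l, h1, h2, h3⟩
  · exact ⟨h1, by rw [h2]; simp⟩
  · refine ⟨?_, h2, h3.trans (hp.height_le_one l)⟩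
    rw [h1]
    exact ⟨(bladePos_mem l).1, (bladePos_mem l).2.le⟩

theorem isClosed_comb (hp : IsCombParam M y) : IsClosed (comb M y) := by
  refine isClosed_of_closure_subset fun p h => ?_
  have hbox : p ∈ Icc (0 : ℝ) 1 ×ˢ Icc (0 : ℝ) 1 :=
    closure_minimal hp.comb_subset (isClosed_Icc.prod isClosed_Icc) h
  rcases hbox.2.1.eq_or_lt with h0 | h0
  · exact mem_comb.2 (Or.inl ⟨hbox.1, h0.symm⟩)
  -- At positive height, truncating at half the height removes the base and leaves a closed set.
  obtain ⟨k, hk⟩ := exists_pow_lt_of_lt_one (half_pos h0) hp.lt_one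
  have hU : {q : ℝ × ℝ | p.2 / 2 < q.2} ∈ 𝓝 p :=
    (isOpen_lt continuous_const continuous_snd).mem_nhds (half_lt_self h0)
  have h2 : p ∈ closure {q : ℝ × ℝ | ∃ l, q.1 = bladePos l ∧ p.2 / 2 ≤ q.2 ∧
      q.2 ≤ bladeHeight M y l} := by
    rw [mem_closure_iff_nhds]
    intro V hV
    obtain ⟨q, ⟨hqV, hqU⟩, hqC⟩ := mem_closure_iff_nhds.1 h _ (inter_mem hV hU)
    refine ⟨q, hqV, ?_⟩
    have hqU : p.2 / 2 < q.2 := hqU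
    rcases mem_comb.1 hqC with ⟨-, h2⟩ | ⟨l, h1, h2, h3⟩
    · linarith [half_pos h0]
    · exact ⟨l, h1, hqU.le, h3⟩
  rw [(hp.isClosed_truncation k _ hk).closure_eq] at h2
  obtain ⟨l, h1, h2, h3⟩ := h2
  exact mem_comb.2 (Or.inr ⟨l, h1, h0.le, h3⟩)

theorem isComb (hp : IsCombParam M y) : IsComb (comb M y) where
  subset := hp.comb_subset
  closed := hp.isClosed_comb
  bottom := by
    ext x
    refine ⟨fun h => (hp.comb_subset h).1, fun h => mem_comb.2 (Or.inl ⟨h, rfl⟩)⟩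
  cantor := by
    rintro s hs x hx
    rcases mem_comb.1 hx with ⟨-, h⟩ | ⟨l, h, -⟩
    · exact absurd h hs.1.ne'
    · change x = _ at h
      rw [h]
      exact bladePos_mem_cantorSet l
  antitone := by
    rintro s hs s' hs' hss x hx
    rcases mem_comb.1 hx with ⟨h, h'⟩ | ⟨l, h, h1, h2⟩
    · exact absurd h' (hs.1.trans_lt hss).ne'
    · exact mem_comb.2 (Or.inr ⟨l, h, hs.1, hss.le.trans h2⟩)
  three := by
    have hpos := lt_min (hp.pos 1) (hp.pos 2)
    have hle : min (y 1) (y 2) ≤ 1 := (min_le_left _ _).trans (hp.y_lt_one 1).le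
    refine ⟨min (y 1) (y 2), ⟨hpos, hle⟩, ?_⟩
    have hsub : bladePos '' {[], [1], [2]} ⊆ {x | (x, min (y 1) (y 2)) ∈ comb M y} := by
      rintro _ ⟨l, hl, rfl⟩
      refine mem_comb.2 (Or.inr ⟨l, rfl, hpos.le, ?_⟩)
      rcases hl with rfl | rfl | rfl
      · rwa [bladeHeight_nil]
      · rw [bladeHeight_singleton]; exact min_le_left _ _
      · rw [bladeHeight_singleton]; exact min_le_right _ _
    refine lt_of_lt_of_le ?_ (encard_le_encard hsub)
    rw [bladePos_injective.encard_image, encard_insert_of_notMem (by simp), encard_pair (by simp)]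
    norm_num

/-! ### The planar model of the fan of a comb and the limits of its ends -/

theorem compactSpace (hp : IsCombParam M y) : CompactSpace (CombFan (comb M y)) := by
  have : CompactSpace (comb M y) := isCompact_iff_compactSpace.1
    ((isCompact_Icc.prod isCompact_Icc).of_isClosed_subset hp.isClosed_comb hp.comb_subset)
  exact inferInstanceAs (CompactSpace (Quotient (combSetoid (comb M y))))

/-- The fan of a comb as a union of segments in the plane. -/
noncomputable def model (hp : IsCombParam M y) : FanModel (List ℕ+) (CombFan (comb M y)) where
  pos := bladePos
  len := bladeHeight M y
  -- Multiplying the abscissa by the height collapses the base to the origin and identifies nothing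
  -- else.
  coord := Quotient.lift (s := combSetoid (comb M y))
    (fun p : comb M y => (p.1.2 * p.1.1, p.1.2)) (by
      rintro p q (rfl | ⟨h, h'⟩)
      · rfl
      · simp [h, h'])
  -- Heights are clamped to the blade, so that the parametrization is continuous on the whole line.
  pt := fun l s => Quotient.mk (combSetoid (comb M y))
    ⟨(bladePos l, max 0 (min s (bladeHeight M y l))), mem_comb.2 (Or.inr ⟨l, rfl, le_max_left _ _,
      max_le (hp.height_pos l).le (min_le_right _ _)⟩)⟩
  top := Quotient.mk (combSetoid (comb M y)) ⟨(0, 0), mem_comb.2 (Or.inl ⟨by simp, rfl⟩)⟩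
  pos_injective := bladePos_injective
  len_pos := hp.height_pos
  isEmbedding := by
    have := hp.compactSpace
    refine (Continuous.isClosedEmbedding ?_ ?_).isEmbedding
    · exact Continuous.quotient_lift (by fun_prop) _
    · intro p q
      refine Quotient.inductionOn₂ p q fun p q h => Quotient.sound ?_
      obtain ⟨h1, h2⟩ := Prod.mk.injEq _ _ _ _ ▸ h
      by_cases h0 : p.1.2 = 0
      · exact Or.inr ⟨h0, h2 ▸ h0⟩
      · refine Or.inl (Subtype.ext (Prod.ext ?_ h2))
        rw [← h2] at h1
        exact mul_left_cancel₀ h0 h1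
  coord_top := by simp
  coord_pt := by
    intro l s h0 h1
    simp [h0, h1]
  continuous_pt := fun l => continuous_quotient_mk'.comp
    (Continuous.subtype_mk (by fun_prop) _)
  exists_pt := by
    intro x
    refine Quotient.inductionOn x fun p => ?_
    rcases mem_comb.1 p.2 with ⟨-, h⟩ | ⟨l, h1, h2, h3⟩
    · exact ⟨[], 0, le_rfl, (hp.height_pos _).le, Quotient.sound (Or.inr ⟨by
        simp [(hp.height_pos []).le], h⟩)⟩
    · refine ⟨l, p.1.2, h2, h3, Quotient.sound (Or.inl (Subtype.ext (Prod.ext h1.symm ?_)))⟩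
      simp [h2, h3]

theorem isTop (hp : IsCombParam M y) : IsTop hp.model.top :=
  hp.model.isTop (l₁ := []) (l₂ := [1]) (l₃ := [2]) (by simp) (by simp) (by simp)

theorem isSmoothFan (hp : IsCombParam M y) : IsSmoothFan (CombFan (comb M y)) :=
  have := hp.compactSpace
  hp.model.isSmoothFan hp.isTop

theorem len_model (hp : IsCombParam M y) : hp.model.len = bladeHeight M y := rfl

theorem pos_model (hp : IsCombParam M y) : hp.model.pos = bladePos := rfl

/-- Near a point of a blade other than the top there are only points of this blade and of its
children, with finitely many exceptions. -/
theorem eventually_nhds_pt (hp : IsCombParam M y) {l : List ℕ+} {s : ℝ} (h0 : 0 < s)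
    (h1 : s ≤ bladeHeight M y l) {P : ℕ+ → Prop} (hP : ∀ᶠ j in cofinite, P j) :
    ∀ᶠ z in 𝓝 (hp.model.pt l s),
      hp.model.idx z = l ∨ ∃ j, P j ∧ hp.model.idx z = l ++ [j] := by
  obtain ⟨δ, hδ, hl⟩ := hp.exists_child_of_close l hP (half_pos h0)
  have hht : hp.model.ht (hp.model.pt l s) = s := hp.model.ht_pt h0.le h1
  have e1 : ∀ᶠ z in 𝓝 (hp.model.pt l s), s / 2 < hp.model.ht z :=
    hp.model.continuous_ht.continuousAt.eventually (lt_mem_nhds (by rw [hht]; linarith))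
  -- Off the top, the quotient of the two plane coordinates is the position of the blade.
  have e2 : ∀ᶠ z in 𝓝 (hp.model.pt l s),
      |(hp.model.coord z).1 / hp.model.ht z - bladePos l| < δ := by
    have hc : ContinuousAt (fun z => |(hp.model.coord z).1 / hp.model.ht z - bladePos l|)
        (hp.model.pt l s) := by
      refine ((ContinuousAt.div hp.model.continuous_coord.fst.continuousAt
        hp.model.continuous_ht.continuousAt ?_).sub continuousAt_const).abs
      rw [hht]
      exact h0.ne'
    refine hc.eventually (gt_mem_nhds ?_)
    beta_reduce
    rw [hht, hp.model.coord_pt l s h0.le h1, mul_div_cancel_left₀ _ h0.ne', pos_model, sub_self,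
      abs_zero]
    exact hδ
  filter_upwards [e1, e2] with z hz1 hz2
  have hz0 : 0 < hp.model.ht z := (half_pos h0).trans hz1
  refine hl _ ?_ (hz1.le.trans (hp.model.ht_le z))
  rwa [hp.model.coord_eq z, mul_div_cancel_left₀ _ hz0.ne', pos_model] at hz2

theorem endpoints_eq (hp : IsCombParam M y) :
    endpoints (CombFan (comb M y)) = range fun l => hp.model.pt l (bladeHeight M y l) :=
  hp.model.endpoints_eq

theorem isArcBetween_blade (hp : IsCombParam M y) (l : List ℕ+) :
    IsArcBetween (hp.model.pt l '' Icc 0 (bladeHeight M y l)) hp.model.top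
      (hp.model.pt l (bladeHeight M y l)) := by
  have := hp.model.isArcBetween_pt (l := l) le_rfl (hp.height_pos l) le_rfl
  rwa [hp.model.pt_zero] at this

/-- The limits on the root blade of the ends of the other blades. -/
theorem root_inter_closure (hp : IsCombParam M y) (hfib : ∀ n, {k | y k = y n}.Infinite) :
    hp.model.pt [] '' Icc 0 1 ∩ closure (endpoints (CombFan (comb M y)) \
      hp.model.pt [] '' Icc 0 1) = hp.model.pt [] '' insert 0 (closure (range y)) := by
  have hE : endpoints (CombFan (comb M y)) \ hp.model.pt [] '' Icc 0 1 =
      (fun l => hp.model.pt l (bladeHeight M y l)) '' {[]}ᶜ := by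
    rw [hp.endpoints_eq]
    ext x
    constructor
    · rintro ⟨⟨l, rfl⟩, hl⟩
      refine ⟨l, ?_, rfl⟩
      rintro rfl
      exact hl ⟨1, by simp, by simp [bladeHeight_nil]⟩
    · rintro ⟨l, hl, rfl⟩
      refine ⟨⟨l, rfl⟩, ?_⟩
      rintro ⟨s, hs, h⟩
      exact hl (hp.model.pt_inj (hp.height_pos l) le_rfl hs.1
        (by rw [len_model, bladeHeight_nil]; exact hs.2) h.symm).1
  rw [hE]
  have hy01 : closure (range y) ⊆ Icc 0 1 := closure_minimal
    (range_subset_iff.2 fun n => ⟨(hp.pos n).le, (hp.y_lt_one n).le⟩) isClosed_Icc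
  refine Subset.antisymm ?_ ?_
  · rintro _ ⟨⟨s, hs, rfl⟩, hcl⟩
    refine ⟨s, ?_, rfl⟩
    rcases hs.1.eq_or_lt with h0 | h0
    · exact Or.inl h0.symm
    have hs1 : s ≤ bladeHeight M y [] := by rw [bladeHeight_nil]; exact hs.2
    refine Or.inr (Metric.mem_closure_iff.2 fun ε hε => ?_)
    have e1 := hp.eventually_nhds_pt h0 hs1 (P := fun _ => True) (by simp)
    have e2 : ∀ᶠ z in 𝓝 (hp.model.pt [] s), dist s (hp.model.ht z) < ε := by
      have hc : ContinuousAt (fun z => dist s (hp.model.ht z)) (hp.model.pt [] s) :=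
        continuousAt_const.dist hp.model.continuous_ht.continuousAt
      refine hc.eventually (gt_mem_nhds ?_)
      beta_reduce
      rw [hp.model.ht_pt h0.le hs1, dist_self]
      exact hε
    obtain ⟨_, ⟨h1, h2⟩, ⟨l, hl, rfl⟩⟩ := mem_closure_iff_nhds.1 hcl _ (e1.and e2)
    rw [hp.model.idx_pt (hp.height_pos l) le_rfl] at h1
    rw [hp.model.ht_pt (hp.height_pos l).le le_rfl] at h2
    rcases h1 with h1 | ⟨j, -, rfl⟩
    · exact absurd h1 hl
    · rw [List.nil_append, bladeHeight_singleton] at h2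
      exact ⟨y j, mem_range_self j, h2⟩
  · rintro _ ⟨s, hs, rfl⟩
    have hs1 : s ∈ Icc (0 : ℝ) 1 := by
      rcases hs with rfl | hs
      · simp
      · exact hy01 hs
    refine ⟨⟨s, hs1, rfl⟩, ?_⟩
    have hs1' : s ≤ bladeHeight M y [] := by rw [bladeHeight_nil]; exact hs1.2
    rw [hp.model.isEmbedding.isInducing.closure_eq_preimage_closure_image, mem_preimage,
      hp.model.coord_pt [] s hs1.1 hs1', pos_model, bladePos_nil, mul_zero, image_image,
      Metric.mem_closure_iff]
    intro ε hε
    suffices ∃ l ≠ [], bladeHeight M y l * bladePos l < ε ∧ |s - bladeHeight M y l| < ε by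
      obtain ⟨l, hl, h1, h2⟩ := this
      refine ⟨_, ⟨l, hl, rfl⟩, ?_⟩
      beta_reduce
      rw [hp.model.coord_pt l _ (hp.height_pos l).le le_rfl, Prod.dist_eq, max_lt_iff,
        Real.dist_eq, Real.dist_eq, pos_model, zero_sub, abs_neg,
        abs_of_nonneg (mul_nonneg (hp.height_pos l).le (bladePos_mem l).1)]
      exact ⟨h1, h2⟩
    rcases hs with rfl | hs
    · obtain ⟨j, hj⟩ := ((tendsto_pow_pnat hp.M_pos.le hp.lt_one).eventually
        (gt_mem_nhds hε)).exists
      have hlt : bladeHeight M y [j, 1] < ε := (hp.height_append_le [] j 1 []).trans_lt hj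
      have hpos := hp.height_pos [j, 1]
      refine ⟨[j, 1], by simp, ?_, by rwa [zero_sub, abs_neg, abs_of_pos hpos]⟩
      exact (mul_le_of_le_one_right hpos.le (bladePos_mem _).2.le).trans_lt hlt
    · obtain ⟨_, ⟨n, rfl⟩, hn⟩ := Metric.mem_closure_iff.1 hs ε hε
      have hev : ∀ᶠ j : ℕ+ in cofinite, bladePos [j] < ε := by
        refine tendsto_bladePos_singleton.eventually (gt_mem_nhds ?_)
        rwa [bladePos_nil]
      -- Infinitely many children have height `y n`, some of them arbitrarily close to the root.
      obtain ⟨j, hjn, hj⟩ := ((frequently_cofinite_iff_infinite.2 (hfib n)).and_eventually hev).exists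
      refine ⟨[j], by simp, ?_, ?_⟩
      · exact (mul_le_of_le_one_left (bladePos_mem _).1 (hp.height_le_one _)).trans_lt hj
      · rwa [bladeHeight_singleton, hjn, ← Real.dist_eq]

end IsCombParam

/-! ### Order isomorphisms of the line -/

/-- Two order isomorphisms of the line that agree at a point can be glued there. -/
theorem exists_glue (f g : ℝ ≃o ℝ) {a : ℝ} (h : f a = g a) :
    ∃ k : ℝ ≃o ℝ, (∀ s ≤ a, k s = f s) ∧ ∀ s, a ≤ s → k s = g s := by
  let k : ℝ → ℝ := fun s => if s ≤ a then f s else g s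
  have hle : ∀ s ≤ a, k s = f s := fun s hs => if_pos hs
  have hge : ∀ s, a ≤ s → k s = g s := by
    intro s hs
    rcases hs.eq_or_lt with rfl | hs
    · rw [hle _ le_rfl, h]
    · exact if_neg hs.not_ge
  have hmono : StrictMono k := by
    intro s t hst
    rcases le_or_gt t a with ht | ht
    · rw [hle s (hst.le.trans ht), hle t ht]
      exact f.strictMono hst
    · rw [hge t ht.le]
      rcases le_or_gt s a with hs | hs
      · rw [hle s hs]
        exact (f.monotone hs).trans_lt (h ▸ g.strictMono ht)
      · rw [hge s hs.le]
        exact g.strictMono hst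
  have hsurj : Function.Surjective k := by
    intro t
    rcases le_total t (f a) with ht | ht
    · exact ⟨f.symm t, by rw [hle _ (by rwa [OrderIso.symm_apply_le]), f.apply_symm_apply]⟩
    · exact ⟨g.symm t, by rw [hge _ (by rwa [OrderIso.le_symm_apply, ← h]), g.apply_symm_apply]⟩
  exact ⟨hmono.orderIsoOfSurjective k hsurj, hle, hge⟩

/-- The affine order isomorphism of the line that maps `a` to `c` and `b` to `d`. -/
theorem exists_affine {a b c d : ℝ} (hab : a < b) (hcd : c < d) :
    ∃ k : ℝ ≃o ℝ, ∀ s, k s = c + (d - c) / (b - a) * (s - a) := by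
  have hr : 0 < (d - c) / (b - a) := div_pos (by linarith) (by linarith)
  refine ⟨StrictMono.orderIsoOfSurjective (fun s => c + (d - c) / (b - a) * (s - a)) ?_ ?_,
    fun s => rfl⟩
  · intro s t hst
    have := mul_lt_mul_of_pos_left hst hr
    simp only [mul_sub]
    linarith
  · intro t
    refine ⟨(t - c) / ((d - c) / (b - a)) + a, ?_⟩
    simp only [add_sub_cancel_right]
    rw [mul_div_cancel₀ _ hr.ne']
    ring

theorem affine_left {a b c d : ℝ} : c + (d - c) / (b - a) * (a - a) = c := by ring

theorem affine_right {a b c d : ℝ} (hab : a < b) : c + (d - c) / (b - a) * (b - a) = d := by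
  rw [div_mul_cancel₀ _ (by linarith)]
  ring

/-- An order isomorphism that is linear near `0` and equal to a given one beyond a given point. -/
theorem exists_linear_glue (f : ℝ ≃o ℝ) {α β η : ℝ} (hα : 0 < α) (hβ : 0 < β) (h : α < η)
    (h' : β < f η) : ∃ k : ℝ ≃o ℝ, (∀ s ≤ α, k s = β / α * s) ∧ ∀ s, η ≤ s → k s = f s := by
  obtain ⟨u, hu⟩ := exists_affine hα hβ
  obtain ⟨v, hv⟩ := exists_affine h h'
  obtain ⟨p, hp, hp'⟩ := exists_glue v f (a := η) (by rw [hv, affine_right h])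
  obtain ⟨q, hq, hq'⟩ := exists_glue u p (a := α) (by
    rw [hp α h.le, hu, hv, affine_right hα, affine_left])
  refine ⟨q, fun s hs => ?_, fun s hs => ?_⟩
  · rw [hq s hs, hu]
    simp
  · rw [hq' s (h.le.trans hs), hp' s hs]

/-! ### Homeomorphisms of the fan of a comb -/

/-- A permutation of the blades, together with order isomorphisms between blades and their images,
that induces a homeomorphism of the fan of a comb. -/
structure BladeMap (M : ℝ) (y : ℕ+ → ℝ) where
  perm : List ℕ+ ≃ List ℕ+
  iso : List ℕ+ → ℝ ≃o ℝ
  iso_zero : ∀ l, iso l 0 = 0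
  iso_height : ∀ l, iso l (bladeHeight M y l) = bladeHeight M y (perm l)
  -- This and `eventually_eq` give continuity off the top, where only children accumulate; `small`,
  -- being uniform in the index, gives it at the top.
  tendsto_pos : ∀ l, Tendsto (fun j => bladePos (perm (l ++ [j]))) cofinite
    (𝓝 (bladePos (perm l)))
  eventually_eq : ∀ l, ∀ δ > 0, ∀ᶠ j in cofinite, ∀ s ≥ δ, iso (l ++ [j]) s = iso l s
  small : ∀ ε > 0, ∃ δ > 0, ∀ l, iso l δ < ε

namespace BladeMap

variable {M : ℝ} {y : ℕ+ → ℝ} (B : BladeMap M y) (hp : IsCombParam M y)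

theorem iso_nonneg (l : List ℕ+) {s : ℝ} (h : 0 ≤ s) : 0 ≤ B.iso l s := by
  rw [← B.iso_zero l]
  exact (B.iso l).monotone h

theorem iso_pos (l : List ℕ+) {s : ℝ} (h : 0 < s) : 0 < B.iso l s := by
  rw [← B.iso_zero l]
  exact (B.iso l).strictMono h

theorem iso_le (l : List ℕ+) {s : ℝ} (h : s ≤ bladeHeight M y l) :
    B.iso l s ≤ bladeHeight M y (B.perm l) := by
  rw [← B.iso_height l]
  exact (B.iso l).monotone h

/-- The self-map of the fan of a comb that is induced by a blade map. -/
noncomputable def toFun (x : CombFan (comb M y)) : CombFan (comb M y) :=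
  hp.model.pt (B.perm (hp.model.idx x)) (B.iso (hp.model.idx x) (hp.model.ht x))

theorem toFun_pt {l : List ℕ+} {s : ℝ} (h0 : 0 ≤ s) (h1 : s ≤ bladeHeight M y l) :
    B.toFun hp (hp.model.pt l s) = hp.model.pt (B.perm l) (B.iso l s) := by
  rw [toFun, hp.model.ht_pt h0 h1]
  rcases h0.eq_or_lt with rfl | h0
  · rw [B.iso_zero, B.iso_zero, FanModel.pt_zero, FanModel.pt_zero]
  · rw [hp.model.idx_pt h0 h1]

theorem ht_toFun (x : CombFan (comb M y)) :
    hp.model.ht (B.toFun hp x) = B.iso (hp.model.idx x) (hp.model.ht x) :=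
  hp.model.ht_pt (B.iso_nonneg _ (hp.model.ht_nonneg x)) (B.iso_le _ (hp.model.ht_le x))

theorem coord_toFun (x : CombFan (comb M y)) :
    hp.model.coord (B.toFun hp x) = (B.iso (hp.model.idx x) (hp.model.ht x) *
      bladePos (B.perm (hp.model.idx x)), B.iso (hp.model.idx x) (hp.model.ht x)) :=
  hp.model.coord_pt _ _ (B.iso_nonneg _ (hp.model.ht_nonneg x)) (B.iso_le _ (hp.model.ht_le x))

theorem bijective_toFun : Function.Bijective (B.toFun hp) := by
  constructor
  · intro x x' h
    rw [← hp.model.pt_idx x, ← hp.model.pt_idx x']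
    have hx := hp.model.ht_nonneg x
    have hx' := hp.model.ht_nonneg x'
    have hle := B.iso_le _ (hp.model.ht_le x)
    have hle' := B.iso_le _ (hp.model.ht_le x')
    have hh : B.iso (hp.model.idx x) (hp.model.ht x) = B.iso (hp.model.idx x') (hp.model.ht x') := by
      rw [← ht_toFun, ← ht_toFun, h]
    rcases hx.eq_or_lt with h0 | h0
    · rcases hx'.eq_or_lt with h0' | h0'
      · rw [← h0, ← h0', FanModel.pt_zero, FanModel.pt_zero]
      · rw [← h0, B.iso_zero] at hh
        exact absurd hh (B.iso_pos _ h0').ne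
    · obtain ⟨h1, -⟩ := hp.model.pt_inj (B.iso_pos _ h0) hle (B.iso_nonneg _ hx') hle' h
      have h1 := B.perm.injective h1
      rw [h1] at hh ⊢
      rw [(B.iso _).injective hh]
  · intro x
    obtain ⟨l, s, h0, h1, rfl⟩ := hp.model.exists_pt x
    obtain ⟨l, rfl⟩ := B.perm.surjective l
    refine ⟨hp.model.pt l ((B.iso l).symm s), ?_⟩
    rw [B.toFun_pt hp, OrderIso.apply_symm_apply]
    · rw [OrderIso.le_symm_apply, B.iso_zero]
      exact h0
    · rw [OrderIso.symm_apply_le, B.iso_height]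
      exact h1

theorem continuous_toFun : Continuous (B.toFun hp) := by
  rw [continuous_iff_continuousAt]
  intro x
  rw [hp.model.isEmbedding.isInducing.continuousAt_iff]
  obtain ⟨l, s, h0, h1, rfl⟩ := hp.model.exists_pt x
  have hht : hp.model.ht (hp.model.pt l s) = s := hp.model.ht_pt h0 h1
  rw [ContinuousAt]
  simp only [Function.comp_def, B.toFun_pt hp h0 h1]
  rw [hp.model.coord_pt _ _ (B.iso_nonneg l h0) (B.iso_le l h1)]
  simp only [coord_toFun, IsCombParam.pos_model]
  rcases h0.eq_or_lt with rfl | h0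
  · have hsmall : Tendsto (fun z => B.iso (hp.model.idx z) (hp.model.ht z))
        (𝓝 (hp.model.pt l 0)) (𝓝 0) := by
      rw [tendsto_order]
      constructor
      · intro a ha
        exact Eventually.of_forall fun z => ha.trans_le (B.iso_nonneg _ (hp.model.ht_nonneg z))
      · intro ε hε
        obtain ⟨δ, hδ, h⟩ := B.small ε hε
        have e1 : ∀ᶠ z in 𝓝 (hp.model.pt l 0), hp.model.ht z < δ :=
          hp.model.continuous_ht.continuousAt.eventually (gt_mem_nhds (by rwa [hht]))
        filter_upwards [e1] with z hz
        exact ((B.iso _).strictMono hz).trans (h _)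
    rw [B.iso_zero, zero_mul]
    refine Tendsto.prodMk_nhds ?_ hsmall
    refine squeeze_zero (fun z => mul_nonneg (B.iso_nonneg _ (hp.model.ht_nonneg z))
      (bladePos_mem _).1) (fun z => ?_) hsmall
    exact mul_le_of_le_one_right (B.iso_nonneg _ (hp.model.ht_nonneg z)) (bladePos_mem _).2.le
  · have hs2 : 0 < s / 2 := half_pos h0
    have e0 : ∀ᶠ z in 𝓝 (hp.model.pt l s), s / 2 < hp.model.ht z :=
      hp.model.continuous_ht.continuousAt.eventually (lt_mem_nhds (by rw [hht]; linarith))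
    have e1 : ∀ᶠ z in 𝓝 (hp.model.pt l s),
        B.iso (hp.model.idx z) (hp.model.ht z) = B.iso l (hp.model.ht z) := by
      filter_upwards [e0, hp.eventually_nhds_pt h0 h1 (B.eventually_eq l _ hs2)] with z hz hz'
      rcases hz' with hz' | ⟨j, hj, hz'⟩
      · rw [hz']
      · rw [hz']
        exact hj _ hz.le
    have t1 : Tendsto (fun z => B.iso (hp.model.idx z) (hp.model.ht z))
        (𝓝 (hp.model.pt l s)) (𝓝 (B.iso l s)) := by
      refine Tendsto.congr' (EventuallyEq.symm e1) ?_
      have := ((B.iso l).continuous.comp hp.model.continuous_ht).tendsto (hp.model.pt l s)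
      simpa only [Function.comp_def, hht] using this
    have t2 : Tendsto (fun z => bladePos (B.perm (hp.model.idx z)))
        (𝓝 (hp.model.pt l s)) (𝓝 (bladePos (B.perm l))) := by
      intro V hV
      have := hp.eventually_nhds_pt h0 h1 ((B.tendsto_pos l).eventually hV)
      rw [mem_map]
      filter_upwards [this] with z hz
      rcases hz with hz | ⟨j, hj, hz⟩
      · rw [mem_preimage, hz]
        exact mem_of_mem_nhds hV
      · rw [mem_preimage, hz]
        exact hj
    exact (t1.mul t2).prodMk_nhds t1

/-- The homeomorphism of the fan of a comb that is induced by a blade map. -/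
theorem exists_homeomorph : ∃ H : CombFan (comb M y) ≃ₜ CombFan (comb M y),
    ∀ l s, 0 ≤ s → s ≤ bladeHeight M y l →
      H (hp.model.pt l s) = hp.model.pt (B.perm l) (B.iso l s) := by
  have := hp.compactSpace
  have := hp.model.t2Space
  refine ⟨(isHomeomorph_iff_continuous_bijective.2
    ⟨B.continuous_toFun hp, B.bijective_toFun hp⟩).homeomorph _, fun l s h0 h1 => ?_⟩
  exact B.toFun_pt hp h0 h1

end BladeMap

/-! ### Construction of blade maps and transitivity on the blades -/

namespace IsCombParam

variable {M : ℝ} {y : ℕ+ → ℝ}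

/-- The isomorphism from the fan onto the part of it that grows from the blade `[n]`. -/
theorem exists_branch_iso (hp : IsCombParam M y) (n : ℕ+) : ∃ θ : ℝ ≃o ℝ, θ 0 = 0 ∧
    ∀ r, θ (bladeHeight M y r) = bladeHeight M y (n :: r) := by
  have hM := hp.M_pos
  have hn := hp.pos n
  have hlt : M ^ (n : ℕ) < 1 := pow_lt_one₀ hM.le hp.lt_one n.pos.ne'
  obtain ⟨f, hf⟩ := exists_affine zero_lt_one hn
  -- Every blade but the root lies within `[0, M]`, where the factor `M ^ n * y n` is right; the
  -- interval `[M, 1]` is free to absorb the exceptional value `y n` at `1`.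
  obtain ⟨k, hk, hk'⟩ := exists_linear_glue f (α := M) (β := M ^ (n : ℕ) * y n * M) (η := 1) hM
    (by positivity) hp.lt_one (by
      rw [hf]
      simp only [sub_zero, zero_add, div_one, mul_one]
      rw [mul_assoc]
      nlinarith [hp.lt_one, mul_pos hn hM])
  refine ⟨k, by rw [hk 0 hM.le, mul_zero], fun r => ?_⟩
  by_cases hr : r = []
  · rw [hr, bladeHeight_nil, bladeHeight_singleton, hk' 1 le_rfl, hf]
    simp
  · rw [hk _ (hp.height_le hr), bladeHeight_cons M y n hr, mul_div_cancel_right₀ _ hM.ne']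

/-- A family of isomorphisms from the branches at the blades `[a i]` to the branches at the blades
`[b i]` that converge to a given isomorphism. -/
theorem exists_family (hp : IsCombParam M y) {ι : Type*} {a b : ι → ℕ+}
    (ha : Function.Injective a) (hb : Function.Injective b) (f : ℝ ≃o ℝ) (hf0 : f 0 = 0)
    (hf : ∀ i, f (y (a i)) = y (b i)) : ∃ g : ι → ℝ ≃o ℝ, (∀ i, g i 0 = 0) ∧
      (∀ i r, g i (bladeHeight M y (a i :: r)) = bladeHeight M y (b i :: r)) ∧
      (∀ δ > 0, ∀ᶠ i in cofinite, ∀ s ≥ δ, g i s = f s) ∧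
      ∀ ε > 0, ∃ δ > 0, ∀ i, g i δ < ε := by
  have hM := hp.M_pos
  -- Below `η i` there is room for the linear scaling of the deeper blades. Above it `g i` can equal
  -- `f`, and `η i ≤ y (a i)` tends to `0`.
  let η : ι → ℝ := fun i => max (M ^ (a i : ℕ) * y (a i)) (f.symm (M ^ (b i : ℕ) * y (b i)))
  have hpow : ∀ n : ℕ+, 0 < M ^ (n : ℕ) * y n := fun n => mul_pos (pow_pos hM _) (hp.pos n)
  have hle : ∀ n : ℕ+, M ^ (n : ℕ) * y n ≤ y n := fun n =>
    mul_le_of_le_one_left (hp.pos n).le (pow_le_one₀ hM.le hp.lt_one.le)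
  have key : ∀ i, ∃ k : ℝ ≃o ℝ, (∀ s ≤ M ^ (a i : ℕ) * y (a i) * M,
      k s = (M ^ (b i : ℕ) * y (b i) * M) / (M ^ (a i : ℕ) * y (a i) * M) * s) ∧
      ∀ s, η i ≤ s → k s = f s := by
    intro i
    refine exists_linear_glue f (mul_pos (hpow _) hM) (mul_pos (hpow _) hM) ?_ ?_
    · exact (mul_lt_of_lt_one_right (hpow _) hp.lt_one).trans_le (le_max_left _ _)
    · refine (mul_lt_of_lt_one_right (hpow _) hp.lt_one).trans_le ?_
      rw [← OrderIso.symm_apply_le]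
      exact le_max_right _ _
  choose g hg hg' using key
  have hg0 : ∀ i, g i 0 = 0 := fun i => by rw [hg i 0 (mul_pos (hpow _) hM).le, mul_zero]
  have hηy : ∀ i, η i ≤ y (a i) := fun i =>
    max_le (hle _) (by rw [OrderIso.symm_apply_le, hf]; exact hle _)
  have hzero : ∀ {c : ι → ℕ+}, Function.Injective c →
      Tendsto (fun i => M ^ (c i : ℕ) * y (c i)) cofinite (𝓝 0) := by
    intro c hc
    refine squeeze_zero (fun i => (hpow _).le) (fun i => ?_)
      ((tendsto_pow_pnat hM.le hp.lt_one).comp hc.tendsto_cofinite)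
    exact mul_le_of_le_one_right (pow_nonneg hM.le _) (hp.y_lt_one _).le
  have hη : Tendsto η cofinite (𝓝 0) := by
    have h2 := (f.symm.continuous.tendsto 0).comp (hzero hb)
    rw [show f.symm 0 = 0 by rw [f.symm_apply_eq, hf0]] at h2
    simpa using (hzero ha).max h2
  have hev : ∀ δ > 0, ∀ᶠ i in cofinite, ∀ s ≥ δ, g i s = f s := by
    intro δ hδ
    filter_upwards [hη.eventually (gt_mem_nhds hδ)] with i hi s hs
    exact hg' i s (hi.le.trans hs)
  refine ⟨g, hg0, fun i r => ?_, hev, fun ε hε => ?_⟩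
  · by_cases hr : r = []
    · rw [hr, bladeHeight_singleton, bladeHeight_singleton, hg' i _ (hηy i), hf]
    · rw [bladeHeight_cons M y _ hr, bladeHeight_cons M y _ hr, hg i _
        (mul_le_mul_of_nonneg_left (hp.height_le hr) (hpow _).le)]
      rw [mul_div_mul_right _ _ hM.ne', ← mul_assoc, div_mul_cancel₀ _ (hpow (a i)).ne']
  · have small : ∀ k : ℝ ≃o ℝ, k 0 = 0 → ∀ᶠ δ in 𝓝[>] (0 : ℝ), k δ < ε := by
      intro k hk
      have h : ∀ᶠ δ in 𝓝 (0 : ℝ), k δ < ε :=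
        k.continuous.continuousAt.eventually (gt_mem_nhds (by rwa [hk]))
      exact mem_nhdsWithin_of_mem_nhds h
    -- All but finitely many `g i` agree with `f` from `δ₀` on and are controlled by monotonicity;
    -- the rest are treated one by one.
    obtain ⟨δ₀, hδ₀, hfδ₀⟩ := (eventually_mem_nhdsWithin.and (small f hf0)).exists
    have hfin : {i | ¬ ∀ s ≥ δ₀, g i s = f s}.Finite := hev δ₀ hδ₀
    have h2 : ∀ᶠ δ in 𝓝[>] (0 : ℝ), ∀ i ∈ {i | ¬ ∀ s ≥ δ₀, g i s = f s}, g i δ < ε :=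
      (eventually_all_finite hfin).2 fun i _ => small _ (hg0 i)
    obtain ⟨δ, ⟨hδ, h3⟩, h4⟩ := ((eventually_mem_nhdsWithin.and h2).and
      (mem_nhdsWithin_of_mem_nhds (gt_mem_nhds hδ₀))).exists
    have h4 : δ < δ₀ := h4
    refine ⟨δ, hδ, fun i => ?_⟩
    by_cases hi : ∀ s ≥ δ₀, g i s = f s
    · exact ((g i).monotone h4.le).trans_lt (by rwa [hi δ₀ le_rfl])
    · exact h3 i hi

end IsCombParam

/-- Two functions with countable domains, the same range and infinite fibres differ by a
bijection of the domains. -/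
theorem exists_equiv_of_infinite_fibers {α β γ : Type*} [Countable α] [Countable β] (u : α → γ)
    (v : β → γ) (huv : range u = range v) (hu : ∀ a, {a' | u a' = u a}.Infinite)
    (hv : ∀ b, {b' | v b' = v b}.Infinite) : ∃ e : α ≃ β, ∀ a, v (e a) = u a := by
  have key : ∀ c : γ, Nonempty ({a // u a = c} ≃ {b // v b = c}) := by
    intro c
    by_cases hc : c ∈ range u
    · obtain ⟨a, rfl⟩ := hc
      obtain ⟨b, hb⟩ : u a ∈ range v := huv ▸ mem_range_self a
      have : Infinite {a' // u a' = u a} := (hu a).to_subtype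
      have : Infinite {b' // v b' = u a} := by
        rw [← hb]
        exact (hv b).to_subtype
      exact nonempty_equiv_of_countable
    · have : IsEmpty {a // u a = c} := ⟨fun a => hc ⟨a.1, a.2⟩⟩
      have : IsEmpty {b // v b = c} := ⟨fun b => hc (huv ▸ ⟨b.1, b.2⟩)⟩
      exact ⟨Equiv.equivOfIsEmpty _ _⟩
  have E := fun c => (key c).some
  refine ⟨(Equiv.sigmaFiberEquiv u).symm.trans ((Equiv.sigmaCongrRight E).trans
    (Equiv.sigmaFiberEquiv v)), fun a => ?_⟩
  exact (E (u a) ⟨a, rfl⟩).2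

theorem eventually_cofinite_of_subtype {α : Type*} {p : α → Prop} {P : {a // p a} → Prop}
    (h : ∀ᶠ i in cofinite, P i) : ∀ᶠ a in cofinite, ∀ ha : p a, P ⟨a, ha⟩ := by
  have h : {i | ¬ P i}.Finite := h
  refine (h.image Subtype.val).subset fun a ha => ?_
  rw [mem_compl_iff, mem_ofPred_eq, not_forall] at ha
  obtain ⟨ha, h⟩ := ha
  exact ⟨⟨a, ha⟩, h, rfl⟩

namespace IsCombParam

variable {M : ℝ} {y : ℕ+ → ℝ}

/-- An order isomorphism of the root blade that preserves the set of values of `y` extends to a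
homeomorphism of the fan. -/
theorem exists_bladeMap_root (hp : IsCombParam M y) (hfib : ∀ n, {k | y k = y n}.Infinite)
    (f : ℝ ≃o ℝ) (hf0 : f 0 = 0) (hf1 : f 1 = 1) (hf : f '' range y = range y) :
    ∃ B : BladeMap M y, B.perm [] = [] ∧ B.iso [] = f := by
  obtain ⟨e, he⟩ := exists_equiv_of_infinite_fibers (fun n => f (y n)) y
    (by rw [← hf, ← range_comp]; rfl) (by simpa using hfib) hfib
  obtain ⟨g, hg0, hg, hev, hsmall⟩ :=
    hp.exists_family (a := id) (b := e) Function.injective_id e.injective f hf0 fun i => (he i).symm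
  -- The child `n` goes to a child `e n` with `y (e n) = f (y n)`; later entries are unchanged.
  let perm : List ℕ+ ≃ List ℕ+ :=
    { toFun := fun l => l.casesOn [] fun n r => e n :: r
      invFun := fun l => l.casesOn [] fun n r => e.symm n :: r
      left_inv := by rintro (_ | ⟨n, r⟩) <;> simp
      right_inv := by rintro (_ | ⟨n, r⟩) <;> simp }
  let iso : List ℕ+ → ℝ ≃o ℝ := fun l => l.casesOn f fun n _ => g n
  refine ⟨⟨perm, iso, ?_, ?_, ?_, ?_, ?_⟩, rfl, rfl⟩
  · rintro (_ | ⟨n, r⟩)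
    exacts [hf0, hg0 n]
  · rintro (_ | ⟨n, r⟩)
    · change f (bladeHeight M y []) = bladeHeight M y []
      rw [bladeHeight_nil, hf1]
    · exact hg n r
  · rintro (_ | ⟨n, r⟩)
    · exact tendsto_bladePos_singleton.comp e.injective.tendsto_cofinite
    · exact tendsto_bladePos_append (e n :: r)
  · rintro (_ | ⟨n, r⟩) δ hδ
    · exact hev δ hδ
    · exact Eventually.of_forall fun j s _ => rfl
  · intro ε hε
    obtain ⟨δ, hδ, h⟩ := hsmall ε hε
    have e1 : ∀ᶠ s in 𝓝 (0 : ℝ), f s < ε :=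
      f.continuous.continuousAt.eventually (gt_mem_nhds (by rwa [hf0]))
    obtain ⟨δ', hδ', h', hlt⟩ := ((eventually_mem_nhdsWithin (s := Ioi (0 : ℝ))).and
      (mem_nhdsWithin_of_mem_nhds (inter_mem e1 (gt_mem_nhds hδ)))).exists
    have hlt : δ' < δ := hlt
    refine ⟨δ', hδ', ?_⟩
    rintro (_ | ⟨n, r⟩)
    · exact h'
    · exact ((g n).strictMono hlt).trans (h n)

/-- There is a homeomorphism of the fan that maps the root blade to the blade `[n]`. -/
theorem exists_bladeMap_swap (hp : IsCombParam M y) (hfib : ∀ n, {k | y k = y n}.Infinite)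
    (n : ℕ+) : ∃ B : BladeMap M y, B.perm [] = [n] := by
  classical
  -- Without `n`, the children of the root still take every value infinitely often, so they match
  -- the full set of children of `[n]`.
  obtain ⟨e, he⟩ := exists_equiv_of_infinite_fibers (fun k : {k : ℕ+ // k ≠ n} => y k) y
    (by
      refine Subset.antisymm (range_subset_iff.2 fun k => mem_range_self _)
        (range_subset_iff.2 fun k => ?_)
      obtain ⟨j, hj, hjn⟩ := (hfib k).exists_notMem_finset {n}
      exact ⟨⟨j, by simpa using hjn⟩, hj⟩)
    (by
      intro k
      have := (hfib k).sdiff (finite_singleton n)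
      refine Infinite.of_image Subtype.val (this.mono ?_)
      rintro j ⟨hj, hjn⟩
      exact ⟨⟨j, hjn⟩, hj, rfl⟩) hfib
  obtain ⟨θ, hθ0, hθ⟩ := hp.exists_branch_iso n
  have hθs0 : θ.symm 0 = 0 := by rw [θ.symm_apply_eq, hθ0]
  have hθs : ∀ r, θ.symm (bladeHeight M y (n :: r)) = bladeHeight M y r := fun r => by
    rw [θ.symm_apply_eq, hθ]
  obtain ⟨g, hg0, hg, hev, hsmall⟩ := hp.exists_family (a := Subtype.val) (b := e)
    Subtype.val_injective e.injective (OrderIso.refl ℝ) rfl fun i => (he i).symm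
  obtain ⟨g', hg0', hg', hev', hsmall'⟩ := hp.exists_family (a := id) (b := fun i => (e.symm i : ℕ+))
    Function.injective_id (Subtype.val_injective.comp e.symm.injective) (OrderIso.refl ℝ) rfl
    fun i => by simpa using he (e.symm i)
  -- The root and `[n]` change places, and so do the branch `j ≠ n` at the root and the branch `e j`
  -- at `[n]`.
  let F : List ℕ+ → List ℕ+ := fun l => l.casesOn [n] fun j r =>
    if h : j = n then r.casesOn [] fun i q => (e.symm i : ℕ+) :: q else n :: e ⟨j, h⟩ :: r
  have F1 : F [n] = [] := by simp [F]
  have F2 : ∀ i q, F (n :: i :: q) = (e.symm i : ℕ+) :: q := fun i q => by simp [F]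
  have F3 : ∀ j (h : j ≠ n) r, F (j :: r) = n :: e ⟨j, h⟩ :: r := fun j h r => by simp [F, h]
  have hF : Function.Involutive F := by
    rintro (_ | ⟨j, r⟩)
    · exact F1
    by_cases h : j = n
    · subst h
      rcases r with _ | ⟨i, q⟩
      · rw [F1]
      · rw [F2, F3 _ (e.symm i).2]
        simp
    · rw [F3 j h, F2]
      simp
  -- `θ` passes from the heights of the whole fan to those of the branch at `[n]`; `g` and `g'`
  -- correct for the renumbering of children by `e` and its inverse.
  let iso : List ℕ+ → ℝ ≃o ℝ := fun l => l.casesOn θ fun j r =>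
    if h : j = n then r.casesOn θ.symm fun i _ => θ.symm.trans (g' i) else (g ⟨j, h⟩).trans θ
  have I1 : iso [n] = θ.symm := by simp [iso]
  have I2 : ∀ i q, iso (n :: i :: q) = θ.symm.trans (g' i) := fun i q => by simp [iso]
  have I3 : ∀ j (h : j ≠ n) r, iso (j :: r) = (g ⟨j, h⟩).trans θ := fun j h r => by simp [iso, h]
  have hne : ∀ᶠ j in cofinite, j ≠ n := (finite_singleton n).eventually_cofinite_notMem
  refine ⟨⟨hF.toPerm, iso, ?_, ?_, ?_, ?_, ?_⟩, rfl⟩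
  · rintro (_ | ⟨j, r⟩)
    · exact hθ0
    by_cases h : j = n
    · subst h
      rcases r with _ | ⟨i, q⟩
      · rw [I1, hθs0]
      · rw [I2 i q, OrderIso.trans_apply, hθs0, hg0']
    · rw [I3 j h, OrderIso.trans_apply, hg0, hθ0]
  · rintro (_ | ⟨j, r⟩)
    · exact hθ []
    rw [Function.Involutive.coe_toPerm]
    by_cases h : j = n
    · subst h
      rcases r with _ | ⟨i, q⟩
      · rw [I1, F1, hθs]
      · rw [I2 i q, F2, OrderIso.trans_apply, hθs]
        exact hg' i q
    · rw [I3 j h, F3 j h, OrderIso.trans_apply, ← hθ]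
      exact congrArg θ (hg ⟨j, h⟩ r)
  · simp only [Function.Involutive.coe_toPerm]
    rintro (_ | ⟨j, r⟩)
    · intro V hV
      have h1 := (tendsto_bladePos_append [n]).eventually hV
      rw [mem_map]
      filter_upwards [hne, eventually_cofinite_of_subtype
        (e.injective.tendsto_cofinite.eventually h1)] with j hj h2
      rw [mem_preimage, List.nil_append, F3 j hj []]
      exact h2 hj
    by_cases h : j = n
    · subst h
      rcases r with _ | ⟨i, q⟩
      · simp only [List.cons_append, List.nil_append, F1, F2]
        exact tendsto_bladePos_singleton.comp
          (Subtype.val_injective.comp e.symm.injective).tendsto_cofinite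
      · simp only [List.cons_append, F2]
        exact tendsto_bladePos_append ((e.symm i : ℕ+) :: q)
    · simp only [List.cons_append, F3 j h]
      exact tendsto_bladePos_append (n :: e ⟨j, h⟩ :: r)
  · rintro (_ | ⟨j, r⟩) δ hδ
    · filter_upwards [hne, eventually_cofinite_of_subtype (hev δ hδ)] with j hj h s hs
      rw [List.nil_append, I3 j hj []]
      exact congrArg θ (h hj s hs)
    by_cases h : j = n
    · subst h
      rcases r with _ | ⟨i, q⟩
      · have hpos : 0 < θ.symm δ := by rwa [θ.lt_symm_apply, hθ0]
        filter_upwards [hev' _ hpos] with i hi s hs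
        rw [List.cons_append, List.nil_append, I2 i [], I1]
        exact hi _ (θ.symm.monotone hs)
      · exact Eventually.of_forall fun j s _ => by
          rw [List.cons_append, List.cons_append, I2 i (q ++ [j])]
    · exact Eventually.of_forall fun i s _ => by rw [List.cons_append, I3 j h, I3 j h]
  · intro ε hε
    have hε1 : 0 < θ.symm ε := by rwa [θ.lt_symm_apply, hθ0]
    have hε2 : 0 < θ ε := by rw [← hθ0]; exact θ.strictMono hε
    obtain ⟨δ₁, hδ₁, h₁⟩ := hsmall _ hε1
    obtain ⟨δ₂, hδ₂, h₂⟩ := hsmall' ε hε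
    have hδ₂' : 0 < θ δ₂ := by rw [← hθ0]; exact θ.strictMono hδ₂
    obtain ⟨δ, hδ, hlt⟩ := exists_between
      (lt_min (lt_min hε1 hε2) (lt_min hδ₁ hδ₂') : (0 : ℝ) < _)
    rw [lt_min_iff, lt_min_iff, lt_min_iff] at hlt
    obtain ⟨⟨d1, d2⟩, d3, d4⟩ := hlt
    refine ⟨δ, hδ, ?_⟩
    rintro (_ | ⟨j, r⟩)
    · exact θ.lt_symm_apply.1 d1
    by_cases h : j = n
    · subst h
      rcases r with _ | ⟨i, q⟩
      · rw [I1]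
        exact θ.symm_apply_lt.2 d2
      · rw [I2 i q, OrderIso.trans_apply]
        exact ((g' i).strictMono (θ.symm_apply_lt.2 d4)).trans (h₂ i)
    · rw [I3 j h, OrderIso.trans_apply, ← θ.lt_symm_apply]
      exact ((g _).strictMono d3).trans (h₁ _)

/-- A blade map of the whole fan can be transported to the branch that grows from a blade `[n]`. -/
theorem exists_bladeMap_lift (hp : IsCombParam M y) (n : ℕ+) (B : BladeMap M y) :
    ∃ B' : BladeMap M y, ∀ l, B'.perm (n :: l) = n :: B.perm l := by
  classical
  obtain ⟨θ, hθ0, hθ⟩ := hp.exists_branch_iso n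
  have hθs0 : θ.symm 0 = 0 := by rw [θ.symm_apply_eq, hθ0]
  have hθs : ∀ r, θ.symm (bladeHeight M y (n :: r)) = bladeHeight M y r := fun r => by
    rw [θ.symm_apply_eq, hθ]
  -- The map acts inside the branch at `[n]` only. The root sees one changed child, which the
  -- cofinite conditions ignore.
  let F : (List ℕ+ ≃ List ℕ+) → List ℕ+ → List ℕ+ := fun p l => l.casesOn [] fun j r =>
    if j = n then n :: p r else j :: r
  have F0 : ∀ p, F p [] = [] := fun p => rfl
  have F1 : ∀ p r, F p (n :: r) = n :: p r := fun p r => by simp [F]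
  have F2 : ∀ p j r, j ≠ n → F p (j :: r) = j :: r := fun p j r h => by simp [F, h]
  have FF : ∀ p l, F p.symm (F p l) = l := by
    rintro p (_ | ⟨j, r⟩)
    · rfl
    by_cases h : j = n
    · rw [h, F1, F1, Equiv.symm_apply_apply]
    · rw [F2 _ _ _ h, F2 _ _ _ h]
  let perm : List ℕ+ ≃ List ℕ+ := ⟨F B.perm, F B.perm.symm, FF _, fun l => FF B.perm.symm l⟩
  have hperm : ∀ l, perm l = F B.perm l := fun l => rfl
  let iso : List ℕ+ → ℝ ≃o ℝ := fun l => l.casesOn (OrderIso.refl ℝ) fun j r =>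
    if j = n then (θ.symm.trans (B.iso r)).trans θ else OrderIso.refl ℝ
  have I0 : iso [] = OrderIso.refl ℝ := rfl
  have I1 : ∀ r, iso (n :: r) = (θ.symm.trans (B.iso r)).trans θ := fun r => by simp [iso]
  have I2 : ∀ j r, j ≠ n → iso (j :: r) = OrderIso.refl ℝ := fun j r h => by simp [iso, h]
  have hne : ∀ᶠ j in cofinite, j ≠ n := (finite_singleton n).eventually_cofinite_notMem
  refine ⟨⟨perm, iso, ?_, ?_, ?_, ?_, ?_⟩, fun l => F1 _ l⟩
  · rintro (_ | ⟨j, r⟩)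
    · rfl
    by_cases h : j = n
    · rw [h, I1]
      simp [hθs0, B.iso_zero, hθ0]
    · rw [I2 j r h]
      rfl
  · rintro (_ | ⟨j, r⟩)
    · rfl
    rw [hperm]
    by_cases h : j = n
    · rw [h, I1, F1]
      simp [hθs, B.iso_height, hθ]
    · rw [I2 j r h, F2 _ _ _ h]
      rfl
  · simp only [hperm]
    rintro (_ | ⟨j, r⟩)
    · refine tendsto_bladePos_singleton.congr' ?_
      filter_upwards [hne] with j hj
      rw [List.nil_append, F2 _ _ _ hj]
    by_cases h : j = n
    · simp only [h, List.cons_append, F1, bladePos_cons]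
      exact ((B.tendsto_pos r).const_add 2).const_mul _
    · simp only [List.cons_append, F2 _ _ _ h]
      exact tendsto_bladePos_append (j :: r)
  · rintro (_ | ⟨j, r⟩) δ hδ
    · filter_upwards [hne] with j hj s _
      rw [List.nil_append, I2 _ _ hj, I0]
    by_cases h : j = n
    · have hpos : 0 < θ.symm δ := by rwa [θ.lt_symm_apply, hθ0]
      filter_upwards [B.eventually_eq r _ hpos] with i hi s hs
      rw [h, List.cons_append, I1, I1]
      exact congrArg θ (hi _ (θ.symm.monotone hs))
    · exact Eventually.of_forall fun i s _ => by rw [List.cons_append, I2 _ _ h, I2 _ _ h]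
  · intro ε hε
    have hpos : 0 < θ.symm ε := by rwa [θ.lt_symm_apply, hθ0]
    obtain ⟨δ, hδ, h⟩ := B.small _ hpos
    have hpos' : 0 < θ δ := by rw [← hθ0]; exact θ.strictMono hδ
    refine ⟨min (θ δ) (ε / 2), lt_min hpos' (half_pos hε), ?_⟩
    rintro (_ | ⟨j, r⟩)
    · exact (min_le_right _ _).trans_lt (half_lt_self hε)
    by_cases hj : j = n
    · rw [hj, I1, OrderIso.trans_apply, OrderIso.trans_apply, ← θ.lt_symm_apply]
      refine lt_of_le_of_lt ((B.iso r).monotone ?_) (h r)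
      rw [θ.symm_apply_le]
      exact min_le_left _ _
    · rw [I2 _ _ hj]
      exact (min_le_right _ _).trans_lt (half_lt_self hε)

/-- The swap at the root is carried to the parent `l` by lifting it through the branches along `l`.
-/
theorem exists_bladeMap_append (hp : IsCombParam M y) (hfib : ∀ n, {k | y k = y n}.Infinite)
    (l : List ℕ+) (n : ℕ+) : ∃ B : BladeMap M y, B.perm l = l ++ [n] := by
  induction l with
  | nil => exact hp.exists_bladeMap_swap hfib n
  | cons m r ih =>
    obtain ⟨B, hB⟩ := ih
    obtain ⟨B', hB'⟩ := hp.exists_bladeMap_lift m B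
    exact ⟨B', by rw [hB', hB, List.cons_append]⟩

/-- The homeomorphism group acts transitively on the blades. -/
theorem exists_homeomorph_root (hp : IsCombParam M y) (hfib : ∀ n, {k | y k = y n}.Infinite)
    (l : List ℕ+) : ∃ (H : CombFan (comb M y) ≃ₜ CombFan (comb M y)) (f : ℝ ≃o ℝ), f 0 = 0 ∧
      f 1 = bladeHeight M y l ∧
        ∀ s, 0 ≤ s → s ≤ 1 → H (hp.model.pt [] s) = hp.model.pt l (f s) := by
  induction l using List.reverseRecOn with
  | nil => exact ⟨Homeomorph.refl _, OrderIso.refl ℝ, rfl, (bladeHeight_nil M y).symm,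
      fun s _ _ => rfl⟩
  | append_singleton l n ih =>
    obtain ⟨H, f, hf0, hf1, hH⟩ := ih
    obtain ⟨B, hB⟩ := hp.exists_bladeMap_append hfib l n
    obtain ⟨H', hH'⟩ := B.exists_homeomorph hp
    refine ⟨H.trans H', f.trans (B.iso l), ?_, ?_, fun s h0 h1 => ?_⟩
    · rw [OrderIso.trans_apply, hf0, B.iso_zero]
    · rw [OrderIso.trans_apply, hf1, B.iso_height, hB]
    · rw [Homeomorph.trans_apply, hH s h0 h1, hH', hB, OrderIso.trans_apply]
      · rw [← hf0]
        exact f.monotone h0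
      · rw [← hf1]
        exact f.monotone h1

end IsCombParam

/-! ### Classes of points of the unit interval relative to a set -/

/-- The type of a point `s` of `[0,1]` relative to `S ⊆ [0,1]`. -/
noncomputable def pointType (S : Set ℝ) (s : ℝ) : ℕ∞ × Prop × Prop × Prop :=
  ((S ∩ Icc s 1).encard, s ∈ S, s = 0, s = 1)

theorem pointType_eq {S : Set ℝ} {s t : ℝ} : pointType S s = pointType S t ↔
    (S ∩ Icc s 1).encard = (S ∩ Icc t 1).encard ∧ (s ∈ S ↔ t ∈ S) ∧ (s = 0 ↔ t = 0) ∧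
      (s = 1 ↔ t = 1) := by
  simp [pointType]

/-- The type of a point is invariant under homeomorphisms of `[0,1]` that fix `0` and preserve
`S`. -/
theorem pointType_map {S : Set ℝ} (hS : S ⊆ Icc 0 1) {ψ : ℝ → ℝ}
    (hmono : StrictMonoOn ψ (Icc 0 1)) (h0 : ψ 0 = 0) (h1 : ψ 1 = 1) (hψ : ψ '' S = S) {s : ℝ}
    (hs : s ∈ Icc (0 : ℝ) 1) : pointType S (ψ s) = pointType S s := by
  have z : (0 : ℝ) ∈ Icc (0 : ℝ) 1 := by simp
  have o : (1 : ℝ) ∈ Icc (0 : ℝ) 1 := by simp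
  rw [pointType_eq]
  refine ⟨?_, ?_, ?_, ?_⟩
  · rw [← (hmono.injOn.mono (inter_subset_left.trans hS : S ∩ Icc s 1 ⊆ _)).encard_image]
    congr 1
    ext t
    constructor
    · rintro ⟨ht, ht'⟩
      rw [← hψ] at ht
      obtain ⟨r, hr, rfl⟩ := ht
      exact ⟨r, ⟨hr, (hmono.le_iff_le hs (hS hr)).1 ht'.1, (hS hr).2⟩, rfl⟩
    · rintro ⟨r, ⟨hr, hr'⟩, rfl⟩
      refine ⟨hψ ▸ mem_image_of_mem ψ hr, (hmono.le_iff_le hs (hS hr)).2 hr'.1, ?_⟩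
      rw [← h1]
      exact (hmono.le_iff_le (hS hr) o).2 hr'.2
  · constructor
    · intro h
      rw [← hψ] at h
      obtain ⟨r, hr, hrs⟩ := h
      rwa [← hmono.injOn (hS hr) hs hrs]
    · exact fun h => hψ ▸ mem_image_of_mem ψ h
  · rw [← h0]
    exact ⟨fun h => by rw [hmono.injOn hs z h, h0], fun h => by rw [h, h0, h0]⟩
  · rw [← h1]
    exact ⟨fun h => by rw [hmono.injOn hs o h, h1], fun h => by rw [h, h1, h1]⟩

/-- Any two points of an open interval are exchanged by an order isomorphism of the line that is
the identity outside of this interval. -/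
theorem exists_bump {u v s t : ℝ} (hs : s ∈ Ioo u v) (ht : t ∈ Ioo u v) :
    ∃ f : ℝ ≃o ℝ, (∀ r ∉ Ioo u v, f r = r) ∧ f s = t := by
  obtain ⟨g, hg⟩ := exists_affine hs.1 ht.1
  obtain ⟨h, hh⟩ := exists_affine hs.2 ht.2
  obtain ⟨k, hk, hk'⟩ := exists_glue g h (a := s) (by rw [hg, hh, affine_right hs.1, affine_left])
  obtain ⟨p, hp, hp'⟩ := exists_glue (OrderIso.refl ℝ) k (a := u) (by
    rw [hk u hs.1.le, hg, affine_left]; rfl)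
  obtain ⟨q, hq, hq'⟩ := exists_glue p (OrderIso.refl ℝ) (a := v) (by
    rw [hp' v (hs.1.trans hs.2).le, hk' v hs.2.le, hh, affine_right hs.2]; rfl)
  refine ⟨q, fun r hr => ?_, ?_⟩
  · rcases le_or_gt r u with h | h
    · rw [hq r (h.trans (hs.1.trans hs.2).le), hp r h]
      rfl
    · rw [hq' r (not_lt.1 fun h' => hr ⟨h, h'⟩)]
      rfl
  · rw [hq s hs.2.le, hp' s hs.1.le, hk s le_rfl, hg, affine_right hs.1]

/-- Two points of the same type with finitely many points of `S` above them are exchanged by an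
order isomorphism that fixes `S` pointwise. -/
theorem exists_fix_of_pointType_eq {S : Set ℝ} (hS : IsClosed S) {s t : ℝ}
    (hs : s ∈ Icc (0 : ℝ) 1) (ht : t ∈ Icc (0 : ℝ) 1) (hst : pointType S s = pointType S t)
    (hfin : (S ∩ Icc s 1).Finite) :
    ∃ f : ℝ ≃o ℝ, (∀ r ∈ S, f r = r) ∧ f 1 = 1 ∧ f s = t := by
  wlog hle : s ≤ t generalizing s t
  · have hfin' : (S ∩ Icc t 1).Finite := by
      rw [← encard_lt_top_iff, ← (pointType_eq.1 hst).1, encard_lt_top_iff]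
      exact hfin
    obtain ⟨f, hf, hf1, hfs⟩ := this ht hs hst.symm hfin' (not_le.1 hle).le
    refine ⟨f.symm, fun r hr => ?_, ?_, ?_⟩
    · rw [f.symm_apply_eq, hf r hr]
    · rw [f.symm_apply_eq, hf1]
    · rw [f.symm_apply_eq, hfs]
  rcases hle.eq_or_lt with rfl | hlt
  · exact ⟨OrderIso.refl ℝ, fun _ _ => rfl, rfl, rfl⟩
  obtain ⟨h1, h2, -, h4⟩ := pointType_eq.1 hst
  have hsub : S ∩ Icc t 1 ⊆ S ∩ Icc s 1 :=
    inter_subset_inter_right _ (Icc_subset_Icc_left hle)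
  -- Nested finite sets of equal cardinality coincide, so `S` misses `[s, t)`; by equality of types
  -- `t` is not in `S` either.
  have heq := hfin.eq_of_subset_of_encard_le' hsub h1.le
  have hsS : s ∉ S := fun h => by
    have : s ∈ S ∩ Icc t 1 := heq ▸ ⟨h, le_rfl, hs.2⟩
    exact hlt.not_ge this.2.1
  have htS : t ∉ S := fun h => hsS (h2.2 h)
  have ht1 : t < 1 := ht.2.lt_of_ne fun h => hlt.ne ((h4.2 h).trans h.symm)
  obtain ⟨u, hu, hu'⟩ := exists_Ioc_subset_of_mem_nhds (hS.isOpen_compl.mem_nhds hsS)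
    ⟨s - 1, by linarith⟩
  obtain ⟨v, hv, hv'⟩ := exists_Ico_subset_of_mem_nhds
    (inter_mem (hS.isOpen_compl.mem_nhds htS) (gt_mem_nhds ht1)) ⟨t + 1, by linarith⟩
  obtain ⟨f, hf, hfs⟩ := exists_bump (s := s) (t := t) (u := u) (v := v) ⟨hu, hlt.trans hv⟩
    ⟨hu.trans hlt, hv⟩
  refine ⟨f, fun r hr => hf r ?_, hf 1 ?_, hfs⟩
  · rintro ⟨h, h'⟩
    rcases le_or_gt r s with h3 | h3
    · exact hu' ⟨h, h3⟩ hr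
    rcases lt_or_ge r t with h5 | h5
    · have : r ∈ S ∩ Icc t 1 := heq ▸ ⟨hr, h3.le, (h5.trans ht1).le⟩
      exact h5.not_ge this.2.1
    · exact (hv' ⟨h5, h'⟩).1 hr
  · rintro ⟨-, h'⟩
    exact lt_irrefl _ (show (1 : ℝ) < 1 from (hv' ⟨ht1.le, h'⟩).2)

theorem image_eq_of_forall_eq {D : Set ℝ} {f : ℝ ≃o ℝ} (h : ∀ r ∈ D, f r = r) : f '' D = D := by
  rw [image_congr h, image_id']

/-! ### Shifting a bi-infinite sequence -/

section Shift

variable {p : ℤ → ℝ} {b : ℝ}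

theorem mem_Ioo_of_tendsto (hp : StrictMono p) (h0 : Tendsto p atBot (𝓝 0))
    (h1 : Tendsto p atTop (𝓝 b)) (i : ℤ) : p i ∈ Ioo 0 b :=
  ⟨(hp.monotone.le_of_tendsto h0 (i - 1)).trans_lt (hp (by omega)),
    (hp (by omega : i < i + 1)).trans_le (hp.monotone.ge_of_tendsto h1 (i + 1))⟩

theorem exists_int_between (h0 : Tendsto p atBot (𝓝 0)) (hp : StrictMono p)
    (h1 : Tendsto p atTop (𝓝 b)) {s : ℝ} (hs : s ∈ Ioo 0 b) :
    ∃ i, p i ≤ s ∧ s < p (i + 1) := by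
  obtain ⟨j, hj⟩ := (h1.eventually (lt_mem_nhds hs.2)).exists
  obtain ⟨k, hk⟩ := (h0.eventually (gt_mem_nhds hs.1)).exists
  obtain ⟨i, hi, hmax⟩ := Int.exists_greatest_of_bdd (P := fun i => p i ≤ s)
    ⟨j, fun z hz => (hp.lt_iff_lt.1 (lt_of_le_of_lt hz hj)).le⟩ ⟨k, hk.le⟩
  refine ⟨i, hi, not_le.1 fun h => ?_⟩
  have := hmax _ h
  omega

theorem exists_shift (hp : StrictMono p) (h0 : Tendsto p atBot (𝓝 0))
    (h1 : Tendsto p atTop (𝓝 b)) (k : ℤ) : ∃ σ : ℝ ≃o ℝ, (∀ i, σ (p i) = p (i + k)) ∧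
      ∀ s ∉ Ioo 0 b, σ s = s := by
  -- Linear interpolation of `p`, an increasing bijection of the line onto `(0, b)`. The shift is
  -- translation by `k` conjugated by `ρ`.
  let ρ : ℝ → ℝ := fun x => p ⌊x⌋ + Int.fract x * (p (⌊x⌋ + 1) - p ⌊x⌋)
  have hgap : ∀ i, 0 < p (i + 1) - p i := fun i => sub_pos.2 (hp (by omega))
  have hle : ∀ x, p ⌊x⌋ ≤ ρ x := fun x =>
    le_add_of_nonneg_right (mul_nonneg (Int.fract_nonneg x) (hgap _).le)
  have hlt : ∀ x, ρ x < p (⌊x⌋ + 1) := fun x => by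
    have := mul_lt_mul_of_pos_right (Int.fract_lt_one x) (hgap ⌊x⌋)
    simp only [ρ]
    linarith
  have hρ : StrictMono ρ := by
    intro x x' h
    rcases (Int.floor_mono h.le).eq_or_lt with h' | h'
    · have hfr : Int.fract x < Int.fract x' := by
        rw [Int.fract, Int.fract, h']
        linarith
      simp only [ρ, h']
      have := mul_lt_mul_of_pos_right hfr (hgap ⌊x'⌋)
      linarith
    · exact (hlt x).trans_le ((hp.monotone (by omega)).trans (hle x'))
  have hmem : ∀ x, ρ x ∈ Ioo 0 b := fun x =>
    ⟨(mem_Ioo_of_tendsto hp h0 h1 _).1.trans_le (hle x),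
      (hlt x).trans (mem_Ioo_of_tendsto hp h0 h1 _).2⟩
  have hint : ∀ i : ℤ, ρ i = p i := fun i => by simp [ρ]
  have hsurj : ∀ s ∈ Ioo 0 b, ∃ x, ρ x = s := by
    intro s hs
    obtain ⟨i, hi, hi'⟩ := exists_int_between h0 hp h1 hs
    have hq0 : 0 ≤ (s - p i) / (p (i + 1) - p i) := div_nonneg (by linarith) (hgap i).le
    have hq1 : (s - p i) / (p (i + 1) - p i) < 1 := (div_lt_one (hgap i)).2 (by linarith)
    have hfl : ⌊(i : ℝ) + (s - p i) / (p (i + 1) - p i)⌋ = i := by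
      rw [Int.floor_intCast_add, Int.floor_eq_zero_iff.2 ⟨hq0, hq1⟩, add_zero]
    refine ⟨i + (s - p i) / (p (i + 1) - p i), ?_⟩
    simp only [ρ]
    rw [hfl, Int.fract_intCast_add, Int.fract_eq_self.2 ⟨hq0, hq1⟩, div_mul_cancel₀ _ (hgap i).ne']
    ring
  choose! τ hτ using hsurj
  have hτρ : ∀ x, τ (ρ x) = x := fun x => hρ.injective (hτ _ (hmem x))
  classical
  let σ : ℝ → ℝ := fun s => if s ∈ Ioo 0 b then ρ (τ s + k) else s
  have hin : ∀ x, σ (ρ x) = ρ (x + k) := fun x => by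
    simp only [σ]
    rw [if_pos (hmem x), hτρ]
  have hout : ∀ s ∉ Ioo 0 b, σ s = s := fun s hs => if_neg hs
  have hmono : StrictMono σ := by
    intro s t hst
    by_cases hs : s ∈ Ioo 0 b
    · rw [← hτ s hs, hin]
      by_cases ht : t ∈ Ioo 0 b
      · rw [← hτ t ht, hin]
        rw [← hτ s hs, ← hτ t ht, hρ.lt_iff_lt] at hst
        exact hρ (by linarith)
      · rw [hout t ht]
        exact (hmem _).2.trans_le (not_lt.1 fun h => ht ⟨hs.1.trans hst, h⟩)
    · rw [hout s hs]
      by_cases ht : t ∈ Ioo 0 b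
      · rw [← hτ t ht, hin]
        exact (not_lt.1 fun h => hs ⟨h, hst.trans ht.2⟩).trans_lt (hmem _).1
      · rwa [hout t ht]
  have hsur : Function.Surjective σ := by
    intro t
    by_cases ht : t ∈ Ioo 0 b
    · exact ⟨ρ (τ t - k), by rw [hin, sub_add_cancel, hτ t ht]⟩
    · exact ⟨t, hout t ht⟩
  refine ⟨hmono.orderIsoOfSurjective σ hsur, fun i => ?_, hout⟩
  change σ (p i) = _
  rw [← hint, hin, ← Int.cast_add, hint]

/-- Two points of `(0, b)` that are both in the sequence or both not in it are exchanged by an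
order isomorphism that shifts the sequence. -/
theorem exists_shift_map (hp : StrictMono p) (h0 : Tendsto p atBot (𝓝 0))
    (h1 : Tendsto p atTop (𝓝 b)) {s t : ℝ} (hs : s ∈ Ioo 0 b) (ht : t ∈ Ioo 0 b)
    (hst : s ∈ range p ↔ t ∈ range p) : ∃ (f : ℝ ≃o ℝ) (k : ℤ), (∀ i, f (p i) = p (i + k)) ∧
      (∀ r ∉ Ioo 0 b, f r = r) ∧ f s = t := by
  by_cases h : s ∈ range p
  · obtain ⟨j, rfl⟩ := hst.1 h
    obtain ⟨i, rfl⟩ := h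
    obtain ⟨σ, hσ, hσ'⟩ := exists_shift hp h0 h1 (j - i)
    exact ⟨σ, j - i, hσ, hσ', by rw [hσ, add_sub_cancel]⟩
  · have h' : t ∉ range p := fun h' => h (hst.2 h')
    obtain ⟨i, hi, hi'⟩ := exists_int_between h0 hp h1 hs
    obtain ⟨j, hj, hj'⟩ := exists_int_between h0 hp h1 ht
    have hi := hi.lt_of_ne fun e => h ⟨i, e⟩
    have hj := hj.lt_of_ne fun e => h' ⟨j, e⟩
    -- A shift brings `s` into the gap of `t`; a bump supported in this gap then moves it to `t`.
    obtain ⟨σ, hσ, hσ'⟩ := exists_shift hp h0 h1 (j - i)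
    have hσs : σ s ∈ Ioo (p j) (p (j + 1)) := by
      have e1 := σ.strictMono hi
      have e2 := σ.strictMono hi'
      rw [hσ] at e1 e2
      rw [add_sub_cancel] at e1
      rw [show i + 1 + (j - i) = j + 1 by ring] at e2
      exact ⟨e1, e2⟩
    obtain ⟨g, hg, hgs⟩ := exists_bump hσs ⟨hj, hj'⟩
    refine ⟨σ.trans g, j - i, fun i' => ?_, fun r hr => ?_, hgs⟩
    · rw [OrderIso.trans_apply, hσ, hg]
      rintro ⟨e1, e2⟩
      have e1 := hp.lt_iff_lt.1 e1
      have e2 := hp.lt_iff_lt.1 e2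
      omega
    · rw [OrderIso.trans_apply, hσ' r hr, hg]
      rintro ⟨e1, e2⟩
      exact hr ⟨(mem_Ioo_of_tendsto hp h0 h1 _).1.trans e1,
        e2.trans (mem_Ioo_of_tendsto hp h0 h1 _).2⟩

end Shift

/-! ### Counting the types -/

/-- The types of the points above the least of `m + 1` points in `(0,1)`. -/
noncomputable def upperType (m : ℕ) :
    Option (Fin (m + 1) ⊕ Fin (m + 1)) → ℕ∞ × Prop × Prop × Prop
  -- `none` is the point `1`, `inl i` the point `a i`, and `inr i` the gap immediately above `a i`.
  | none => (0, False, False, True)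
  | some (Sum.inl i) => ((m + 1 - i : ℕ), True, False, False)
  | some (Sum.inr i) => ((m - i : ℕ), False, False, False)

theorem upperType_injective (m : ℕ) : Function.Injective (upperType m) := by
  rintro (_ | i | i) (_ | j | j) h <;>
    simp only [upperType, Prod.mk.injEq, Nat.cast_inj, eq_iff_iff] at h <;>
    simp at h ⊢ <;> ext <;> omega

theorem encard_range_upperType (m : ℕ) : (range (upperType m)).encard = (2 * (m + 1) + 1 : ℕ) := by
  rw [← image_univ, (upperType_injective m).encard_image, encard_univ, ENat.card_eq_coe_fintype_card]
  simp [Fintype.card_option, two_mul]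

/-- Serves both families, since their sets differ only below `a 0`. The gap above the last `a i`
ends at `1`, so there are as many gaps as points. -/
theorem image_pointType_upper {m : ℕ} {a : Fin (m + 1) → ℝ} (ha : StrictMono a) (h0 : 0 < a 0)
    (h1 : ∀ i, a i < 1) {S : Set ℝ} (haS : range a ⊆ S) (hSa : ∀ s ∈ S, a 0 ≤ s → s ∈ range a) :
    pointType S '' Icc (a 0) 1 = range (upperType m) := by
  have h1S : (1 : ℝ) ∉ S := fun h => by
    obtain ⟨i, hi⟩ := hSa 1 h (h1 0).le
    exact (h1 i).ne hi
  have ecard : ∀ s, a 0 ≤ s → ∀ F : Finset (Fin (m + 1)), (∀ k, s ≤ a k ↔ k ∈ F) →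
      (S ∩ Icc s 1).encard = (F.card : ℕ) := by
    intro s hs F hF
    rw [← encard_coe_eq_coe_finsetCard, ← ha.injective.encard_image]
    congr 1
    ext t
    constructor
    · rintro ⟨ht, ht'⟩
      obtain ⟨k, rfl⟩ := hSa t ht (hs.trans ht'.1)
      exact ⟨k, (hF k).1 ht'.1, rfl⟩
    · rintro ⟨k, hk, rfl⟩
      exact ⟨haS (mem_range_self k), (hF k).2 hk, (h1 k).le⟩
  have e1 : pointType S 1 = upperType m none := by
    rw [pointType, upperType, ecard 1 (h1 0).le ∅ (by simpa using h1)]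
    simp [h1S]
  have ea : ∀ i, pointType S (a i) = upperType m (some (Sum.inl i)) := by
    intro i
    have hi : 0 < a i := h0.trans_le (ha.monotone (Fin.zero_le i))
    rw [pointType, upperType, ecard (a i) (ha.monotone (Fin.zero_le i)) (Finset.Ici i)
      (by simp [ha.le_iff_le]), Fin.card_Ici]
    simp [haS (mem_range_self i), hi.ne', (h1 i).ne]
  have eb : ∀ i s, s < 1 → s ∉ S → (∀ k, a k ≤ s ↔ k ≤ i) →
      pointType S s = upperType m (some (Sum.inr i)) := by
    intro i s hs hsS h
    have hs0 : a 0 ≤ s := (h 0).2 (Fin.zero_le i)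
    have : ∀ k, s ≤ a k ↔ k ∈ Finset.Ioi i := by
      intro k
      rw [Finset.mem_Ioi, ← not_le, ← h k, not_le]
      exact ⟨fun h => h.lt_of_ne (by rintro rfl; exact hsS (haS (mem_range_self k))), le_of_lt⟩
    rw [pointType, upperType, ecard s hs0 _ this, Fin.card_Ioi]
    simp [hsS, (h0.trans_le hs0).ne', hs.ne]
  refine Subset.antisymm ?_ ?_
  · rintro _ ⟨s, hs, rfl⟩
    rcases hs.2.eq_or_lt with rfl | hs1
    · exact ⟨_, e1.symm⟩
    by_cases hsS : s ∈ S
    · obtain ⟨i, rfl⟩ := hSa s hsS hs.1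
      exact ⟨_, (ea i).symm⟩
    · have hne : (Finset.univ.filter fun k => a k ≤ s).Nonempty := ⟨0, by simpa using hs.1⟩
      refine ⟨_, (eb ((Finset.univ.filter fun k => a k ≤ s).max' hne) s hs1 hsS fun k => ?_).symm⟩
      constructor
      · exact fun h => Finset.le_max' _ _ (by simpa using h)
      · intro h
        have := Finset.max'_mem _ hne
        rw [Finset.mem_filter] at this
        exact (ha.monotone h).trans this.2
  · rintro _ ⟨_ | i | i, rfl⟩
    · exact ⟨1, ⟨(h1 0).le, le_rfl⟩, e1⟩
    · exact ⟨a i, ⟨ha.monotone (Fin.zero_le i), (h1 i).le⟩, ea i⟩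
    · have hev : ∀ᶠ s in 𝓝[>] (a i), ∀ k, i < k → s < a k :=
        eventually_all.2 fun k => by
          by_cases hk : i < k
          · filter_upwards [mem_nhdsWithin_of_mem_nhds (gt_mem_nhds (ha hk))] with s hs _ using hs
          · exact Eventually.of_forall fun s h => absurd h hk
      obtain ⟨s, ⟨hs, hs1⟩, hk⟩ := ((eventually_mem_nhdsWithin.and
        (mem_nhdsWithin_of_mem_nhds (gt_mem_nhds (h1 i)))).and hev).exists
      have hs : a i < s := hs
      have hs1 : s < 1 := hs1
      have hks : ∀ k, a k ≤ s ↔ k ≤ i := fun k =>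
        ⟨fun h => not_lt.1 fun h' => (hk k h').not_ge h, fun h => (ha.monotone h).trans hs.le⟩
      have h0s : a 0 ≤ s := (ha.monotone (Fin.zero_le i)).trans hs.le
      refine ⟨s, ⟨h0s, hs1.le⟩, eb i s hs1 (fun hsS => ?_) hks⟩
      obtain ⟨k, rfl⟩ := hSa s hsS h0s
      rcases le_or_gt k i with h | h
      · exact hs.not_ge (ha.monotone h)
      · exact lt_irrefl _ (hk k h)

/-- The number of types for a finite set. -/
theorem encard_image_pointType_finite {m : ℕ} {a : Fin (m + 1) → ℝ} (ha : StrictMono a)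
    (h0 : 0 < a 0) (h1 : ∀ i, a i < 1) :
    (pointType ({0} ∪ range a) '' Icc 0 1).encard = (2 * (m + 1) + 3 : ℕ) := by
  have hle : ∀ i, a 0 ≤ a i := fun i => ha.monotone (Fin.zero_le i)
  have hup := image_pointType_upper ha h0 h1 (S := {0} ∪ range a) subset_union_right (by
    rintro s (rfl | h) hs
    · exact absurd hs h0.not_ge
    · exact h)
  have hmid : ∀ s ∈ Ioo 0 (a 0), pointType ({0} ∪ range a) s = (((m + 1 : ℕ) : ℕ∞), False, False, False) := by
    intro s hs
    have hS : s ∉ ({0} ∪ range a : Set ℝ) := by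
      rintro (h | ⟨i, rfl⟩)
      · exact hs.1.ne' h
      · exact hs.2.not_ge (hle i)
    have hcard : (({0} ∪ range a) ∩ Icc s 1 : Set ℝ) = range a := by
      ext t
      constructor
      · rintro ⟨rfl | h, h'⟩
        · exact absurd h'.1 hs.1.not_ge
        · exact h
      · rintro ⟨i, rfl⟩
        exact ⟨Or.inr ⟨i, rfl⟩, hs.2.le.trans (hle i), (h1 i).le⟩
    have hcard' : (range a).encard = (m + 1 : ℕ) := by
      rw [← image_univ, ha.injective.encard_image, encard_univ, ENat.card_eq_coe_fintype_card,
        Fintype.card_fin]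
    rw [pointType, hcard, hcard']
    simp only [hS, hs.1.ne', (hs.2.trans (h1 0)).ne]
  -- Below `a 0` there are two classes: `0` and a single gap.
  have hsplit : pointType ({0} ∪ range a) '' Icc 0 1 = range (upperType m) ∪
      {pointType ({0} ∪ range a) 0, (((m + 1 : ℕ) : ℕ∞), False, False, False)} := by
    rw [← hup, ← Ico_union_Icc_eq_Icc h0.le (h1 0).le, image_union, union_comm]
    congr 1
    refine Subset.antisymm ?_ ?_
    · rintro _ ⟨s, hs, rfl⟩
      rcases hs.1.eq_or_lt with rfl | h
      · exact Or.inl rfl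
      · exact Or.inr (hmid s ⟨h, hs.2⟩)
    · rintro _ (rfl | rfl)
      · exact ⟨0, ⟨le_rfl, h0⟩, rfl⟩
      · exact ⟨a 0 / 2, ⟨by linarith, by linarith⟩, hmid _ ⟨by linarith, by linarith⟩⟩
  rw [hsplit, encard_union_eq, encard_range_upperType, encard_pair]
  · norm_cast
  · simp [pointType]
  · rw [Set.disjoint_right]
    rintro _ (rfl | rfl) ⟨_ | i | i, h⟩ <;>
      simp only [upperType, pointType, Prod.mk.injEq, Nat.cast_inj, eq_iff_iff] at h <;>
      simp at h
    omega

/-- The number of types for the union of a finite set and a bi-infinite sequence. -/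
theorem encard_image_pointType_shift {m : ℕ} {a : Fin (m + 1) → ℝ} {p : ℤ → ℝ} (ha : StrictMono a)
    (h1 : ∀ i, a i < 1) (hp : StrictMono p) (hp0 : Tendsto p atBot (𝓝 0))
    (hp1 : Tendsto p atTop (𝓝 (a 0))) :
    (pointType (range p ∪ {0} ∪ range a) '' Icc 0 1).encard = (2 * (m + 1) + 4 : ℕ) := by
  have hpm := mem_Ioo_of_tendsto hp hp0 hp1
  have h0 : 0 < a 0 := (hpm 0).1.trans (hpm 0).2
  have hle : ∀ i, a 0 ≤ a i := fun i => ha.monotone (Fin.zero_le i)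
  have hup := image_pointType_upper ha h0 h1 (S := range p ∪ {0} ∪ range a) subset_union_right (by
    rintro s ((⟨i, rfl⟩ | rfl) | h) hs
    · exact absurd hs (hpm i).2.not_ge
    · exact absurd hs h0.not_ge
    · exact h)
  have hinf : ∀ s < a 0, ((range p ∪ {0} ∪ range a) ∩ Icc s 1 : Set ℝ).encard = ⊤ := by
    intro s hs
    obtain ⟨j, hj⟩ := (hp1.eventually (lt_mem_nhds hs)).exists
    rw [encard_eq_top_iff]
    refine ((Ici_infinite j).image hp.injective.injOn).mono ?_
    rintro _ ⟨i, hi, rfl⟩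
    exact ⟨Or.inl (Or.inl ⟨i, rfl⟩), hj.le.trans (hp.monotone hi), ((hpm i).2.trans (h1 0)).le⟩
  have hmem : ∀ s ∈ Ioo 0 (a 0), (s ∈ (range p ∪ {0} ∪ range a : Set ℝ) ↔ s ∈ range p) := by
    intro s hs
    constructor
    · rintro ((h | h) | ⟨i, rfl⟩)
      · exact h
      · exact absurd h hs.1.ne'
      · exact absurd hs.2 (hle i).not_gt
    · exact fun h => Or.inl (Or.inl h)
  have hmid : ∀ s ∈ Ioo 0 (a 0), pointType (range p ∪ {0} ∪ range a) s =
      (⊤, s ∈ range p, False, False) := by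
    intro s hs
    simp only [pointType, hinf s hs.2, hmem s hs, hs.1.ne', (hs.2.trans (h1 0)).ne]
  have hzero : pointType (range p ∪ {0} ∪ range a) 0 = (⊤, True, True, False) := by
    rw [pointType, hinf 0 h0]
    simp
  -- Below `a 0` infinitely many points of the set lie above any point, so the count no longer
  -- distinguishes: only `0`, the terms of the sequence and the gaps between them remain.
  have hsplit : pointType (range p ∪ {0} ∪ range a) '' Icc 0 1 = range (upperType m) ∪
      {(⊤, True, True, False), (⊤, True, False, False), (⊤, False, False, False)} := by
    rw [← hup, ← Ico_union_Icc_eq_Icc h0.le (h1 0).le, image_union, union_comm]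
    congr 1
    refine Subset.antisymm ?_ ?_
    · rintro _ ⟨s, hs, rfl⟩
      rcases hs.1.eq_or_lt with rfl | h
      · exact Or.inl hzero
      · right
        rw [hmid s ⟨h, hs.2⟩]
        by_cases hsp : s ∈ range p <;> simp [hsp]
    · rintro _ (rfl | rfl | rfl)
      · exact ⟨0, ⟨le_rfl, h0⟩, hzero⟩
      · exact ⟨p 0, ⟨(hpm 0).1.le, (hpm 0).2⟩, by rw [hmid _ (hpm 0)]; simp⟩
      · obtain ⟨s, hs, hs'⟩ := exists_between (hp (show (0 : ℤ) < 1 by norm_num))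
        have hs01 : s ∈ Ioo 0 (a 0) := ⟨(hpm 0).1.trans hs, hs'.trans (hpm 1).2⟩
        refine ⟨s, ⟨hs01.1.le, hs01.2⟩, ?_⟩
        rw [hmid s hs01]
        suffices s ∉ range p by simp only [this]
        rintro ⟨i, rfl⟩
        have e1 := hp.lt_iff_lt.1 hs
        have e2 := hp.lt_iff_lt.1 hs'
        omega
  rw [hsplit, encard_union_eq, encard_range_upperType, encard_insert_of_notMem, encard_pair]
  · norm_cast
  · simp
  · simp
  · rw [Set.disjoint_right]
    rintro _ (rfl | rfl | rfl) ⟨_ | i | i, h⟩ <;>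
      simp only [upperType, Prod.mk.injEq] at h <;>
      simp at h

/-! ### Counting orbits -/

section Orbits

variable {X α : Type*} [TopologicalSpace X] {K : X → α}

theorem encard_homeoOrbits (hK : ∀ x x', (∃ h : X ≃ₜ X, h x = x') ↔ K x = K x') :
    (homeoOrbits X).encard = (range K).encard := by
  have h : homeoOrbits X = (fun a => {x | a = K x}) '' range K := by
    rw [homeoOrbits, ← range_comp]
    congr 1
    ext x x'
    exact hK x x'
  rw [h, InjOn.encard_image]
  rintro _ ⟨x, rfl⟩ _ ⟨x', rfl⟩ h
  have : x ∈ {z | K x = K z} := rfl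
  rw [show {z | K x = K z} = {z | K x' = K z} from h] at this
  exact Eq.symm this

/-- `K` is constant on each piece of an admissible partition, so there are at least as many pieces
as values of `K`; its fibres attain this bound. -/
theorem isOneDivHomogeneous_of_invariant {n : ℕ}
    (hK : ∀ x x', (∃ h : X ≃ₜ X, h x = x') ↔ K x = K x') (hn : (range K).encard = n) :
    IsOneDivHomogeneous n X := by
  have hfin : (range K).Finite := finite_of_encard_eq_coe hn
  have := hfin.to_subtype
  have hcard : Nat.card (range K) = n := by
    rw [Nat.card_coe_set_eq, ncard_def, hn]
    rfl
  constructor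
  · let e := Finite.equivFinOfCardEq hcard
    refine ⟨fun x => e ⟨K x, x, rfl⟩, fun i => ?_, fun x x' h => (hK x x').2 ?_⟩
    · obtain ⟨⟨_, x, rfl⟩, h⟩ := e.surjective i
      exact ⟨x, h⟩
    · exact congrArg Subtype.val (e.injective h)
  · rintro k ⟨P, hP, hPh⟩
    choose r hr using hP
    have hsurj : Function.Surjective fun i : Fin k => (⟨K (r i), r i, rfl⟩ : range K) := by
      rintro ⟨_, x, rfl⟩
      exact ⟨P x, Subtype.ext ((hK _ _).1 (hPh _ _ (hr (P x))))⟩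
    have hle := Nat.card_le_card_of_surjective _ hsurj
    rwa [hcard, Nat.card_fin] at hle

end Orbits

/-! ### Endpoint-homogeneity, the EPG property and the classification of orbits -/

namespace IsCombParam

variable {M : ℝ} {y : ℕ+ → ℝ} {S : Set ℝ}

theorem isEndpointHomogeneous (hp : IsCombParam M y) (hfib : ∀ n, {k | y k = y n}.Infinite) :
    IsEndpointHomogeneous (CombFan (comb M y)) := by
  rw [IsEndpointHomogeneous, hp.endpoints_eq]
  rintro _ ⟨l, rfl⟩ _ ⟨l', rfl⟩
  obtain ⟨H, f, -, hf, hH⟩ := hp.exists_homeomorph_root hfib l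
  obtain ⟨H', f', -, hf', hH'⟩ := hp.exists_homeomorph_root hfib l'
  refine ⟨H.symm.trans H', ?_⟩
  beta_reduce
  rw [← hf, ← hf', ← hH 1 zero_le_one le_rfl, ← hH' 1 zero_le_one le_rfl,
    Homeomorph.trans_apply, Homeomorph.symm_apply_apply]

/-- Limits of ends are a topological notion, so `root_inter_closure` is transported to any blade by
a homeomorphism `H`, whose restriction to the root also provides the parametrization. -/
theorem isEPG (hp : IsCombParam M y) (hfib : ∀ n, {k | y k = y n}.Infinite)
    (hS : insert 0 (closure (range y)) = S) : IsEPG S (CombFan (comb M y)) := by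
  refine ⟨hp.isSmoothFan.1, fun t ht e he B hB => ?_⟩
  have htop : t = hp.model.top := singleton_injective (ht.symm.trans hp.isTop)
  subst htop
  rw [hp.endpoints_eq] at he
  obtain ⟨l, rfl⟩ := he
  obtain ⟨H, f, hf0, hf1, hH⟩ := hp.exists_homeomorph_root hfib l
  have hroot := hp.isArcBetween_blade []
  rw [bladeHeight_nil] at hroot
  have hHB : H '' (hp.model.pt [] '' Icc 0 1) = B := by
    have h := hroot.image H
    rw [Homeomorph.map_top hp.isTop, hH 1 zero_le_one le_rfl, hf1] at h
    exact hp.model.arc_unique h hB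
  have hS01 : S ⊆ Icc 0 1 := by
    rw [← hS]
    exact insert_subset (by simp) (closure_minimal
      (range_subset_iff.2 fun n => ⟨(hp.pos n).le, (hp.y_lt_one n).le⟩) isClosed_Icc)
  have := hp.model.t2Space
  have hinj : Function.Injective fun s : unitInterval => hp.model.pt [] s := fun s s' h =>
    Subtype.ext (hp.model.injOn_pt [] (by rw [len_model, bladeHeight_nil]; exact s.2)
      (by rw [len_model, bladeHeight_nil]; exact s'.2) h)
  have himg : ∀ T ⊆ Icc (0 : ℝ) 1, (fun s : unitInterval => H (hp.model.pt [] s)) '' {s | (s : ℝ) ∈ T} =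
      H '' (hp.model.pt [] '' T) := by
    intro T hT
    rw [image_image]
    ext x
    constructor
    · rintro ⟨s, hs, rfl⟩
      exact ⟨s, hs, rfl⟩
    · rintro ⟨s, hs, rfl⟩
      exact ⟨⟨s, hT hs⟩, hs, rfl⟩
  refine ⟨fun s => H (hp.model.pt [] s), ?_, ?_, ?_, ?_⟩
  · exact H.isEmbedding.comp (Continuous.isClosedEmbedding
      ((hp.model.continuous_pt []).comp continuous_subtype_val) hinj).isEmbedding
  · rw [← hHB, ← himg _ Subset.rfl, ← image_univ]
    congr 1
    ext s
    simp
  · simp only [Icc.coe_zero]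
    rw [hp.model.pt_zero, Homeomorph.map_top hp.isTop]
  · rw [himg S hS01, ← hS, ← hp.root_inter_closure hfib, image_inter H.injective, H.image_closure,
      image_sdiff H.injective, Homeomorph.image_endpoints, hHB]

/-- Points of the root blade in the same orbit have the same type. -/
theorem pointType_eq_of_homeomorph (hp : IsCombParam M y) (hfib : ∀ n, {k | y k = y n}.Infinite)
    (hS : insert 0 (closure (range y)) = S) (h : CombFan (comb M y) ≃ₜ CombFan (comb M y))
    {s s' : ℝ} (hs : s ∈ Icc (0 : ℝ) 1) (hs' : s' ∈ Icc (0 : ℝ) 1)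
    (hss : h (hp.model.pt [] s) = hp.model.pt [] s') : pointType S s' = pointType S s := by
  have hlen : hp.model.len [] = 1 := bladeHeight_nil M y
  have htop : h hp.model.top = hp.model.top := Homeomorph.map_top hp.isTop h
  have hinj : InjOn (hp.model.pt []) (Icc 0 1) := hlen ▸ hp.model.injOn_pt []
  have z : (0 : ℝ) ∈ Icc (0 : ℝ) 1 := by simp
  have o : (1 : ℝ) ∈ Icc (0 : ℝ) 1 := by simp
  by_cases hs0 : s = 0
  · subst hs0
    rw [hp.model.pt_zero, htop, ← hp.model.pt_zero []] at hss
    rw [hinj z hs' hss]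
  have hs0' : 0 < s' := by
    refine hs'.1.lt_of_ne ?_
    rintro rfl
    rw [hp.model.pt_zero, ← htop, ← hp.model.pt_zero []] at hss
    exact hs0 (hinj hs z (h.injective hss))
  have hroot := hp.isArcBetween_blade []
  rw [bladeHeight_nil] at hroot
  have hend : hp.model.pt [] 1 ∈ endpoints (CombFan (comb M y)) := by
    rw [hp.endpoints_eq]
    exact ⟨[], by simp only [bladeHeight_nil]⟩
  obtain ⟨l, hl⟩ : h (hp.model.pt [] 1) ∈ range fun l => hp.model.pt l (bladeHeight M y l) := by
    rw [← hp.endpoints_eq]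
    exact Homeomorph.map_endpoints h hend
  have himg : h '' (hp.model.pt [] '' Icc 0 1) = hp.model.pt l '' Icc 0 (bladeHeight M y l) := by
    have h1 := hroot.image h
    rw [htop, ← hl] at h1
    exact hp.model.arc_unique h1 (hp.isArcBetween_blade l)
  -- The image of the root is a blade through a point of the root other than the top, hence the
  -- root.
  obtain rfl : l = [] := by
    have hm : hp.model.pt [] s' ∈ h '' (hp.model.pt [] '' Icc 0 1) := ⟨_, ⟨s, hs, rfl⟩, hss⟩
    rw [himg] at hm
    obtain ⟨u, hu, hu'⟩ := hm
    exact (hp.model.pt_inj hs0' (by rw [hlen]; exact hs'.2) hu.1 hu.2 hu'.symm).1.symm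
  rw [bladeHeight_nil] at himg
  simp only [bladeHeight_nil] at hl
  -- `h` read in the height coordinate of the root: continuous, injective and fixing `0` and `1`,
  -- hence increasing.
  let ψ : ℝ → ℝ := fun u => hp.model.ht (h (hp.model.pt [] u))
  have hψ : ∀ u ∈ Icc (0 : ℝ) 1, ψ u ∈ Icc (0 : ℝ) 1 ∧
      h (hp.model.pt [] u) = hp.model.pt [] (ψ u) := by
    intro u hu
    have hm : h (hp.model.pt [] u) ∈ hp.model.pt [] '' Icc 0 1 := himg ▸ ⟨_, ⟨u, hu, rfl⟩, rfl⟩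
    obtain ⟨v, hv, hv'⟩ := hm
    have : ψ u = v := by
      simp only [ψ]
      rw [← hv', hp.model.ht_pt hv.1 (by rw [hlen]; exact hv.2)]
    rw [this]
    exact ⟨hv, hv'.symm⟩
  have hψ_eq : ∀ u ∈ Icc (0 : ℝ) 1, ∀ v ∈ Icc (0 : ℝ) 1,
      h (hp.model.pt [] u) = hp.model.pt [] v → ψ u = v := fun u hu v hv huv =>
    hinj (hψ u hu).1 hv ((hψ u hu).2.symm.trans huv)
  have hψ0 : ψ 0 = 0 := hψ_eq 0 z 0 z (by rw [hp.model.pt_zero, htop])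
  have hψ1 : ψ 1 = 1 := hψ_eq 1 o 1 o hl.symm
  have hψc : Continuous ψ := hp.model.continuous_ht.comp (h.continuous.comp
    (hp.model.continuous_pt []))
  have hψi : InjOn ψ (Icc 0 1) := fun u hu v hv huv => hinj hu hv (h.injective (by
    rw [(hψ u hu).2, (hψ v hv).2, huv]))
  have hmono : StrictMonoOn ψ (Icc 0 1) := hψc.continuousOn.strictMonoOn_of_injOn_Icc zero_le_one
    (by rw [hψ0, hψ1]; exact zero_le_one) hψi
  have hS01 : S ⊆ Icc 0 1 := by
    rw [← hS]
    exact insert_subset (by simp) (closure_minimal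
      (range_subset_iff.2 fun n => ⟨(hp.pos n).le, (hp.y_lt_one n).le⟩) isClosed_Icc)
  have hψS : ψ '' S = S := by
    have h1 : h '' (hp.model.pt [] '' S) = hp.model.pt [] '' S := by
      conv_lhs => rw [← hS, ← hp.root_inter_closure hfib, image_inter h.injective, h.image_closure,
        image_sdiff h.injective, Homeomorph.image_endpoints, himg, hp.root_inter_closure hfib, hS]
    refine (hinj.image_eq_image_iff (image_subset_iff.2 fun u hu => (hψ u (hS01 hu)).1) hS01).1 ?_
    rw [← h1, image_image, image_image]
    exact image_congr fun u hu => (hψ u (hS01 hu)).2.symm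
  rw [← hψ_eq s hs s' hs' hss]
  exact pointType_map hS01 hmono hψ0 hψ1 hψS hs

/-- Each point is moved to the root blade by a chosen homeomorphism. The type of the height reached
is a complete invariant: homeomorphisms preserve it, and `hmove` with `exists_bladeMap_root`
realizes every equality of types. -/
theorem isOneDivHomogeneous (hp : IsCombParam M y) (hfib : ∀ n, {k | y k = y n}.Infinite)
    (hS : insert 0 (closure (range y)) = S) {n : ℕ}
    (hn : (pointType S '' Icc 0 1).encard = n)
    (hmove : ∀ s ∈ Icc (0 : ℝ) 1, ∀ s' ∈ Icc (0 : ℝ) 1, pointType S s = pointType S s' →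
      ∃ f : ℝ ≃o ℝ, f 0 = 0 ∧ f 1 = 1 ∧ f '' range y = range y ∧ f s = s') :
    IsOneDivHomogeneous n (CombFan (comb M y)) ∧
      (homeoOrbits (CombFan (comb M y))).encard = n := by
  have hex : ∀ x : CombFan (comb M y), ∃ s ∈ Icc (0 : ℝ) 1,
      ∃ h : CombFan (comb M y) ≃ₜ CombFan (comb M y), h (hp.model.pt [] s) = x := by
    intro x
    obtain ⟨l, s, h0, h1, rfl⟩ := hp.model.exists_pt x
    obtain ⟨H, f, hf0, hf1, hH⟩ := hp.exists_homeomorph_root hfib l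
    have hs0 : 0 ≤ f.symm s := by rwa [f.le_symm_apply, hf0]
    have hs1 : f.symm s ≤ 1 := by rwa [f.symm_apply_le, hf1]
    exact ⟨f.symm s, ⟨hs0, hs1⟩, H, by rw [hH _ hs0 hs1, f.apply_symm_apply]⟩
  choose σ hσ H hH using hex
  have hK : ∀ x x', (∃ h : CombFan (comb M y) ≃ₜ CombFan (comb M y), h x = x') ↔
      pointType S (σ x) = pointType S (σ x') := by
    intro x x'
    constructor
    · rintro ⟨h, rfl⟩
      refine (hp.pointType_eq_of_homeomorph hfib hS (((H x).trans h).trans (H (h x)).symm)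
        (hσ x) (hσ (h x)) ?_).symm
      rw [Homeomorph.trans_apply, Homeomorph.trans_apply, hH, Homeomorph.symm_apply_eq, hH]
    · intro h
      obtain ⟨f, hf0, hf1, hfy, hfs⟩ := hmove _ (hσ x) _ (hσ x') h
      obtain ⟨B, hB, hB'⟩ := hp.exists_bladeMap_root hfib f hf0 hf1 hfy
      obtain ⟨G, hG⟩ := B.exists_homeomorph hp
      refine ⟨((H x).symm.trans G).trans (H x'), ?_⟩
      rw [Homeomorph.trans_apply, Homeomorph.trans_apply, ← (H x).eq_symm_apply.2 (hH x),
        hG [] _ (hσ x).1 (by rw [bladeHeight_nil]; exact (hσ x).2), hB, hB', hfs, hH]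
  have hrange : (range fun x => pointType S (σ x)) = pointType S '' Icc 0 1 := by
    ext k
    constructor
    · rintro ⟨x, rfl⟩
      exact ⟨_, hσ x, rfl⟩
    · rintro ⟨s, hs, rfl⟩
      exact ⟨hp.model.pt [] s,
        (hp.pointType_eq_of_homeomorph hfib hS _ (hσ _) hs (hH (hp.model.pt [] s))).symm⟩
  rw [← hrange] at hn
  exact ⟨isOneDivHomogeneous_of_invariant hK hn, (encard_homeoOrbits hK).trans hn⟩

end IsCombParam

/-! ### The two families of fans -/

theorem IsCombData.isCombParam {S : Set ℝ} {M : ℝ} {y : ℕ+ → ℝ} (h : IsCombData S M y)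
    (h0 : ∀ s ∈ S, 0 ≤ s) (h1 : ∀ s ∈ S, s < 1) : IsCombParam M y := by
  obtain ⟨hM, D, -, hDS, -, hy, -⟩ := h
  exact ⟨h1 M hM.1, fun n => (h0 _ (hDS (hy n)).1).lt_of_ne' (hDS (hy n)).2,
    fun n => hM.2 (hDS (hy n)).1⟩

theorem IsCombData.infinite_fiber {S : Set ℝ} {M : ℝ} {y : ℕ+ → ℝ} (h : IsCombData S M y) (n : ℕ+) :
    {k | y k = y n}.Infinite := by
  obtain ⟨-, D, -, -, -, hy, hfib⟩ := h
  exact hfib _ (hy n)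

theorem IsCombData.range_subset {S : Set ℝ} {M : ℝ} {y : ℕ+ → ℝ} (h : IsCombData S M y) :
    range y ⊆ S := by
  obtain ⟨-, D, -, hDS, -, hy, -⟩ := h
  exact range_subset_iff.2 fun n => (hDS (hy n)).1

theorem IsCombData.subset_closure_range {S : Set ℝ} {M : ℝ} {y : ℕ+ → ℝ} (h : IsCombData S M y) :
    S \ {0} ⊆ closure (range y) := by
  obtain ⟨-, D, -, -, hSD, -, hfib⟩ := h
  refine hSD.trans (closure_mono fun d hd => ?_)
  obtain ⟨n, hn⟩ := (hfib d hd).nonempty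
  exact ⟨n, hn⟩

theorem IsCombData.insert_closure {S : Set ℝ} {M : ℝ} {y : ℕ+ → ℝ} (h : IsCombData S M y)
    (hS : IsClosed S) (h0 : 0 ∈ S) : insert 0 (closure (range y)) = S := by
  refine Subset.antisymm (insert_subset h0 (closure_minimal h.range_subset hS)) fun s hs => ?_
  by_cases hs0 : s = 0
  · exact Or.inl hs0
  · exact Or.inr (h.subset_closure_range ⟨hs, hs0⟩)

/-- Enumerating `(S \ {0}) × ℕ` and forgetting the second factor repeats each value infinitely
often. -/
theorem exists_isCombData {S : Set ℝ} {M : ℝ} (hS : S.Countable) (hM : IsGreatest S M)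
    (hM0 : 0 < M) : ∃ y, IsCombData S M y := by
  have hne : Nonempty (S \ {0} : Set ℝ) := ⟨⟨M, hM.1, hM0.ne'⟩⟩
  have hc : Countable (S \ {0} : Set ℝ) := (hS.mono sdiff_subset).to_subtype
  obtain ⟨g, hg⟩ := exists_surjective_nat ((S \ {0} : Set ℝ) × ℕ)
  refine ⟨fun n => (g n.natPred).1, hM, S \ {0}, hS.mono sdiff_subset, Subset.rfl, subset_closure,
    fun n => (g n.natPred).1.2, fun d hd => ?_⟩
  have hinf : (range fun k : ℕ => ((⟨d, hd⟩, k) : (S \ {0} : Set ℝ) × ℕ)).Infinite :=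
    infinite_range_of_injective fun k k' h => (Prod.mk.inj h).2
  have hsurj : Function.Surjective fun n : ℕ+ => g n.natPred := fun q => by
    obtain ⟨k, hk⟩ := hg q
    exact ⟨k.succPNat, by simpa using hk⟩
  refine Infinite.mono ?_ (hinf.preimage (f := fun n : ℕ+ => g n.natPred) fun q _ => hsurj q)
  rintro n ⟨k, hk⟩
  exact congrArg (fun q : (S \ {0} : Set ℝ) × ℕ => (q.1 : ℝ)) hk.symm

/-- The fans of the combs associated with a finite set. -/
theorem combFan_finite {m : ℕ} {a : Fin (m + 1) → ℝ} (ha : StrictMono a)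
    (h01 : ∀ i, 0 < a i ∧ a i < 1) {M : ℝ} {y : ℕ+ → ℝ}
    (h : IsCombData ({0} ∪ range a) M y) :
    IsComb (comb M y) ∧ IsSmoothFan (CombFan (comb M y)) ∧
      IsEPG ({0} ∪ range a) (CombFan (comb M y)) ∧
      IsEndpointHomogeneous (CombFan (comb M y)) ∧
      IsOneDivHomogeneous (2 * (m + 1) + 3) (CombFan (comb M y)) ∧
      (homeoOrbits (CombFan (comb M y))).encard = (2 * (m + 1) + 3 : ℕ) := by
  have hfin : ({0} ∪ range a : Set ℝ).Finite := (finite_singleton 0).union (finite_range a)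
  have hp : IsCombParam M y := by
    refine h.isCombParam ?_ ?_ <;> rintro s (rfl | ⟨i, rfl⟩)
    exacts [le_rfl, (h01 i).1.le, zero_lt_one, (h01 i).2]
  have hS := h.insert_closure hfin.isClosed (Or.inl rfl)
  refine ⟨hp.isComb, hp.isSmoothFan, hp.isEPG h.infinite_fiber hS,
    hp.isEndpointHomogeneous h.infinite_fiber, hp.isOneDivHomogeneous h.infinite_fiber hS
      (encard_image_pointType_finite ha (h01 0).1 fun i => (h01 i).2) fun s hs s' hs' hss => ?_⟩
  obtain ⟨f, hf, hf1, hfs⟩ := exists_fix_of_pointType_eq hfin.isClosed hs hs' hss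
    (hfin.subset inter_subset_left)
  exact ⟨f, hf 0 (Or.inl rfl), hf1, image_eq_of_forall_eq fun r hr => hf r (h.range_subset hr), hfs⟩

/-- Each half of the sequence is compact once its limit, `0` or `b`, is added. -/
theorem isClosed_range_shift {p : ℤ → ℝ} {b : ℝ} (h0 : Tendsto p atBot (𝓝 0))
    (h1 : Tendsto p atTop (𝓝 b)) {T : Set ℝ} (hT : IsClosed T) (hb : b ∈ T) :
    IsClosed (range p ∪ {0} ∪ T) := by
  have e1 := (h1.comp tendsto_natCast_atTop_atTop).isCompact_insert_range.isClosed
  have e2 := (h0.comp (tendsto_neg_atTop_atBot.comp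
    (tendsto_natCast_atTop_atTop (R := ℤ)))).isCompact_insert_range.isClosed
  convert (e1.union e2).union hT using 1
  ext s
  constructor
  · rintro ((⟨i, rfl⟩ | rfl) | hs)
    · obtain ⟨k, rfl | rfl⟩ := i.eq_nat_or_neg
      · exact Or.inl (Or.inl (Or.inr ⟨k, rfl⟩))
      · exact Or.inl (Or.inr (Or.inr ⟨k, rfl⟩))
    · exact Or.inl (Or.inr (Or.inl rfl))
    · exact Or.inr hs
  · rintro (((rfl | ⟨k, rfl⟩) | (rfl | ⟨k, rfl⟩)) | hs)
    · exact Or.inr hb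
    · exact Or.inl (Or.inl ⟨_, rfl⟩)
    · exact Or.inl (Or.inr rfl)
    · exact Or.inl (Or.inl ⟨_, rfl⟩)
    · exact Or.inr hs

/-- The fans of the combs associated with the union of a finite set and a bi-infinite sequence. -/
theorem combFan_shift {m : ℕ} {a : Fin (m + 1) → ℝ} {p : ℤ → ℝ} (ha : StrictMono a)
    (ha1 : ∀ i, a i < 1) (hpm : StrictMono p) (hp0 : Tendsto p atBot (𝓝 0))
    (hp1 : Tendsto p atTop (𝓝 (a 0))) {M : ℝ} {y : ℕ+ → ℝ}
    (h : IsCombData (range p ∪ {0} ∪ range a) M y) :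
    IsComb (comb M y) ∧ IsSmoothFan (CombFan (comb M y)) ∧
      IsEPG (range p ∪ {0} ∪ range a) (CombFan (comb M y)) ∧
      IsEndpointHomogeneous (CombFan (comb M y)) ∧
      IsOneDivHomogeneous (2 * (m + 1) + 4) (CombFan (comb M y)) ∧
      (homeoOrbits (CombFan (comb M y))).encard = (2 * (m + 1) + 4 : ℕ) := by
  have hmem := mem_Ioo_of_tendsto hpm hp0 hp1
  have h0 : 0 < a 0 := (hmem 0).1.trans (hmem 0).2
  have hle : ∀ i, a 0 ≤ a i := fun i => ha.monotone (Fin.zero_le i)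
  have hcl : IsClosed (range p ∪ {0} ∪ range a) :=
    isClosed_range_shift hp0 hp1 (finite_range a).isClosed (mem_range_self 0)
  have hp : IsCombParam M y := by
    refine h.isCombParam ?_ ?_ <;> rintro s ((⟨i, rfl⟩ | rfl) | ⟨i, rfl⟩)
    exacts [(hmem i).1.le, le_rfl, h0.le.trans (hle i), (hmem i).2.trans (ha1 0), zero_lt_one, ha1 i]
  have hS := h.insert_closure hcl (Or.inl (Or.inr rfl))
  have hlow : ∀ s ∈ Ioo 0 (a 0), s ∈ range p ∪ {0} ∪ range a → s ∈ range p := by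
    rintro s hs ((h' | h') | ⟨i, rfl⟩)
    · exact h'
    · exact absurd h' hs.1.ne'
    · exact absurd hs.2 (hle i).not_gt
  -- `p i` is isolated in `S`, so the dense set of values of `y` has to contain it.
  have hpy : ∀ i, p i ∈ range y := by
    intro i
    have hcl := h.subset_closure_range ⟨Or.inl (Or.inl (mem_range_self i)), (hmem i).1.ne'⟩
    obtain ⟨_, ⟨hz1, hz2⟩, n, rfl⟩ := mem_closure_iff_nhds.1 hcl _
      (Ioo_mem_nhds (hpm (show i - 1 < i by omega)) (hpm (show i < i + 1 by omega)))
    obtain ⟨j, hj⟩ := hlow (y n) ⟨(hmem _).1.trans hz1, hz2.trans (hmem _).2⟩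
      (h.range_subset (mem_range_self n))
    rw [← hj] at hz1 hz2
    have e1 := hpm.lt_iff_lt.1 hz1
    have e2 := hpm.lt_iff_lt.1 hz2
    obtain rfl : j = i := by omega
    exact ⟨n, hj.symm⟩
  refine ⟨hp.isComb, hp.isSmoothFan, hp.isEPG h.infinite_fiber hS,
    hp.isEndpointHomogeneous h.infinite_fiber, hp.isOneDivHomogeneous h.infinite_fiber hS
      (encard_image_pointType_shift ha ha1 hpm hp0 hp1) fun s hs s' hs' hss => ?_⟩
  -- A finite count means that `s` is `a 0` or above it, where fixing `S` pointwise suffices; below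
  -- `a 0` shifts are needed.
  by_cases hfin : ((range p ∪ {0} ∪ range a) ∩ Icc s 1).Finite
  · obtain ⟨f, hf, hf1, hfs⟩ := exists_fix_of_pointType_eq hcl hs hs' hss hfin
    exact ⟨f, hf 0 (Or.inl (Or.inr rfl)), hf1,
      image_eq_of_forall_eq fun r hr => hf r (h.range_subset hr), hfs⟩
  have below : ∀ s : ℝ, ¬ ((range p ∪ {0} ∪ range a) ∩ Icc s 1).Finite → s < a 0 := by
    intro s hs
    by_contra! hle'
    refine hs ((finite_range a).subset ?_)
    rintro t ⟨(⟨i, rfl⟩ | rfl) | ht, ht'⟩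
    · exact absurd (hle'.trans ht'.1) (hmem i).2.not_ge
    · exact absurd (hle'.trans ht'.1) h0.not_ge
    · exact ht
  obtain ⟨e1, e2, e3, -⟩ := pointType_eq.1 hss
  have hfin' : ¬ ((range p ∪ {0} ∪ range a) ∩ Icc s' 1).Finite := by
    rwa [← encard_lt_top_iff, ← e1, encard_lt_top_iff]
  rcases hs.1.eq_or_lt with hs0 | hs0
  · exact ⟨OrderIso.refl ℝ, rfl, rfl, image_eq_of_forall_eq fun _ _ => rfl,
      hs0.symm.trans (e3.1 hs0.symm).symm⟩
  have hs1 : s ∈ Ioo 0 (a 0) := ⟨hs0, below s hfin⟩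
  have hs1' : s' ∈ Ioo 0 (a 0) := ⟨hs'.1.lt_of_ne' fun h => hs0.ne' (e3.2 h), below s' hfin'⟩
  obtain ⟨f, k, hf, hf', hfs⟩ := exists_shift_map hpm hp0 hp1 hs1 hs1'
    ⟨fun h' => hlow _ hs1' (e2.1 (Or.inl (Or.inl h'))),
      fun h' => hlow _ hs1 (e2.2 (Or.inl (Or.inl h')))⟩
  -- The limit point `a 0` need not be a value of `y`. This is harmless, as `f` is the identity off
  -- `(0, a 0)` and all `p i` are values.
  have hcase : ∀ r ∈ range y, (∃ i, p i = r) ∨ r ∉ Ioo 0 (a 0) := by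
    intro r hr
    by_cases hr' : r ∈ Ioo 0 (a 0)
    · exact Or.inl (hlow r hr' (h.range_subset hr))
    · exact Or.inr hr'
  refine ⟨f, hf' 0 (by simp), hf' 1 fun h' => h'.2.not_gt (ha1 0), Subset.antisymm ?_ ?_, hfs⟩
  · rintro _ ⟨r, hr, rfl⟩
    rcases hcase r hr with ⟨i, rfl⟩ | hr'
    · rw [hf]
      exact hpy _
    · rwa [hf' r hr']
  · intro r hr
    rcases hcase r hr with ⟨i, rfl⟩ | hr'
    · exact ⟨p (i - k), hpy _, by rw [hf, sub_add_cancel]⟩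
    · exact ⟨r, hr, hf' r hr'⟩

end Fans

/-! ### The main theorem, with explicit sets for the existence statement -/

theorem mainTheorem3 :
    -- existence for every `n ≥ 5`
    (∀ n : ℕ, 5 ≤ n → ∃ (F : Type) (_ : TopologicalSpace F),
      Fans.IsSmoothFan F ∧ Fans.IsEndpointHomogeneous F ∧
        Fans.IsOneDivHomogeneous n F ∧ (Fans.homeoOrbits F).encard = n) ∧
    -- odd `n = 2 (m + 1) + 3`
    (∀ (m : ℕ) (a : Fin (m + 1) → ℝ), StrictMono a → (∀ i, 0 < a i ∧ a i < 1) →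
      ∀ (S : Set ℝ), S = {0} ∪ Set.range a →
      ∀ (M : ℝ) (y : ℕ+ → ℝ), Fans.IsCombData S M y →
        Fans.IsComb (Fans.comb M y) ∧
        Fans.IsSmoothFan (Fans.CombFan (Fans.comb M y)) ∧
        Fans.IsEPG S (Fans.CombFan (Fans.comb M y)) ∧
        Fans.IsEndpointHomogeneous (Fans.CombFan (Fans.comb M y)) ∧
        Fans.IsOneDivHomogeneous (2 * (m + 1) + 3) (Fans.CombFan (Fans.comb M y)) ∧
        (Fans.homeoOrbits (Fans.CombFan (Fans.comb M y))).encard = (2 * (m + 1) + 3 : ℕ)) ∧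
    -- even `n = 2 (m + 1) + 4`
    (∀ (m : ℕ) (a : Fin (m + 1) → ℝ) (p : ℤ → ℝ), StrictMono a → (∀ i, a i < 1) →
      StrictMono p → Filter.Tendsto p Filter.atBot (nhds 0) →
      Filter.Tendsto p Filter.atTop (nhds (a 0)) →
      ∀ (S : Set ℝ), S = Set.range p ∪ {0} ∪ Set.range a →
      ∀ (M : ℝ) (y : ℕ+ → ℝ), Fans.IsCombData S M y →
        Fans.IsComb (Fans.comb M y) ∧
        Fans.IsSmoothFan (Fans.CombFan (Fans.comb M y)) ∧
        Fans.IsEPG S (Fans.CombFan (Fans.comb M y)) ∧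
        Fans.IsEndpointHomogeneous (Fans.CombFan (Fans.comb M y)) ∧
        Fans.IsOneDivHomogeneous (2 * (m + 1) + 4) (Fans.CombFan (Fans.comb M y)) ∧
        (Fans.homeoOrbits (Fans.CombFan (Fans.comb M y))).encard = (2 * (m + 1) + 4 : ℕ)) := by
  refine ⟨fun n hn => ?_, ?_, ?_⟩
  -- `m + 1` is the number of points `a i`; the parity of `n` decides between the two families.
  · obtain ⟨m, hm⟩ : ∃ m, n = 2 * (m + 1) + 3 ∨ n = 2 * (m + 1) + 4 := ⟨(n - 5) / 2, by omega⟩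
    let a : Fin (m + 1) → ℝ := fun i => ((i : ℕ) + 1) / (m + 2)
    have ha : StrictMono a := fun i j hij => by
      have : ((i : ℕ) : ℝ) < (j : ℕ) := by exact_mod_cast hij
      simp only [a]
      gcongr
    have h01 : ∀ i, 0 < a i ∧ a i < 1 := fun i => by
      have : ((i : ℕ) : ℝ) < m + 1 := by exact_mod_cast i.2
      refine ⟨by positivity, (div_lt_one (by positivity)).2 (by linarith)⟩
    have hlast : ∀ i, a i ≤ a (Fin.last m) := fun i => ha.monotone (Fin.le_last i)
    rcases hm with rfl | rfl
    · obtain ⟨y, hy⟩ := Fans.exists_isCombData (S := {0} ∪ Set.range a) (M := a (Fin.last m))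
        ((Set.countable_singleton 0).union (Set.countable_range a))
        ⟨Or.inr ⟨_, rfl⟩, by
          rintro s (rfl | ⟨i, rfl⟩)
          exacts [(h01 _).1.le, hlast i]⟩ (h01 _).1
      obtain ⟨-, h1, -, h2, h3, h4⟩ := Fans.combFan_finite ha h01 hy
      exact ⟨_, _, h1, h2, h3, h4⟩
    -- The sigmoid increases strictly from `0` to `1`, so its scaled values at the integers have the
    -- required limits.
    · let p : ℤ → ℝ := fun i => a 0 * Real.sigmoid i
      have hp : StrictMono p := fun i j hij =>
        mul_lt_mul_of_pos_left (Real.sigmoid_strictMono (by exact_mod_cast hij)) (h01 0).1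
      have hp0 : Filter.Tendsto p Filter.atBot (nhds 0) := by
        simpa using (Real.tendsto_sigmoid_atBot.comp
          (tendsto_intCast_atBot_iff.2 tendsto_id)).const_mul (a 0)
      have hp1 : Filter.Tendsto p Filter.atTop (nhds (a 0)) := by
        simpa using (Real.tendsto_sigmoid_atTop.comp
          (tendsto_intCast_atTop_atTop (R := ℝ))).const_mul (a 0)
      obtain ⟨y, hy⟩ := Fans.exists_isCombData (S := Set.range p ∪ {0} ∪ Set.range a)
        (M := a (Fin.last m)) (((Set.countable_range p).union (Set.countable_singleton 0)).union
          (Set.countable_range a))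
        ⟨Or.inr ⟨_, rfl⟩, by
          rintro s ((⟨i, rfl⟩ | rfl) | ⟨i, rfl⟩)
          exacts [(Fans.mem_Ioo_of_tendsto hp hp0 hp1 i).2.le.trans (hlast 0), (h01 _).1.le,
            hlast i]⟩ (h01 _).1
      obtain ⟨-, h1, -, h2, h3, h4⟩ := Fans.combFan_shift ha (fun i => (h01 i).2) hp hp0 hp1 hy
      exact ⟨_, _, h1, h2, h3, h4⟩
  · rintro m a ha h01 S rfl M y h
    exact Fans.combFan_finite ha h01 h
  · rintro m a p ha ha1 hp hp0 hp1 S rfl M y h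
    exact Fans.combFan_shift ha ha1 hp hp0 hp1 h
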